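/- Let $n\ge 0$ and let $\mathrm{u}(n)$ be the skew-Hermitian $n\times n$ matrices. A *spatial pair* $(A,\phi)$ consists of Schwartz functions $A_x,A_y,\phi:\mathbb{R}^2\to \mathrm{u}(n)$. Put $\nabla_x=\partial_x-A_x$, $\nabla_y=\partial_y-A_y$, $\nabla_z=\frac12(\nabla_x-i\nabla_y)$, $\nabla_{\bar z}=\frac12(\nabla_x+i\nabla_y)$ and $$D_s(\mu)=\mu\nabla_z-\mu^{-1}\nabla_{\bar z}-i\phi .$$ A smooth $u:\mathbb{R}^2\to U(n)$ acts as a gauge transformation by $A\mapsto uAu^{-1}+(du)u^{-1}$, $\phi\mapsto u\phi u^{-1}$. The $W^{2,1}$ norm is the sum of the $L^1(\mathbb{R}^2)$ norms of all partial derivatives of order at most $2$. *Chern vector.* For $\mu\in(\mathbb{C}\cup\{\infty\})\setminus S^1$, the operator $D_s(\mu)$ (rescaled to $\mu D_s(\mu)$ at $\mu=0$ and to $\mu^{-1}D_s(\mu)$ at $\mu=\infty$) is a Cauchy–Riemann operator for the complex coordinate $w=\mu^{-1}z+\mu\bar z$ on $\mathbb{R}^2$ (up to a constant factor; $w=z$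 at $\mu=0$, $w=\bar z$ at $\mu=\infty$) and defines a rank $n$ holomorphic vector bundle on the sphere $\mathbb{R}^2\cup\{\infty\}$. The Chern vector $\vec c(\mu)=(c(1)\le\dots\le c(n))$ is the sequence of first Chern classes of the line bundles in its Grothendieck splitting. *Continuous scattering data.* $(A,\phi)$ has continuous scattering data with scattering matrix $S_\theta(x,y)$ if for some $\epsilon_0>0$ there are, for $\mu\in\mathcal{O}^{\pm}=\{1<|\mu|^{\pm1}<1+\epsilon_0\}$, invertible frames $E_\mu$ on $\mathbb{R}^2$ with $D_s(\mu)E_\mu=0$, $E_\mu\to I$ at infinity and $E_{\bar\mu^{-1}}=(E_\mu^*)^{-1}$, holomorphic in $\mu\in\mathcal{O}^\pm$, such that the limits $S^\pm_\theta=\lim_{\mu\in\mathcal{O}^\pm,\ \mu\to e^{i\theta}}E_\mu$ exist locally uniformly on $\mathbb{R}^2$ for all $\theta$, and $S_\theta=(S_\theta^-)^{-1}S_\theta^+=(S_\theta^+)^*S_\theta^+$. **Theorem.** For every $n$ and $\varepsilon>0$ there is $\delta>0$ with the following property. Let $J\subset\mathbb{R}$ be a set of times and, for $t\in J$, let $(A,\phi)(t)$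 be a spatial pair such that some gauge transformation takes it to a spatial pair of $W^{2,1}$ norm less than $\delta$. Then for every $t\in J$: 1. the Chern vector satisfies $\vec c(\mu)=0$ for every $\mu\in(\mathbb{C}\cup\{\infty\})\setminus S^1$; 2. $(A,\phi)(t)$ has continuous scattering data, whose scattering matrix is $S_\theta=I+G_\theta$ with $|G_\theta(x,y,t)|\le\varepsilon$ for all $\theta,x,y$ (so $G_\theta$ is small in $L^\infty_{(x,y,t)}$, uniformly in $\theta$); 3. $S_\theta^*=S_\theta\ge0$; 4. $d_{s,\theta}S_\theta=\left(-\sin\theta\,\partial_x+\cos\theta\,\partial_y\right)S_\theta=0$; 5. for each $\theta$, $S_\theta(x,y,t)\to I$ as $|x\cos\theta+y\sin\theta|\to\infty$. -/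

import Mathlib

open Filter Topology MeasureTheory
open scoped SchwartzMap ENNReal ContDiff ComplexOrder Matrix.Norms.L2Operator

namespace Monopole

/-- Complex `n × n` matrices (normed by the operator norm of `ℂⁿ`). -/
abbrev Mat (n : ℕ) : Type := Matrix (Fin n) (Fin n) ℂ

/-- A spatial pair `(A, φ)` at a fixed time: the spatial components `A_x, A_y` of a `u(n)`-connection
and a `u(n)`-valued Higgs field on the plane with coordinates `(x, y)`, all rapidly decaying
(Schwartz) and skew-Hermitian. -/
structure SpatialPair (n : ℕ) where
  Ax : 𝓢(ℝ × ℝ, Mat n)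
  Ay : 𝓢(ℝ × ℝ, Mat n)
  φ : 𝓢(ℝ × ℝ, Mat n)
  Ax_skew : ∀ p, star (Ax p) = -Ax p
  Ay_skew : ∀ p, star (Ay p) = -Ay p
  φ_skew : ∀ p, star (φ p) = -φ p

section

variable {n : ℕ}

/-- `∂f/∂x`. -/
noncomputable def pdx (f : ℝ × ℝ → Mat n) (p : ℝ × ℝ) : Mat n := fderiv ℝ f p (1, 0)

/-- `∂f/∂y`. -/
noncomputable def pdy (f : ℝ × ℝ → Mat n) (p : ℝ × ℝ) : Mat n := fderiv ℝ f p (0, 1)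

/-- The `L¹` norm on the plane. -/
noncomputable def normL1 (f : ℝ × ℝ → Mat n) : ℝ≥0∞ := ∫⁻ p, ‖f p‖ₑ

/-- The `W^{2,1}` norm: the sum of the `L¹` norms of all partial derivatives of order at most 2. -/
noncomputable def normW21 (f : ℝ × ℝ → Mat n) : ℝ≥0∞ :=
  normL1 f + normL1 (pdx f) + normL1 (pdy f) +
    normL1 (pdx (pdx f)) + normL1 (pdx (pdy f)) + normL1 (pdy (pdy f))

/-- The `W^{2,1}` norm of `(A, φ)`. -/
noncomputable def SpatialPair.normW21 (P : SpatialPair n) : ℝ≥0∞ :=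
  Monopole.normW21 P.Ax + Monopole.normW21 P.Ay + Monopole.normW21 P.φ

/-- `Q` is obtained from `P` by the smooth unitary gauge transformation `u`:
`A ↦ u A u⁻¹ + (∂u) u⁻¹` and `φ ↦ u φ u⁻¹` (where `u⁻¹ = u*`). -/
structure IsGaugeTransform (u : ℝ × ℝ → Mat n) (P Q : SpatialPair n) : Prop where
  smooth : ContDiff ℝ ∞ u
  unitary : ∀ p, u p ∈ Matrix.unitaryGroup (Fin n) ℂ
  Ax_eq : ∀ p, Q.Ax p = u p * P.Ax p * star (u p) + pdx u p * star (u p)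
  Ay_eq : ∀ p, Q.Ay p = u p * P.Ay p * star (u p) + pdy u p * star (u p)
  φ_eq : ∀ p, Q.φ p = u p * P.φ p * star (u p)

/-- `∇_x = ∂_x - A_x`. -/
noncomputable def nablaX (P : SpatialPair n) (E : ℝ × ℝ → Mat n) (p : ℝ × ℝ) : Mat n :=
  pdx E p - P.Ax p * E p

/-- `∇_y = ∂_y - A_y`. -/
noncomputable def nablaY (P : SpatialPair n) (E : ℝ × ℝ → Mat n) (p : ℝ × ℝ) : Mat n :=
  pdy E p - P.Ay p * E p

/-- `∇_z = (∇_x - i ∇_y) / 2`. -/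
noncomputable def nablaZ (P : SpatialPair n) (E : ℝ × ℝ → Mat n) (p : ℝ × ℝ) : Mat n :=
  (1 / 2 : ℂ) • (nablaX P E p - Complex.I • nablaY P E p)

/-- `∇_z̄ = (∇_x + i ∇_y) / 2`. -/
noncomputable def nablaZbar (P : SpatialPair n) (E : ℝ × ℝ → Mat n) (p : ℝ × ℝ) : Mat n :=
  (1 / 2 : ℂ) • (nablaX P E p + Complex.I • nablaY P E p)

/-- The spatial operator `D_s(μ) = μ ∇_z - μ⁻¹ ∇_z̄ - i φ`, for `μ ≠ 0`. -/
noncomputable def spatialOp (P : SpatialPair n) (μ : ℂ) (E : ℝ × ℝ → Mat n) (p : ℝ × ℝ) : Mat n :=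
  μ • nablaZ P E p - μ⁻¹ • nablaZbar P E p - Complex.I • (P.φ p * E p)

/-- The second form of `D_s(μ)`. -/
theorem spatialOp_eq (P : SpatialPair n) (μ : ℂ) (E : ℝ × ℝ → Mat n) (p : ℝ × ℝ) :
    spatialOp P μ E p = ((μ - μ⁻¹) / 2) • nablaX P E p
      - (Complex.I * (μ + μ⁻¹) / 2) • nablaY P E p - Complex.I • (P.φ p * E p) := by
  simp only [spatialOp, nablaZ, nablaZbar]
  module

/-- The Cauchy-Riemann operator of the bundle over the sphere `ℝ² ∪ {∞}` attached to a spectral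
parameter in `ℂ ∪ {∞}`: it is `D_s(μ)` rescaled so as to make sense at `0` and `∞`, namely
`μ D_s(μ) = μ² ∇_z - ∇_z̄ - i μ φ` for finite `μ`, and
`∇_z = lim μ⁻¹ D_s(μ)` at `μ = ∞`. -/
noncomputable def bundleOp (P : SpatialPair n) (μ : OnePoint ℂ) (E : ℝ × ℝ → Mat n)
    (p : ℝ × ℝ) : Mat n :=
  μ.elim (nablaZ P E p)
    (fun m => m ^ 2 • nablaZ P E p - nablaZbar P E p - (Complex.I * m) • (P.φ p * E p))

theorem bundleOp_coe (P : SpatialPair n) {μ : ℂ} (hμ : μ ≠ 0) (E : ℝ × ℝ → Mat n) (p : ℝ × ℝ) :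
    bundleOp P (μ : OnePoint ℂ) E p = μ • spatialOp P μ E p := by
  simp only [bundleOp, spatialOp, OnePoint.elim_some, smul_sub, smul_smul, mul_inv_cancel₀ hμ,
    one_smul, pow_two, mul_comm]

/-- The complex coordinate on `ℝ²` that is annihilated by the scalar part of the operator above:
up to a constant factor, `w = μ⁻¹ z + μ z̄`; `w = z` at `μ = 0` and `w = z̄` at `μ = ∞`. -/
noncomputable def coordW (μ : OnePoint ℂ) (p : ℝ × ℝ) : ℂ :=
  μ.elim ((p.1 : ℂ) - p.2 * Complex.I)
    (fun m => ((p.1 : ℂ) + p.2 * Complex.I) + m ^ 2 * ((p.1 : ℂ) - p.2 * Complex.I))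

/-- `c` is the Chern vector at `μ` (off the unit circle): `c(1) ≤ ⋯ ≤ c(n)` and the holomorphic
bundle over the sphere `ℝ² ∪ {∞}` (with complex coordinate `w`) defined by the spatial operator
is isomorphic to `𝒪(c(1)) ⊕ ⋯ ⊕ 𝒪(c(n))`. Here `𝒪(c)`, of first Chern class `c`, is
glued from trivial bundles over `ℝ²` and over a neighbourhood of `∞` by `w^{-c}`; an isomorphism
is given by a holomorphic frame `E` over `ℝ²` and a holomorphic frame `F` near `∞`, the latter
extending to `∞`, that are related by the transition matrix `diag (w^{-c(i)})`. The rapidly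
decaying operator extends smoothly over `∞`, in the trivialization in which it is written;
solutions that are `C¹`, and continuous at `∞`, are automatically smooth. -/
def IsChernVector (P : SpatialPair n) (μ : OnePoint ℂ) (c : Fin n → ℤ) : Prop :=
  Monotone c ∧ ∃ (E F : ℝ × ℝ → Mat n) (R : ℝ) (F' : Mat n), 0 ≤ R ∧
    ContDiff ℝ 1 E ∧ (∀ p, IsUnit (E p)) ∧ (∀ p, bundleOp P μ E p = 0) ∧
    ContDiffOn ℝ 1 F {p | R < ‖p‖} ∧
    (∀ p, R < ‖p‖ → IsUnit (F p)) ∧ (∀ p, R < ‖p‖ → bundleOp P μ F p = 0) ∧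
    Tendsto F (cocompact (ℝ × ℝ)) (𝓝 F') ∧ IsUnit F' ∧
    ∀ p, R < ‖p‖ → E p = F p * Matrix.diagonal (fun i => coordW μ p ^ (-(c i)))

/-- `E` solves `D_s(μ) E = 0` on the plane, with `E(∞) = I`. -/
structure IsSpatialFrame (P : SpatialPair n) (μ : ℂ) (E : ℝ × ℝ → Mat n) : Prop where
  contDiff : ContDiff ℝ 1 E
  eq_zero : ∀ p, spatialOp P μ E p = 0
  tendsto_one : Tendsto E (cocompact (ℝ × ℝ)) (𝓝 1)

end

/-- `𝒪⁺_ε = {1 < |μ| < 1 + ε}`. -/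
def outerAnnulus (ε : ℝ) : Set ℂ := {μ | 1 < ‖μ‖ ∧ ‖μ‖ < 1 + ε}

/-- `𝒪⁻_ε = {1 < |μ|⁻¹ < 1 + ε}`. -/
def innerAnnulus (ε : ℝ) : Set ℂ := {μ | 1 < ‖μ‖⁻¹ ∧ ‖μ‖⁻¹ < 1 + ε}

/-- `(A, φ)` has continuous scattering data, with scattering matrix `S θ = S_θ`: there are frames
`E_μ` on both sides of the unit circle which satisfy the reality condition
`E_{1/μ̄} = (E_μ*)⁻¹`, are holomorphic in `μ`, and have limits `S^±_θ` as `μ → e^{iθ}` in `𝒪^±_ε`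
(as functions on the plane, locally uniformly), and
`S_θ = (S⁻_θ)⁻¹ S⁺_θ = (S⁺_θ)* S⁺_θ`. -/
def HasContinuousScatteringData {n : ℕ} (P : SpatialPair n) (S : ℝ → ℝ × ℝ → Mat n) : Prop :=
  ∃ ε : ℝ, 0 < ε ∧ ∃ (E : ℂ → ℝ × ℝ → Mat n) (Splus Sminus : ℝ → ℝ × ℝ → Mat n),
    (∀ μ ∈ outerAnnulus ε ∪ innerAnnulus ε, IsSpatialFrame P μ (E μ)) ∧
    (∀ μ ∈ outerAnnulus ε ∪ innerAnnulus ε, ∀ p,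
      IsUnit (E μ p) ∧ E (starRingEnd ℂ μ)⁻¹ p = (star (E μ p))⁻¹) ∧
    (∀ p, DifferentiableOn ℂ (fun μ => E μ p) (outerAnnulus ε)) ∧
    (∀ p, DifferentiableOn ℂ (fun μ => E μ p) (innerAnnulus ε)) ∧
    (∀ θ : ℝ, TendstoLocallyUniformly E (Splus θ)
      (𝓝[outerAnnulus ε] Complex.exp (θ * Complex.I))) ∧
    (∀ θ : ℝ, TendstoLocallyUniformly E (Sminus θ)
      (𝓝[innerAnnulus ε] Complex.exp (θ * Complex.I))) ∧
    ∀ θ p, IsUnit (Sminus θ p) ∧ S θ p = (Sminus θ p)⁻¹ * Splus θ p ∧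
      S θ p = star (Splus θ p) * Splus θ p

end Monopole

/-! Away from the unit circle the spatial equation is a Cauchy–Riemann equation with a small
potential, and on the circle it degenerates to a transport equation. The point is an estimate that
is uniform up to the circle. Dividing by the coefficient of one of the two partial derivatives
brings the equation to the form `∂_τ E + γ ∂_s E = a E`, where `Im γ ≥ 0` exactly when `|μ| ≥ 1`.
After a Fourier transform in `s`, each frequency `ξ` satisfies an ordinary differential equation in
`τ`. It is solved forwards in `τ` for `ξ > 0` and backwards for `ξ < 0`; with this choice the
propagator is multiplication by a function of modulus at most `1`, also for real `γ`.

So the equation is solved in `L¹` of the frequency variable, where products become convolutions and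
the sup norm of the solution is controlled. The potential enters through the integral over `τ` of
the `L¹` norm of its partial transform, and two derivatives in `s` give an integrable factor `(1 +
ξ²)⁻¹`; this is how smallness in `W^{2,1}` is used. A contraction (`exists_evolution`) then gives a
frame close to `1`, jointly continuous in the parameter and the point for `|μ| ≥ 1` and holomorphic
for `|μ| > 1` (`exists_chart`). A weight `1 + ρ|ξ|` with small `ρ` makes these solutions `C¹`
without affecting the size estimate.

Two such charts, one for each partial derivative, cover all `|μ| ≥ 1` (`exists_upperChart`). For
`|μ| > 1` the frames tend to `1` at infinity, hence are unique by Liouville's theorem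
(`IsFrameAt.eq`), so the charts fit together (`exists_hasUpperFrames`). Inside the disc one takes
`(E*)⁻¹` at the reflected parameter, since the potentials are skew-Hermitian. A gauge transformation
`u` between Schwartz pairs has a unitary limit `c` at infinity, and `u* E c` carries a frame for the
small pair to one for the given pair.

A global frame `E₀` tending to `1` forces the Chern vector to vanish: for a frame `E` of a
splitting, `E₀⁻¹ E` is entire and invertible, and a nonzero degree would make a column of it, or a
row of its inverse, decay and therefore vanish (`IsFrameAt.isChernVector_iff`). On the circle the
operator is, up to a factor, a real vector field plus a skew-Hermitian potential, so `S = T* T` is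
annihilated by the vector field. Its limit along one transversal line, which the Riemann–Lebesgue
lemma provides, then gives the limit in the remaining variable. -/

namespace Monopole

/-! ### Multipliers on `L¹` of the frequency line. -/

section WeightedL1

/-- The Banach space `L¹(ℝ; R)`. -/
abbrev LOne (R : Type*) [NormedRing R] : Type _ := Lp R 1 (volume : Measure ℝ)

theorem lOne_integrable {R : Type*} [NormedRing R] (a : LOne R) : Integrable a :=
  L1.integrable_coeFn a

variable {R : Type*} [NormedRing R] [NormedAlgebra ℂ R]

/-- Bounded measurable multipliers. -/
def BddMultiplier (m : ℝ → ℂ) : Prop := Measurable m ∧ ∃ C, ∀ ξ, ‖m ξ‖ ≤ C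

theorem BddMultiplier.integrable_smul {m : ℝ → ℂ} (hm : BddMultiplier m) {f : ℝ → R}
    (hf : Integrable f) : Integrable (fun ξ => m ξ • f ξ) := by
  obtain ⟨h, C, hC⟩ := hm
  exact hf.bdd_smul C h.aestronglyMeasurable (Eventually.of_forall hC)

open Classical in
/-- Multiplication of `L¹` functions by a bounded measurable function (`0` for other functions). -/
noncomputable def mulL1 (m : ℝ → ℂ) : LOne R →L[ℂ] LOne R :=
  if hm : BddMultiplier m then
    LinearMap.mkContinuousOfExistsBound
      { toFun := fun a => (hm.integrable_smul (lOne_integrable a)).toL1 _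
        map_add' := fun a b => by
          rw [← Integrable.toL1_add]
          refine (Integrable.toL1_eq_toL1_iff _ _ _ _).2 ?_
          filter_upwards [Lp.coeFn_add a b] with ξ h
          rw [h, Pi.add_apply, smul_add, Pi.add_apply]
        map_smul' := fun c a => by
          rw [RingHom.id_apply, ← Integrable.toL1_smul]
          refine (Integrable.toL1_eq_toL1_iff _ _ _ _).2 ?_
          filter_upwards [Lp.coeFn_smul c a] with ξ h
          rw [h, Pi.smul_apply, smul_comm] }
      (by
        obtain ⟨C, hC⟩ := hm.2
        refine ⟨C, fun a => ?_⟩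
        change ‖(hm.integrable_smul (lOne_integrable a)).toL1 _‖ ≤ _
        rw [L1.norm_of_fun_eq_integral_norm, L1.norm_eq_integral_norm, ← integral_const_mul]
        refine integral_mono (hm.integrable_smul (lOne_integrable a)).norm
          ((lOne_integrable a).norm.const_mul _) fun ξ => ?_
        simp only [norm_smul]
        gcongr
        exact hC ξ)
  else 0

theorem coeFn_mulL1 {m : ℝ → ℂ} (hm : BddMultiplier m) (a : LOne R) :
    mulL1 m a =ᵐ[volume] fun ξ => m ξ • a ξ := by
  have : mulL1 m a = (hm.integrable_smul (lOne_integrable a)).toL1 _ := by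
    rw [mulL1, dif_pos hm]; rfl
  rw [this]
  exact Integrable.coeFn_toL1 _

theorem norm_mulL1_apply {m : ℝ → ℂ} (hm : BddMultiplier m) (a : LOne R) :
    ‖mulL1 m a‖ = ∫ ξ, ‖m ξ • a ξ‖ := by
  rw [L1.norm_eq_integral_norm]
  refine integral_congr_ae ?_
  filter_upwards [coeFn_mulL1 hm a] with ξ h
  rw [h]

theorem norm_mulL1_apply_le {m : ℝ → ℂ} {C : ℝ} (hm : Measurable m) (hC : ∀ ξ, ‖m ξ‖ ≤ C)
    (a : LOne R) : ‖mulL1 m a‖ ≤ C * ‖a‖ := by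
  rw [norm_mulL1_apply ⟨hm, C, hC⟩, L1.norm_eq_integral_norm, ← integral_const_mul]
  refine integral_mono (BddMultiplier.integrable_smul ⟨hm, C, hC⟩ (lOne_integrable a)).norm
    ((lOne_integrable a).norm.const_mul _) fun ξ => ?_
  simp only [norm_smul]
  gcongr
  exact hC ξ

theorem norm_mulL1_le {m : ℝ → ℂ} {C : ℝ} (hm : Measurable m) (hC : ∀ ξ, ‖m ξ‖ ≤ C) :
    ‖(mulL1 m : LOne R →L[ℂ] LOne R)‖ ≤ C :=
  ContinuousLinearMap.opNorm_le_bound _ ((norm_nonneg _).trans (hC 0))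
    (norm_mulL1_apply_le hm hC)

theorem mulL1_sub {m m' : ℝ → ℂ} (hm : BddMultiplier m) (hm' : BddMultiplier m') :
    (mulL1 (fun ξ => m ξ - m' ξ) : LOne R →L[ℂ] LOne R) = mulL1 m - mulL1 m' := by
  have hs : BddMultiplier fun ξ => m ξ - m' ξ := by
    obtain ⟨h, C, hC⟩ := hm
    obtain ⟨h', C', hC'⟩ := hm'
    exact ⟨h.sub h', C + C', fun ξ => (norm_sub_le _ _).trans (add_le_add (hC ξ) (hC' ξ))⟩
  ext1 a
  refine Lp.ext ?_
  rw [_root_.sub_apply]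
  filter_upwards [coeFn_mulL1 hs a, coeFn_mulL1 hm a, coeFn_mulL1 hm' a,
    Lp.coeFn_sub (mulL1 m a) (mulL1 m' a)] with ξ h1 h2 h3 h4
  rw [h1, h4, Pi.sub_apply, h2, h3, sub_smul]

theorem mulL1_const_mul {m : ℝ → ℂ} (hm : BddMultiplier m) (c : ℂ) :
    (mulL1 (fun ξ => c * m ξ) : LOne R →L[ℂ] LOne R) = c • mulL1 m := by
  have hs : BddMultiplier fun ξ => c * m ξ := by
    obtain ⟨h, C, hC⟩ := hm
    refine ⟨h.const_mul c, ‖c‖ * C, fun ξ => ?_⟩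
    rw [norm_mul]
    gcongr
    exact hC ξ
  ext1 a
  refine Lp.ext ?_
  rw [_root_.smul_apply]
  filter_upwards [coeFn_mulL1 hs a, coeFn_mulL1 hm a, Lp.coeFn_smul c (mulL1 m a)] with ξ h1 h2 h4
  rw [h1, h4, Pi.smul_apply, h2, mul_smul]

theorem mulL1_mulL1 {m m' : ℝ → ℂ} (hm : BddMultiplier m) (hm' : BddMultiplier m') (a : LOne R) :
    mulL1 m (mulL1 m' a) = mulL1 (fun ξ => m ξ * m' ξ) a := by
  have hs : BddMultiplier fun ξ => m ξ * m' ξ := by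
    obtain ⟨h, C, hC⟩ := hm
    obtain ⟨h', C', hC'⟩ := hm'
    refine ⟨h.mul h', C * C', fun ξ => ?_⟩
    rw [norm_mul]
    exact mul_le_mul (hC ξ) (hC' ξ) (norm_nonneg _) ((norm_nonneg _).trans (hC ξ))
  refine Lp.ext ?_
  filter_upwards [coeFn_mulL1 hs a, coeFn_mulL1 hm (mulL1 m' a), coeFn_mulL1 hm' a] with ξ h1 h2 h3
  rw [h1, h2, h3, mul_smul]

/-- Dominated convergence for multipliers. -/
theorem tendsto_mulL1 {ι : Type*} {l : Filter ι} [l.IsCountablyGenerated] {m : ι → ℝ → ℂ}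
    {m₀ : ℝ → ℂ} {C : ℝ} (hm : ∀ i, Measurable (m i)) (hC : ∀ i ξ, ‖m i ξ‖ ≤ C)
    (hm₀ : Measurable m₀) (hC₀ : ∀ ξ, ‖m₀ ξ‖ ≤ C)
    (hlim : ∀ᵐ ξ : ℝ, Tendsto (fun i => m i ξ) l (𝓝 (m₀ ξ)))
    {a : ι → LOne R} {a₀ : LOne R} (ha : Tendsto a l (𝓝 a₀)) :
    Tendsto (fun i => mulL1 (m i) (a i)) l (𝓝 (mulL1 m₀ a₀)) := by
  have hb : ∀ i, BddMultiplier (m i) := fun i => ⟨hm i, C, hC i⟩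
  have hb₀ : BddMultiplier m₀ := ⟨hm₀, C, hC₀⟩
  have h1 : Tendsto (fun i => mulL1 (m i) a₀) l (𝓝 (mulL1 m₀ a₀)) := by
    rw [tendsto_iff_norm_sub_tendsto_zero]
    have heq : ∀ i, ‖mulL1 (m i) a₀ - mulL1 m₀ a₀‖ = ∫ ξ, ‖(m i ξ - m₀ ξ) • a₀ ξ‖ := by
      intro i
      have hs : BddMultiplier fun ξ => m i ξ - m₀ ξ :=
        ⟨(hm i).sub hm₀, C + C, fun ξ => (norm_sub_le _ _).trans (add_le_add (hC i ξ) (hC₀ ξ))⟩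
      rw [← norm_mulL1_apply hs, mulL1_sub (hb i) hb₀, _root_.sub_apply]
    simp only [heq]
    have h0 : (0 : ℝ) = ∫ ξ : ℝ, (0 : ℝ) := by simp
    rw [h0]
    refine tendsto_integral_filter_of_dominated_convergence (fun ξ => (C + C) * ‖a₀ ξ‖) ?_ ?_
      ((lOne_integrable a₀).norm.const_mul _) ?_
    · refine Eventually.of_forall fun i => ?_
      exact (((hm i).sub hm₀).aestronglyMeasurable.smul
        (lOne_integrable a₀).aestronglyMeasurable).norm
    · refine Eventually.of_forall fun i => Eventually.of_forall fun ξ => ?_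
      rw [norm_norm, norm_smul]
      gcongr
      exact (norm_sub_le _ _).trans (add_le_add (hC i ξ) (hC₀ ξ))
    · filter_upwards [hlim] with ξ hξ
      have := ((hξ.sub_const (m₀ ξ)).smul_const (a₀ ξ)).norm
      simpa using this
  have h2 : Tendsto (fun i => mulL1 (m i) (a i - a₀)) l (𝓝 0) := by
    rw [tendsto_zero_iff_norm_tendsto_zero]
    have h3 : Tendsto (fun i => C * ‖a i - a₀‖) l (𝓝 0) := by
      simpa using (tendsto_iff_norm_sub_tendsto_zero.1 ha).const_mul C
    exact squeeze_zero (fun _ => norm_nonneg _) (fun i => norm_mulL1_apply_le (hm i) (hC i) _) h3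
  have := h2.add h1
  simpa using this

/-- The pairing of an `L¹` function with a multiplier. -/
noncomputable def pairL1 [CompleteSpace R] (m : ℝ → ℂ) : LOne R →L[ℂ] R :=
  (L1.integralCLM' ℂ).comp (mulL1 m)

variable [CompleteSpace R]

theorem pairL1_apply {m : ℝ → ℂ} (hm : BddMultiplier m) (a : LOne R) :
    pairL1 m a = ∫ ξ, m ξ • a ξ := by
  have : pairL1 m a = L1.integral (mulL1 m a) := by
    rw [L1.integral_eq' ℂ]; rfl
  rw [this, L1.integral_eq_integral]
  exact integral_congr_ae (coeFn_mulL1 hm a)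

theorem norm_pairL1_apply_le {m : ℝ → ℂ} {C : ℝ} (hm : Measurable m) (hC : ∀ ξ, ‖m ξ‖ ≤ C)
    (a : LOne R) : ‖pairL1 m a‖ ≤ C * ‖a‖ := by
  have : pairL1 m a = L1.integral (mulL1 m a) := by
    rw [L1.integral_eq' ℂ]; rfl
  rw [this]
  exact (L1.norm_integral_le _).trans (norm_mulL1_apply_le hm hC a)

theorem pairL1_mulL1 {m m' : ℝ → ℂ} (hm : BddMultiplier m) (hm' : BddMultiplier m') (a : LOne R) :
    pairL1 m (mulL1 m' a) = pairL1 (fun ξ => m ξ * m' ξ) a := by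
  simp only [pairL1, ContinuousLinearMap.comp_apply, mulL1_mulL1 hm hm']

theorem tendsto_pairL1 {ι : Type*} {l : Filter ι} [l.IsCountablyGenerated] {m : ι → ℝ → ℂ}
    {m₀ : ℝ → ℂ} {C : ℝ} (hm : ∀ i, Measurable (m i)) (hC : ∀ i ξ, ‖m i ξ‖ ≤ C)
    (hm₀ : Measurable m₀) (hC₀ : ∀ ξ, ‖m₀ ξ‖ ≤ C)
    (hlim : ∀ᵐ ξ : ℝ, Tendsto (fun i => m i ξ) l (𝓝 (m₀ ξ)))
    {a : ι → LOne R} {a₀ : LOne R} (ha : Tendsto a l (𝓝 a₀)) :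
    Tendsto (fun i => pairL1 (m i) (a i)) l (𝓝 (pairL1 m₀ a₀)) :=
  ((L1.integralCLM' ℂ).continuous.tendsto _).comp (tendsto_mulL1 hm hC hm₀ hC₀ hlim ha)

end WeightedL1

/-! ### The weighted convolution algebra and evaluation by the Fourier transform. -/

section WeightedConvolution

open scoped Convolution FourierTransform
open ContinuousLinearMap

variable {R : Type*} [NormedRing R] [NormedAlgebra ℂ R]

/-- The weight `1 + ρ |ξ|`. -/
noncomputable def wt (ρ ξ : ℝ) : ℝ := 1 + |ρ| * |ξ|

theorem one_le_wt (ρ ξ : ℝ) : 1 ≤ wt ρ ξ := by unfold wt; nlinarith [abs_nonneg ρ, abs_nonneg ξ, mul_nonneg (abs_nonneg ρ) (abs_nonneg ξ)]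

theorem wt_pos (ρ ξ : ℝ) : 0 < wt ρ ξ := zero_lt_one.trans_le (one_le_wt ρ ξ)

theorem continuous_wt (ρ : ℝ) : Continuous (wt ρ) := by unfold wt; fun_prop

/-- Submultiplicativity of the weight is what makes weighted `L¹` an algebra under convolution with
constant `1`, whatever `ρ` is. -/
theorem wt_add_le (ρ ξ η : ℝ) : wt ρ (ξ + η) ≤ wt ρ ξ * wt ρ η := by
  unfold wt
  have h := mul_le_mul_of_nonneg_left (abs_add_le ξ η) (abs_nonneg ρ)
  have h' : 0 ≤ (|ρ| * |ξ|) * (|ρ| * |η|) := by positivity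
  linarith

/-- The function represented by an element of `LOne R`, i.e. the quotient by the weight. -/
noncomputable def unwt (ρ : ℝ) (a : LOne R) (ξ : ℝ) : R := ((wt ρ ξ)⁻¹ : ℂ) • a ξ

theorem bddMultiplier_wt_inv (ρ : ℝ) : BddMultiplier fun ξ => ((wt ρ ξ)⁻¹ : ℂ) := by
  refine ⟨(Complex.measurable_ofReal.comp (continuous_wt ρ).measurable).inv, 1, fun ξ => ?_⟩
  rw [norm_inv, Complex.norm_real, Real.norm_of_nonneg (wt_pos ρ ξ).le]
  exact inv_le_one_of_one_le₀ (one_le_wt ρ ξ)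

theorem integrable_unwt (ρ : ℝ) (a : LOne R) : Integrable (unwt ρ a) :=
  (bddMultiplier_wt_inv ρ).integrable_smul (lOne_integrable a)

theorem norm_unwt (ρ : ℝ) (a : LOne R) (ξ : ℝ) : ‖unwt ρ a ξ‖ = (wt ρ ξ)⁻¹ * ‖a ξ‖ := by
  rw [unwt, norm_smul, norm_inv, Complex.norm_real, Real.norm_of_nonneg (wt_pos ρ ξ).le]

/-- The weighted convolution of two representatives. -/
noncomputable def wconv (ρ : ℝ) (b a : LOne R) (ξ : ℝ) : R :=
  (wt ρ ξ : ℂ) • (unwt ρ b ⋆[mul ℂ R, volume] unwt ρ a) ξ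

/-- Since `w(ξ) ≤ w(t) w(ξ - t)`, the weights can be pulled inside the convolution integral and
cancel. -/
theorem ae_norm_wconv_le (ρ : ℝ) (b a : LOne R) : ∀ᵐ ξ : ℝ, ‖wconv ρ b a ξ‖ ≤
    ((fun η => ‖b η‖) ⋆[mul ℝ ℝ, volume] (fun η => ‖a η‖)) ξ := by
  filter_upwards [(lOne_integrable b).norm.ae_convolution_exists (mul ℝ ℝ)
    (lOne_integrable a).norm] with ξ hξ
  rw [wconv, norm_smul, Complex.norm_real, Real.norm_of_nonneg (wt_pos ρ ξ).le, convolution,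
    convolution]
  calc wt ρ ξ * ‖∫ t, (mul ℂ R) (unwt ρ b t) (unwt ρ a (ξ - t))‖
      ≤ wt ρ ξ * ∫ t, (wt ρ ξ)⁻¹ * (‖b t‖ * ‖a (ξ - t)‖) := by
        refine mul_le_mul_of_nonneg_left ?_ (wt_pos ρ ξ).le
        refine norm_integral_le_of_norm_le (Integrable.const_mul hξ.integrable _)
          (Eventually.of_forall fun t => ?_)
        simp only [mul_apply']
        refine (norm_mul_le _ _).trans ?_
        rw [norm_unwt, norm_unwt]
        have h1 := wt_add_le ρ t (ξ - t)
        rw [add_sub_cancel] at h1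
        have h2 := wt_pos ρ t
        have h3 := wt_pos ρ (ξ - t)
        have h4 : (wt ρ t)⁻¹ * (wt ρ (ξ - t))⁻¹ ≤ (wt ρ ξ)⁻¹ := by
          rw [← mul_inv]
          exact inv_anti₀ (wt_pos ρ ξ) h1
        calc _ = (wt ρ t)⁻¹ * (wt ρ (ξ - t))⁻¹ * (‖b t‖ * ‖a (ξ - t)‖) := by ring
          _ ≤ _ := by gcongr
    _ = _ := by
        rw [integral_const_mul, mul_inv_cancel_left₀ (wt_pos ρ ξ).ne']
        rfl

theorem integrable_wconv (ρ : ℝ) (b a : LOne R) : Integrable (wconv ρ b a) := by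
  refine Integrable.mono' ((lOne_integrable b).norm.integrable_convolution (mul ℝ ℝ)
    (lOne_integrable a).norm) ?_ (ae_norm_wconv_le ρ b a)
  exact (Complex.continuous_ofReal.comp (continuous_wt ρ)).aestronglyMeasurable.smul
    ((integrable_unwt ρ b).integrable_convolution _ (integrable_unwt ρ a)).aestronglyMeasurable

theorem unwt_add (ρ : ℝ) (a b : LOne R) : unwt ρ (a + b) =ᵐ[volume] unwt ρ a + unwt ρ b := by
  filter_upwards [Lp.coeFn_add a b] with ξ h
  simp only [unwt, h, Pi.add_apply, smul_add]

theorem unwt_smul (ρ : ℝ) (c : ℂ) (a : LOne R) : unwt ρ (c • a) =ᵐ[volume] c • unwt ρ a := by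
  filter_upwards [Lp.coeFn_smul c a] with ξ h
  rw [unwt, h, Pi.smul_apply, smul_comm, Pi.smul_apply, unwt]

theorem norm_toL1_wconv_le (ρ : ℝ) (b a : LOne R) :
    ‖(integrable_wconv ρ b a).toL1 _‖ ≤ ‖b‖ * ‖a‖ := by
  rw [L1.norm_of_fun_eq_integral_norm, L1.norm_eq_integral_norm, L1.norm_eq_integral_norm]
  have h := integral_convolution (mul ℝ ℝ) (lOne_integrable b).norm (lOne_integrable a).norm
    (μ := volume) (ν := volume)
  rw [mul_apply'] at h
  rw [← h]
  exact integral_mono_ae (integrable_wconv ρ b a).norm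
    ((lOne_integrable b).norm.integrable_convolution (mul ℝ ℝ) (lOne_integrable a).norm)
    (ae_norm_wconv_le ρ b a)

/-- Weighted convolution as a bounded bilinear map on `LOne R`. -/
noncomputable def convL1 (ρ : ℝ) : LOne R →L[ℂ] LOne R →L[ℂ] LOne R :=
  LinearMap.mkContinuous₂
    (LinearMap.mk₂ ℂ (fun b a => (integrable_wconv ρ b a).toL1 _)
      (fun b b' a => by
        rw [← Integrable.toL1_add]
        refine (Integrable.toL1_eq_toL1_iff _ _ _ _).2 ?_
        filter_upwards [(integrable_unwt ρ b).ae_convolution_exists (mul ℂ R) (integrable_unwt ρ a),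
          (integrable_unwt ρ b').ae_convolution_exists (mul ℂ R) (integrable_unwt ρ a)] with ξ h h'
        rw [Pi.add_apply, wconv, wconv, wconv, ← smul_add, ← h.add_distrib h']
        congr 1
        rw [convolution_congr (mul ℂ R) (unwt_add ρ b b') (ae_eq_refl _)])
      (fun c b a => by
        rw [← Integrable.toL1_smul]
        refine (Integrable.toL1_eq_toL1_iff _ _ _ _).2 (Eventually.of_forall fun ξ => ?_)
        simp only [wconv]
        rw [convolution_congr (mul ℂ R) (unwt_smul ρ c b) (ae_eq_refl _), smul_convolution,
          Pi.smul_apply, smul_comm])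
      (fun b a a' => by
        rw [← Integrable.toL1_add]
        refine (Integrable.toL1_eq_toL1_iff _ _ _ _).2 ?_
        filter_upwards [(integrable_unwt ρ b).ae_convolution_exists (mul ℂ R) (integrable_unwt ρ a),
          (integrable_unwt ρ b).ae_convolution_exists (mul ℂ R) (integrable_unwt ρ a')] with ξ h h'
        rw [Pi.add_apply, wconv, wconv, wconv, ← smul_add, ← h.distrib_add h']
        congr 1
        rw [convolution_congr (mul ℂ R) (ae_eq_refl _) (unwt_add ρ a a')])
      (fun c b a => by
        rw [← Integrable.toL1_smul]
        refine (Integrable.toL1_eq_toL1_iff _ _ _ _).2 (Eventually.of_forall fun ξ => ?_)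
        simp only [wconv]
        rw [convolution_congr (mul ℂ R) (ae_eq_refl _) (unwt_smul ρ c a), convolution_smul,
          Pi.smul_apply, smul_comm])) 1
    (fun b a => by
      rw [LinearMap.mk₂_apply, one_mul]
      exact norm_toL1_wconv_le ρ b a)

theorem coeFn_convL1 (ρ : ℝ) (b a : LOne R) : convL1 ρ b a =ᵐ[volume] wconv ρ b a :=
  Integrable.coeFn_toL1 (integrable_wconv ρ b a)

theorem norm_convL1_le (ρ : ℝ) (b a : LOne R) : ‖convL1 ρ b a‖ ≤ ‖b‖ * ‖a‖ :=
  norm_toL1_wconv_le ρ b a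

/-- The multiplier `ξ ↦ exp (-2π i s ξ) / w(ξ)`. -/
noncomputable def evMult (ρ s ξ : ℝ) : ℂ := (Real.fourierChar (-(ξ * s)) : ℂ) * ((wt ρ ξ)⁻¹ : ℂ)

theorem measurable_evMult (ρ s : ℝ) : Measurable (evMult ρ s) := by
  refine Measurable.mul ?_ (bddMultiplier_wt_inv ρ).1
  exact (continuous_subtype_val.comp (Real.continuous_fourierChar.comp (by fun_prop))).measurable

theorem norm_evMult_le (ρ s ξ : ℝ) : ‖evMult ρ s ξ‖ ≤ 1 := by
  rw [evMult, norm_mul, Circle.norm_coe, one_mul, norm_inv, Complex.norm_real,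
    Real.norm_of_nonneg (wt_pos ρ ξ).le]
  exact inv_le_one_of_one_le₀ (one_le_wt ρ ξ)

theorem bddMultiplier_evMult (ρ s : ℝ) : BddMultiplier (evMult ρ s) :=
  ⟨measurable_evMult ρ s, 1, norm_evMult_le ρ s⟩

variable [CompleteSpace R]

/-- The value at `s` of the Fourier transform of the function represented by an `L¹` class. -/
noncomputable def ev (ρ s : ℝ) : LOne R →L[ℂ] R := pairL1 (evMult ρ s)

theorem norm_ev_le (ρ s : ℝ) (a : LOne R) : ‖ev ρ s a‖ ≤ ‖a‖ := by
  simpa [ev] using norm_pairL1_apply_le (measurable_evMult ρ s) (norm_evMult_le ρ s) a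

theorem ev_eq_fourier (ρ s : ℝ) (a : LOne R) : ev ρ s a = 𝓕 (unwt ρ a) s := by
  rw [ev, pairL1_apply (bddMultiplier_evMult ρ s), Real.fourier_eq]
  refine integral_congr_ae (Eventually.of_forall fun ξ => ?_)
  simp only [evMult, unwt, mul_smul, RCLike.inner_apply, conj_trivial, Circle.smul_def, mul_comm s]

/-- The Fourier transform turns convolution into the pointwise product, so the product of the
potential with the unknown frame acts as `convL1` on the frequency side. -/
theorem ev_convL1 (ρ s : ℝ) (b a : LOne R) : ev ρ s (convL1 ρ b a) = ev ρ s b * ev ρ s a := by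
  rw [ev_eq_fourier, ev_eq_fourier, ev_eq_fourier,
    ← Real.fourier_mul_convolution_eq (integrable_unwt ρ b) (integrable_unwt ρ a)]
  have h : unwt ρ (convL1 ρ b a) =ᵐ[volume] (unwt ρ b ⋆[mul ℂ R, volume] unwt ρ a) := by
    filter_upwards [coeFn_convL1 ρ b a] with ξ hξ
    rw [unwt, hξ, wconv, smul_smul, inv_mul_cancel₀, one_smul]
    exact_mod_cast (wt_pos ρ ξ).ne'
  rw [Real.fourier_eq, Real.fourier_eq]
  refine integral_congr_ae ?_
  filter_upwards [h] with ξ hξ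
  rw [hξ]

/-- The Riemann–Lebesgue lemma. It is the only source of decay in `s`, and it needs no ellipticity,
so it remains available on the unit circle. -/
theorem tendsto_ev_cocompact (ρ : ℝ) (a : LOne R) :
    Tendsto (fun s => ev ρ s a) (cocompact ℝ) (𝓝 0) := by
  simp only [ev_eq_fourier]
  exact Real.zero_at_infty_fourier _

theorem tendsto_evMult (ρ s ξ : ℝ) : Tendsto (fun s => evMult ρ s ξ) (𝓝 s) (𝓝 (evMult ρ s ξ)) := by
  refine Continuous.tendsto ?_ s
  unfold evMult
  exact (continuous_subtype_val.comp (Real.continuous_fourierChar.comp (by fun_prop))).mul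
    continuous_const

theorem tendsto_ev {ι : Type*} {l : Filter ι} [l.IsCountablyGenerated] (ρ : ℝ) {s : ι → ℝ} {s₀ : ℝ}
    (hs : Tendsto s l (𝓝 s₀)) {a : ι → LOne R} {a₀ : LOne R} (ha : Tendsto a l (𝓝 a₀)) :
    Tendsto (fun i => ev ρ (s i) (a i)) l (𝓝 (ev ρ s₀ a₀)) :=
  tendsto_pairL1 (fun i => measurable_evMult ρ (s i)) (fun i => norm_evMult_le ρ (s i))
    (measurable_evMult ρ s₀) (norm_evMult_le ρ s₀)
    (Eventually.of_forall fun ξ => (tendsto_evMult ρ s₀ ξ).comp hs) ha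
end WeightedConvolution

/-! ### The integral equation: existence, size, continuity and holomorphy in parameters. -/

section FixedPoint

/-- An integral of holomorphic functions with a uniform integrable bound is holomorphic. -/
theorem differentiableOn_integral_of_bound {α E : Type*} [MeasurableSpace α] {μ : Measure α}
    [NormedAddCommGroup E] [NormedSpace ℂ E] [CompleteSpace E] {U : Set ℂ} (hU : IsOpen U)
    {F : ℂ → α → E} {bound : α → ℝ} (hF : ∀ z ∈ U, AEStronglyMeasurable (F z) μ)
    (hb : ∀ z ∈ U, ∀ a, ‖F z a‖ ≤ bound a) (hbi : Integrable bound μ)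
    (hd : ∀ᵐ a ∂μ, DifferentiableOn ℂ (fun z => F z a) U) :
    DifferentiableOn ℂ (fun z => ∫ a, F z a ∂μ) U := by
  intro z₀ hz₀
  obtain ⟨r, hr, hball⟩ := Metric.isOpen_iff.1 hU z₀ hz₀
  have hr2 : 0 < r / 2 := by positivity
  -- Discs of radius `r / 4` about points of the half-size ball stay in `U`, so Cauchy's estimate
  -- bounds the derivatives there by `bound / (r / 4)`, which is integrable.
  have hsub : ∀ z ∈ Metric.ball z₀ (r / 2), Metric.closedBall z (r / 4) ⊆ U := by
    intro z hz w hw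
    refine hball ?_
    rw [Metric.mem_ball] at hz ⊢
    rw [Metric.mem_closedBall] at hw
    have := dist_triangle w z z₀
    linarith
  have hmeas : AEStronglyMeasurable (fun a => deriv (fun z => F z a) z₀) μ := by
    -- The derivative at `z₀` is measurable as an almost everywhere limit of difference quotients
    -- along a null sequence of steps that stay inside the ball.
    have hn : Tendsto (fun n : ℕ => ((r / 2) * (1 / ((n : ℝ) + 2)) : ℝ)) atTop (𝓝[≠] 0) := by
      rw [tendsto_nhdsWithin_iff]
      constructor
      · have h := (tendsto_one_div_add_atTop_nhds_zero_nat (𝕜 := ℝ)).comp (tendsto_add_atTop_nat 1)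
        have h2 := h.const_mul (r / 2)
        rw [mul_zero] at h2
        refine h2.congr fun n => ?_
        simp only [Function.comp_apply]
        push_cast
        ring_nf
      · refine Eventually.of_forall fun n => ?_
        have : (0 : ℝ) < (r / 2) * (1 / ((n : ℝ) + 2)) := by positivity
        exact this.ne'
    have hnc : Tendsto (fun n : ℕ => (((r / 2) * (1 / ((n : ℝ) + 2)) : ℝ) : ℂ)) atTop (𝓝[≠] 0) := by
      rw [tendsto_nhdsWithin_iff] at hn ⊢
      refine ⟨?_, hn.2.mono fun n h => ?_⟩
      · have := (Complex.continuous_ofReal.tendsto 0).comp hn.1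
        simpa [Function.comp_def] using this
      · exact Complex.ofReal_ne_zero.2 h
    refine aestronglyMeasurable_of_tendsto_ae atTop
      (f := fun (n : ℕ) a => ((((r / 2) * (1 / ((n : ℝ) + 2)) : ℝ) : ℂ))⁻¹ •
        (F (z₀ + (((r / 2) * (1 / ((n : ℝ) + 2)) : ℝ) : ℂ)) a - F z₀ a)) ?_ ?_
    · intro n
      refine AEStronglyMeasurable.const_smul ((hF _ (hball ?_)).sub (hF _ hz₀)) _
      rw [Metric.mem_ball, dist_eq_norm, add_sub_cancel_left, Complex.norm_real,
        Real.norm_of_nonneg (by positivity)]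
      have h1 : (1 : ℝ) / ((n : ℝ) + 2) ≤ 1 := by
        rw [div_le_one (by positivity)]
        have : (0 : ℝ) ≤ n := by positivity
        linarith
      nlinarith
    · filter_upwards [hd] with a ha
      have h := ((ha z₀ hz₀).differentiableAt (hU.mem_nhds hz₀)).hasDerivAt
      exact (hasDerivAt_iff_tendsto_slope_zero.1 h).comp hnc
  refine ((hasDerivAt_integral_of_dominated_loc_of_deriv_le (F := F)
    (F' := fun z a => deriv (fun z => F z a) z) (bound := fun a => bound a / (r / 4))
    (Metric.ball_mem_nhds z₀ hr2) ?_ ?_ hmeas ?_ (hbi.div_const _)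
    ?_).2.differentiableAt).differentiableWithinAt
  · filter_upwards [hU.mem_nhds hz₀] with z hz using hF z hz
  · exact hbi.mono' (hF z₀ hz₀) (Eventually.of_forall (hb z₀ hz₀))
  · filter_upwards [hd] with a ha z hz
    refine Complex.norm_deriv_le_of_forall_mem_sphere_norm_le (by positivity) ?_ ?_
    · refine DifferentiableOn.diffContOnCl ?_
      rw [closure_ball z (by positivity)]
      exact ha.mono (hsub z hz)
    · intro w hw
      exact hb w (hsub z hz (Metric.sphere_subset_closedBall hw)) a
  · filter_upwards [hd] with a ha z hz
    have hzU : z ∈ U := hsub z hz (Metric.mem_closedBall_self (by positivity))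
    exact ((ha z hzU).differentiableAt (hU.mem_nhds hzU)).hasDerivAt

variable {Γ A : Type*} [TopologicalSpace Γ] [FirstCountableTopology Γ]
  [NormedAddCommGroup A] [NormedSpace ℂ A]

/-- A family of propagators: contractions, strongly continuous away from time `0`. -/
structure IsPropagator (V : Γ → ℝ → A →L[ℂ] A) : Prop where
  norm_le : ∀ γ t a, ‖V γ t a‖ ≤ ‖a‖
  continuousAt : ∀ γ t a, t ≠ 0 → ContinuousAt (fun q : Γ × ℝ × A => V q.1 q.2.1 q.2.2) (γ, t, a)

variable {V : Γ → ℝ → A →L[ℂ] A}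

omit [FirstCountableTopology Γ] in
theorem IsPropagator.aestronglyMeasurable (hV : IsPropagator V) {F : Γ × ℝ → A}
    (hF : Continuous F) (γ : Γ) (τ : ℝ) :
    AEStronglyMeasurable (fun σ => V γ (τ - σ) (F (γ, σ))) := by
  have h : ContinuousOn (fun σ => V γ (τ - σ) (F (γ, σ))) {τ}ᶜ := by
    intro σ hσ
    have hσ' : τ - σ ≠ 0 := sub_ne_zero.2 fun h => hσ h.symm
    have h1 : ContinuousAt (fun σ : ℝ => ((γ, τ - σ, F (γ, σ)) : Γ × ℝ × A)) σ := by
      have : Continuous (fun σ : ℝ => ((γ, τ - σ, F (γ, σ)) : Γ × ℝ × A)) := by fun_prop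
      exact this.continuousAt
    exact (ContinuousAt.comp (f := fun σ : ℝ => ((γ, τ - σ, F (γ, σ)) : Γ × ℝ × A))
      (hV.continuousAt γ (τ - σ) (F (γ, σ)) hσ') h1).continuousWithinAt
  have h2 := h.aestronglyMeasurable (μ := volume) (measurableSet_singleton τ).compl
  rwa [Measure.restrict_eq_self_of_ae_mem] at h2
  exact (measure_eq_zero_iff_ae_notMem.1 (Real.volume_singleton (a := τ)))

theorem IsPropagator.continuous_integral (hV : IsPropagator V) {F : Γ × ℝ → A}
    (hF : Continuous F) {β : ℝ → ℝ} (hβ : Integrable β) (hFβ : ∀ q, ‖F q‖ ≤ β q.2) :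
    Continuous fun q : Γ × ℝ => ∫ σ, V q.1 (q.2 - σ) (F (q.1, σ)) := by
  rw [continuous_iff_continuousAt]
  rintro ⟨γ, τ⟩
  refine continuousAt_of_dominated (bound := β)
    (Eventually.of_forall fun q => hV.aestronglyMeasurable hF q.1 q.2)
    (Eventually.of_forall fun q => Eventually.of_forall fun σ =>
      (hV.norm_le _ _ _).trans (hFβ (q.1, σ))) hβ ?_
  -- The propagator jumps at time `0`, that is at `σ = τ`, which is a null set for each fixed `τ`;
  -- dominated convergence does not see it.
  have h0 : ∀ᵐ σ : ℝ, σ ≠ τ := measure_eq_zero_iff_ae_notMem.1 (Real.volume_singleton (a := τ))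
  filter_upwards [h0] with σ hσ
  have h1 : ContinuousAt (fun q : Γ × ℝ => ((q.1, q.2 - σ, F (q.1, σ)) : Γ × ℝ × A)) (γ, τ) := by
    have : Continuous (fun q : Γ × ℝ => ((q.1, q.2 - σ, F (q.1, σ)) : Γ × ℝ × A)) := by fun_prop
    exact this.continuousAt
  exact ContinuousAt.comp (f := fun q : Γ × ℝ => ((q.1, q.2 - σ, F (q.1, σ)) : Γ × ℝ × A))
    (hV.continuousAt γ (τ - σ) (F (γ, σ)) (sub_ne_zero.2 hσ.symm)) h1

omit [FirstCountableTopology Γ] in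
theorem IsPropagator.norm_integral_le (hV : IsPropagator V) {F : Γ × ℝ → A}
    {β : ℝ → ℝ} (hβ : Integrable β) (hFβ : ∀ q, ‖F q‖ ≤ β q.2) (q : Γ × ℝ) :
    ‖∫ σ, V q.1 (q.2 - σ) (F (q.1, σ))‖ ≤ ∫ σ, β σ :=
  norm_integral_le_of_norm_le hβ (Eventually.of_forall fun σ =>
    (hV.norm_le _ _ _).trans (hFβ (q.1, σ)))

/-- The coefficients of a linear evolution equation with small integrable norm. -/
structure IsSmallSource (b : Γ → ℝ → A) (M : Γ → ℝ → A →L[ℂ] A) (β : ℝ → ℝ) : Prop where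
  continuous_b : Continuous fun q : Γ × ℝ => b q.1 q.2
  continuous_M : Continuous fun q : Γ × ℝ × A => M q.1 q.2.1 q.2.2
  integrable : Integrable β
  norm_b_le : ∀ γ t, ‖b γ t‖ ≤ β t
  norm_M_le : ∀ γ t a, ‖M γ t a‖ ≤ β t * ‖a‖
  integral_le : ∫ t, β t ≤ 1 / 2

variable {b : Γ → ℝ → A} {M : Γ → ℝ → A →L[ℂ] A} {β : ℝ → ℝ}

open scoped BoundedContinuousFunction

omit [FirstCountableTopology Γ] in
theorem IsSmallSource.continuous_source (hs : IsSmallSource b M β) {f : Γ × ℝ → A}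
    (hf : Continuous f) : Continuous fun q : Γ × ℝ => b q.1 q.2 + M q.1 q.2 (f q) := by
  refine hs.continuous_b.add ?_
  exact hs.continuous_M.comp (f := fun q : Γ × ℝ => ((q.1, q.2, f q) : Γ × ℝ × A)) (by fun_prop)

omit [FirstCountableTopology Γ] in
theorem IsSmallSource.norm_source_le (hs : IsSmallSource b M β) {f : Γ × ℝ → A} {K : ℝ}
    (hf : ∀ q, ‖f q‖ ≤ K) (q : Γ × ℝ) : ‖b q.1 q.2 + M q.1 q.2 (f q)‖ ≤ β q.2 * (1 + K) := by
  have h0 : 0 ≤ β q.2 := (norm_nonneg _).trans (hs.norm_b_le q.1 q.2)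
  calc _ ≤ β q.2 + β q.2 * ‖f q‖ :=
        (norm_add_le _ _).trans (add_le_add (hs.norm_b_le _ _) (hs.norm_M_le _ _ _))
    _ ≤ β q.2 + β q.2 * K := by gcongr; exact hf q
    _ = _ := by ring

/-- One step of the iteration. -/
noncomputable def evolutionStep (hV : IsPropagator V) (hs : IsSmallSource b M β)
    (f : (Γ × ℝ) →ᵇ A) : (Γ × ℝ) →ᵇ A :=
  BoundedContinuousFunction.ofNormedAddCommGroup
    (fun q => ∫ σ, V q.1 (q.2 - σ) (b q.1 σ + M q.1 σ (f (q.1, σ))))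
    (hV.continuous_integral (hs.continuous_source f.continuous) (hs.integrable.mul_const (1 + ‖f‖))
      (hs.norm_source_le f.norm_coe_le_norm))
    (∫ σ, β σ * (1 + ‖f‖))
    (hV.norm_integral_le (F := fun q => b q.1 q.2 + M q.1 q.2 (f q))
      (hs.integrable.mul_const (1 + ‖f‖)) (hs.norm_source_le f.norm_coe_le_norm))

theorem evolutionStep_apply (hV : IsPropagator V) (hs : IsSmallSource b M β)
    (f : (Γ × ℝ) →ᵇ A) (q : Γ × ℝ) : evolutionStep hV hs f q =
      ∫ σ, V q.1 (q.2 - σ) (b q.1 σ + M q.1 σ (f (q.1, σ))) := rfl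

omit [FirstCountableTopology Γ] in
theorem integrable_evolution (hV : IsPropagator V) (hs : IsSmallSource b M β)
    (f : (Γ × ℝ) →ᵇ A) (γ : Γ) (τ : ℝ) :
    Integrable fun σ => V γ (τ - σ) (b γ σ + M γ σ (f (γ, σ))) :=
  (hs.integrable.mul_const (1 + ‖f‖)).mono'
    (hV.aestronglyMeasurable (hs.continuous_source f.continuous) γ τ)
    (Eventually.of_forall fun σ => (hV.norm_le _ _ _).trans
      (hs.norm_source_le f.norm_coe_le_norm (γ, σ)))

/-- The source is affine in the unknown, so the inhomogeneous term cancels in the difference. The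
propagator does not increase norms, and the Lipschitz constant is the total mass of `β`, at most `1
/ 2`. -/
theorem contracting_evolutionStep (hV : IsPropagator V) (hs : IsSmallSource b M β) :
    ContractingWith (1 / 2) (evolutionStep hV hs) := by
  refine ⟨by norm_num, LipschitzWith.of_dist_le_mul fun f g => ?_⟩
  have h0 : ∀ t, 0 ≤ β t ∨ IsEmpty Γ := fun t => by
    rcases isEmpty_or_nonempty Γ with h | ⟨⟨γ⟩⟩
    · exact Or.inr h
    · exact Or.inl ((norm_nonneg _).trans (hs.norm_b_le γ t))
  rw [BoundedContinuousFunction.dist_le (by positivity)]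
  rintro ⟨γ, τ⟩
  rw [dist_eq_norm, evolutionStep_apply, evolutionStep_apply,
    ← integral_sub (integrable_evolution hV hs f γ τ) (integrable_evolution hV hs g γ τ)]
  calc _ ≤ ∫ σ, β σ * dist f g := by
        refine norm_integral_le_of_norm_le (hs.integrable.mul_const _)
          (Eventually.of_forall fun σ => ?_)
        rw [← map_sub, add_sub_add_left_eq_sub, ← map_sub]
        refine (hV.norm_le _ _ _).trans ((hs.norm_M_le _ _ _).trans ?_)
        have := (norm_nonneg _).trans (hs.norm_b_le γ σ)
        gcongr
        rw [← dist_eq_norm]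
        exact BoundedContinuousFunction.dist_coe_le_dist _
    _ = (∫ σ, β σ) * dist f g := integral_mul_const _ _
    _ ≤ 1 / 2 * dist f g := by gcongr; exact hs.integral_le
    _ = _ := by norm_num

/-- Solutions of the integral equation, continuous in all variables and holomorphic along
holomorphic curves of parameters. -/
theorem exists_evolution [CompleteSpace A] (hV : IsPropagator V) (hs : IsSmallSource b M β) :
    ∃ e : (Γ × ℝ) →ᵇ A,
      (∀ γ τ, e (γ, τ) = ∫ σ, V γ (τ - σ) (b γ σ + M γ σ (e (γ, σ)))) ∧
      (∀ γ τ, ‖e (γ, τ)‖ ≤ 2 * ∫ σ, β σ) ∧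
      ∀ (U : Set ℂ) (c : ℂ → Γ), IsOpen U →
        (∀ t, t ≠ 0 → ∀ g : ℂ → A, DifferentiableOn ℂ g U →
          DifferentiableOn ℂ (fun z => V (c z) t (g z)) U) →
        (∀ t, DifferentiableOn ℂ (fun z => b (c z) t) U) →
        (∀ t, ∀ g : ℂ → A, DifferentiableOn ℂ g U →
          DifferentiableOn ℂ (fun z => M (c z) t (g z)) U) →
        ∀ τ, DifferentiableOn ℂ (fun z => e (c z, τ)) U := by
  have hc := contracting_evolutionStep hV hs
  set e := ContractingWith.fixedPoint _ hc with he
  have hfix : evolutionStep hV hs e = e := hc.fixedPoint_isFixedPt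
  have heq : ∀ γ τ, e (γ, τ) = ∫ σ, V γ (τ - σ) (b γ σ + M γ σ (e (γ, σ))) := fun γ τ => by
    conv_lhs => rw [← hfix]
    rfl
  refine ⟨e, heq, ?_, ?_⟩
  · intro γ τ
    have hβ0 : 0 ≤ ∫ σ, β σ := integral_nonneg fun σ => (norm_nonneg _).trans (hs.norm_b_le γ σ)
    -- With `I = ∫ β ≤ 1/2`, the inequality `‖e‖ ≤ I (1 + ‖e‖)` gives `‖e‖ ≤ I + ‖e‖ / 2`, hence the
    -- factor `2` in the bound.
    have h1 : ‖e‖ ≤ (∫ σ, β σ) * (1 + ‖e‖) := by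
      rw [BoundedContinuousFunction.norm_le (by positivity)]
      intro q
      rw [← integral_mul_const]
      conv_lhs => rw [heq q.1 q.2]
      exact hV.norm_integral_le (F := fun q => b q.1 q.2 + M q.1 q.2 (e q))
        (hs.integrable.mul_const (1 + ‖e‖)) (hs.norm_source_le e.norm_coe_le_norm) q
    have h2 := hs.integral_le
    have h3 := e.norm_coe_le_norm (γ, τ)
    nlinarith [norm_nonneg e]
  · intro U c hU hVd hbd hMd τ
    -- The Picard iterates starting from `0` are holomorphic along the curve by induction. They
    -- converge uniformly, so the fixed point is holomorphic by Weierstrass' theorem.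
    have hiter : ∀ k : ℕ, ∀ τ, DifferentiableOn ℂ
        (fun z => ((evolutionStep hV hs)^[k] 0) (c z, τ)) U := by
      intro k
      induction k with
      | zero => intro τ; simp
      | succ k ih =>
        intro τ
        rw [Function.iterate_succ_apply']
        set f := (evolutionStep hV hs)^[k] 0
        simp only [evolutionStep_apply]
        refine differentiableOn_integral_of_bound hU (bound := fun σ => β σ * (1 + ‖f‖))
          (fun z _ => (integrable_evolution hV hs f (c z) τ).aestronglyMeasurable)
          (fun z _ σ => (hV.norm_le _ _ _).trans (hs.norm_source_le f.norm_coe_le_norm (c z, σ)))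
          (hs.integrable.mul_const _) ?_
        have h0 : ∀ᵐ σ : ℝ, σ ≠ τ :=
          measure_eq_zero_iff_ae_notMem.1 (Real.volume_singleton (a := τ))
        filter_upwards [h0] with σ hσ
        exact hVd (τ - σ) (sub_ne_zero.2 hσ.symm) _ ((hbd σ).add (hMd σ _ (ih σ)))
    have hlim := hc.tendsto_iterate_fixedPoint (0 : (Γ × ℝ) →ᵇ A)
    rw [← he, BoundedContinuousFunction.tendsto_iff_tendstoUniformly] at hlim
    have hlim2 : TendstoUniformlyOn (fun k z => ((evolutionStep hV hs)^[k] 0) (c z, τ))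
        (fun z => e (c z, τ)) atTop U :=
      (hlim.comp fun z => (c z, τ)).tendstoUniformlyOn
    exact hlim2.tendstoLocallyUniformlyOn.differentiableOn
      (Eventually.of_forall fun k => hiter k τ) hU

end FixedPoint

/-! ### The propagator of `∂_τ + γ ∂_s` as a contractive multiplier. -/

section Propagator

/-- The Fourier multiplier of the propagator of `∂_τ + γ ∂_s` which is bounded for `0 ≤ Im γ`. -/
noncomputable def propMult (γ : ℂ) (t ξ : ℝ) : ℂ :=
  if 0 < t * ξ then (if 0 < t then 1 else -1) *
    Complex.exp (2 * Real.pi * Complex.I * γ * (t * ξ : ℝ)) else 0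

theorem norm_exp_propMult (γ : ℂ) (r : ℝ) :
    ‖Complex.exp (2 * Real.pi * Complex.I * γ * (r : ℝ))‖ = Real.exp (-(2 * Real.pi * γ.im * r)) := by
  rw [Complex.norm_exp]
  congr 1
  simp

theorem norm_sign_eq_one (t : ℝ) : ‖(if 0 < t then 1 else -1 : ℂ)‖ = 1 := by
  split_ifs <;> simp

/-- The multiplier lives where `t` and `ξ` have the same sign, and there the exponential has modulus
`exp (-2π Im γ · tξ) ≤ 1`. Real `γ` is allowed, which is what lets the frames be followed to the
unit circle. -/
theorem norm_propMult_le {γ : ℂ} (hγ : 0 ≤ γ.im) (t ξ : ℝ) : ‖propMult γ t ξ‖ ≤ 1 := by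
  unfold propMult
  split_ifs with h
  · simp only [one_mul]
    rw [norm_exp_propMult, Real.exp_le_one_iff]
    have := Real.pi_pos
    have : 0 ≤ 2 * Real.pi * γ.im * (t * ξ) := by positivity
    linarith
  · rw [norm_mul, norm_neg, norm_one, one_mul, norm_exp_propMult, Real.exp_le_one_iff]
    have := Real.pi_pos
    have : 0 ≤ 2 * Real.pi * γ.im * (t * ξ) := by positivity
    linarith
  · simp

theorem measurable_propMult (γ : ℂ) (t : ℝ) : Measurable (propMult γ t) := by
  unfold propMult
  refine Measurable.ite (measurableSet_lt measurable_const (by fun_prop)) ?_ measurable_const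
  fun_prop

theorem bddMultiplier_propMult {γ : ℂ} (hγ : 0 ≤ γ.im) (t : ℝ) : BddMultiplier (propMult γ t) :=
  ⟨measurable_propMult γ t, 1, norm_propMult_le hγ t⟩

/-- The only discontinuities are the sign changes of `t` and `ξ`; the dependence on `γ` is
continuous up to the real axis. For fixed `t ≠ 0` this leaves only the null set `ξ = 0`. -/
theorem continuousAt_propMult (γ : ℂ) {t ξ : ℝ} (ht : t ≠ 0) (hξ : ξ ≠ 0) :
    ContinuousAt (fun q : ℂ × ℝ => propMult q.1 q.2 ξ) (γ, t) := by
  have h1 : ∀ᶠ q : ℂ × ℝ in 𝓝 (γ, t), (0 < q.2 * ξ ↔ 0 < t * ξ) := by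
    have hc : ContinuousAt (fun q : ℂ × ℝ => q.2 * ξ) (γ, t) := by fun_prop
    rcases lt_or_gt_of_ne (mul_ne_zero ht hξ) with h | h
    · filter_upwards [hc.eventually_lt_const h] with q hq
      exact iff_of_false hq.le.not_gt h.le.not_gt
    · filter_upwards [hc.eventually_const_lt h] with q hq
      exact iff_of_true hq h
  have h2 : ∀ᶠ q : ℂ × ℝ in 𝓝 (γ, t), (0 < q.2 ↔ 0 < t) := by
    have hc : ContinuousAt (fun q : ℂ × ℝ => q.2) (γ, t) := by fun_prop
    rcases lt_or_gt_of_ne ht with h | h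
    · filter_upwards [hc.eventually_lt_const h] with q hq
      exact iff_of_false hq.le.not_gt h.le.not_gt
    · filter_upwards [hc.eventually_const_lt h] with q hq
      exact iff_of_true hq h
  have h3 : (fun q : ℂ × ℝ => propMult q.1 q.2 ξ) =ᶠ[𝓝 (γ, t)] fun q =>
      if 0 < t * ξ then (if 0 < t then 1 else -1) *
        Complex.exp (2 * Real.pi * Complex.I * q.1 * (q.2 * ξ : ℝ)) else 0 := by
    filter_upwards [h1, h2] with q hq1 hq2
    simp only [propMult, hq1, hq2]
  refine ContinuousAt.congr ?_ h3.symm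
  split_ifs <;> fun_prop

variable {R : Type*} [NormedRing R] [NormedAlgebra ℂ R]

theorem isPropagator_mulL1 {Γ : Type*} [TopologicalSpace Γ] [FirstCountableTopology Γ] {g : Γ → ℂ}
    (hg : Continuous g) (hg0 : ∀ x, 0 ≤ (g x).im) :
    IsPropagator fun x t => (mulL1 (propMult (g x) t) : LOne R →L[ℂ] LOne R) := by
  refine ⟨fun x t a => ?_, fun x t a ht => ?_⟩
  · simpa using norm_mulL1_apply_le (measurable_propMult (g x) t) (norm_propMult_le (hg0 x) t) a
  · refine tendsto_mulL1 (C := 1) (m := fun q : Γ × ℝ × LOne R => propMult (g q.1) q.2.1)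
      (a := fun q : Γ × ℝ × LOne R => q.2.2)
      (fun q => measurable_propMult _ _) (fun q => norm_propMult_le (hg0 _) _)
      (measurable_propMult _ _) (norm_propMult_le (hg0 _) _) ?_ ?_
    · have h0 : ∀ᵐ ξ : ℝ, ξ ≠ 0 := measure_eq_zero_iff_ae_notMem.1 (Real.volume_singleton (a := 0))
      filter_upwards [h0] with ξ hξ
      have hc : Tendsto (fun q : Γ × ℝ × LOne R => (g q.1, q.2.1)) (𝓝 (x, t, a)) (𝓝 (g x, t)) := by
        have : Continuous fun q : Γ × ℝ × LOne R => (g q.1, q.2.1) := by fun_prop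
        exact this.tendsto _
      exact (continuousAt_propMult (g x) ht hξ).tendsto.comp hc
    · have : Continuous fun q : Γ × ℝ × LOne R => q.2.2 := by fun_prop
      exact this.tendsto _

/-- The derivative of `propMult` in the spectral parameter. -/
noncomputable def propMultDeriv (γ : ℂ) (t ξ : ℝ) : ℂ :=
  2 * Real.pi * Complex.I * (t * ξ : ℝ) * propMult γ t ξ

theorem measurable_propMultDeriv (γ : ℂ) (t : ℝ) : Measurable (propMultDeriv γ t) := by
  unfold propMultDeriv
  exact Measurable.mul (by fun_prop) (measurable_propMult γ t)

/-- Differentiation in `γ` costs a factor `2π tξ`, which is absorbed by the decay `exp (-2π Im γ ·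
tξ)`, as `r exp (-r) ≤ 1`. -/
theorem norm_propMultDeriv_le {γ : ℂ} (hγ : 0 < γ.im) (t ξ : ℝ) :
    ‖propMultDeriv γ t ξ‖ ≤ 1 / γ.im := by
  unfold propMultDeriv propMult
  have hpi := Real.pi_pos
  split_ifs with h h'
  all_goals try (simp only [mul_zero, norm_zero]; positivity)
  all_goals
    simp only [norm_mul, norm_exp_propMult, norm_one, norm_neg, one_mul, Complex.norm_I, mul_one,
      Complex.norm_real, Complex.norm_ofNat]
    rw [← norm_mul t ξ, Real.norm_of_nonneg h.le, Real.norm_of_nonneg hpi.le]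
    have hx := Real.add_one_le_exp (2 * Real.pi * γ.im * (t * ξ))
    rw [Real.exp_neg, ← div_eq_mul_inv, div_le_div_iff₀ (Real.exp_pos _) hγ]
    nlinarith

/-- A second-order Taylor estimate uniform in `t` and `ξ`. Since `‖h‖ ≤ Im γ / 2`, the growth of the
remainder uses up at most half of the exponent `2π Im γ · tξ`; the other half absorbs the square, by
`x² exp (-x) ≤ 2`. Uniformity is what makes the multiplier differentiable in operator norm. -/
theorem norm_propMult_remainder_le {γ h : ℂ} (hγ : 0 < γ.im) (hh : ‖h‖ ≤ γ.im / 2) (t ξ : ℝ) :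
    ‖propMult (γ + h) t ξ - propMult γ t ξ - h * propMultDeriv γ t ξ‖ ≤
      8 / γ.im ^ 2 * ‖h‖ ^ 2 := by
  have hpi := Real.pi_pos
  by_cases hr : 0 < t * ξ
  · have heq : propMult (γ + h) t ξ - propMult γ t ξ - h * propMultDeriv γ t ξ =
        (if 0 < t then 1 else -1) * (Complex.exp (2 * Real.pi * Complex.I * γ * (t * ξ : ℝ)) *
          (Complex.exp (2 * Real.pi * Complex.I * h * (t * ξ : ℝ)) -
            ∑ m ∈ Finset.range 2, (2 * Real.pi * Complex.I * h * (t * ξ : ℝ)) ^ m / m.factorial)) := by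
      simp only [propMultDeriv, propMult, if_pos hr, Finset.sum_range_succ, Finset.sum_range_zero]
      rw [mul_add (2 * Real.pi * Complex.I), add_mul, Complex.exp_add]
      simp only [pow_zero, Nat.factorial_zero, Nat.cast_one, div_one, zero_add, pow_one,
        Nat.factorial_one]
      ring
    set r := t * ξ with hrdef
    rw [heq, norm_mul, norm_sign_eq_one, one_mul, norm_mul, norm_exp_propMult]
    have hz : ‖2 * Real.pi * Complex.I * h * (r : ℂ)‖ = 2 * Real.pi * ‖h‖ * r := by
      simp [abs_of_pos hpi, abs_of_pos hr]
    have h1 := Complex.norm_exp_sub_sum_le_norm_mul_exp (2 * Real.pi * Complex.I * h * (r : ℂ)) 2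
    rw [hz] at h1
    set x := Real.pi * γ.im * r with hx
    have hx0 : 0 < x := by positivity
    have h2 : 2 * Real.pi * ‖h‖ * r ≤ x := by
      have : 2 * Real.pi * ‖h‖ * r ≤ 2 * Real.pi * (γ.im / 2) * r := by gcongr
      linarith
    have h3 : x ^ 2 * Real.exp (-x) ≤ 2 := by
      have := Real.quadratic_le_exp_of_nonneg hx0.le
      rw [Real.exp_neg, ← div_eq_mul_inv, div_le_iff₀ (Real.exp_pos _)]
      nlinarith
    calc Real.exp (-(2 * Real.pi * γ.im * r)) * _
        ≤ Real.exp (-(2 * Real.pi * γ.im * r)) * ((2 * Real.pi * ‖h‖ * r) ^ 2 * Real.exp x) := by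
          refine mul_le_mul_of_nonneg_left (h1.trans ?_) (Real.exp_pos _).le
          gcongr
      _ = 4 / γ.im ^ 2 * ‖h‖ ^ 2 * (x ^ 2 * Real.exp (-x)) := by
          have he : Real.exp (-(2 * Real.pi * γ.im * r)) * Real.exp x = Real.exp (-x) := by
            rw [← Real.exp_add]; congr 1; rw [hx]; ring
          calc _ = (2 * Real.pi * ‖h‖ * r) ^ 2 *
                (Real.exp (-(2 * Real.pi * γ.im * r)) * Real.exp x) := by ring
            _ = _ := by rw [he, hx]; field_simp; ring
      _ ≤ 4 / γ.im ^ 2 * ‖h‖ ^ 2 * 2 := by gcongr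
      _ = _ := by ring
  · simp only [propMultDeriv, propMult, if_neg hr, mul_zero, sub_zero, norm_zero]
    positivity

theorem hasDerivAt_mulL1_propMult {γ : ℂ} (hγ : 0 < γ.im) (t : ℝ) :
    HasDerivAt (fun z => (mulL1 (propMult z t) : LOne R →L[ℂ] LOne R))
      (mulL1 (propMultDeriv γ t)) γ := by
  refine (hasDerivAt_iff_isLittleO_nhds_zero (𝕜 := ℂ) (F := LOne R →L[ℂ] LOne R)).2 ?_
  refine Asymptotics.IsBigO.trans_isLittleO (g := fun h : ℂ => h ^ 2) ?_
    (Asymptotics.isLittleO_pow_id one_lt_two)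
  refine Asymptotics.IsBigO.of_bound (8 / γ.im ^ 2) ?_
  have hball : ∀ᶠ h : ℂ in 𝓝 0, ‖h‖ < γ.im / 2 := by
    have : Tendsto (fun h : ℂ => ‖h‖) (𝓝 0) (𝓝 0) := tendsto_norm_zero
    exact this.eventually_lt_const (by positivity)
  filter_upwards [hball] with h hh
  have him : 0 ≤ (γ + h).im := by
    have := (abs_le.1 (Complex.abs_im_le_norm h)).1
    rw [Complex.add_im]; linarith
  have hd : BddMultiplier (propMultDeriv γ t) :=
    ⟨measurable_propMultDeriv γ t, _, norm_propMultDeriv_le hγ t⟩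
  have hd' : BddMultiplier fun ξ => h * propMultDeriv γ t ξ := by
    refine ⟨(measurable_propMultDeriv γ t).const_mul h, ‖h‖ * (1 / γ.im), fun ξ => ?_⟩
    rw [norm_mul]
    gcongr
    exact norm_propMultDeriv_le hγ t ξ
  have hs : BddMultiplier fun ξ => propMult (γ + h) t ξ - propMult γ t ξ :=
    ⟨(measurable_propMult _ t).sub (measurable_propMult _ t), 1 + 1, fun ξ => (norm_sub_le _ _).trans
      (add_le_add (norm_propMult_le him t ξ) (norm_propMult_le hγ.le t ξ))⟩
  rw [← mulL1_sub (bddMultiplier_propMult him t) (bddMultiplier_propMult hγ.le t),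
    ← mulL1_const_mul hd, ← mulL1_sub hs hd', norm_pow]
  exact norm_mulL1_le (hs.1.sub hd'.1) (norm_propMult_remainder_le hγ hh.le t)

end Propagator

/-! ### The partial Fourier transform of a Schwartz function and its `W^{2,1}` bound. -/

section PartialFourier

open scoped FourierTransform LineDeriv

variable {R : Type*} [NormedRing R] [NormedAlgebra ℂ R]

theorem hasTemperateGrowth_mk_left (τ : ℝ) :
    (fun s : ℝ => ((s, τ) : ℝ × ℝ)).HasTemperateGrowth := by
  have h : (fun s : ℝ => ((s, τ) : ℝ × ℝ)) =
      fun s => ContinuousLinearMap.inl ℝ ℝ ℝ s + (0, τ) := by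
    ext s <;> simp
  rw [h]
  exact (ContinuousLinearMap.inl ℝ ℝ ℝ).hasTemperateGrowth.add
    (Function.HasTemperateGrowth.const _)

theorem antilipschitz_mk_left (τ : ℝ) :
    AntilipschitzWith 1 (fun s : ℝ => ((s, τ) : ℝ × ℝ)) :=
  AntilipschitzWith.of_le_mul_dist fun x y => by simp [Prod.dist_eq]

/-- The restriction of a Schwartz function to a horizontal line. -/
noncomputable def slice (a : 𝓢(ℝ × ℝ, R)) (τ : ℝ) : 𝓢(ℝ, R) :=
  SchwartzMap.compCLMOfAntilipschitz ℝ (hasTemperateGrowth_mk_left τ) (antilipschitz_mk_left τ) a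

theorem slice_apply (a : 𝓢(ℝ × ℝ, R)) (τ s : ℝ) : slice a τ s = a (s, τ) := rfl

/-- The `L¹` norm of a slice. -/
noncomputable def sliceNorm (a : 𝓢(ℝ × ℝ, R)) (τ : ℝ) : ℝ := ∫ s, ‖a (s, τ)‖

theorem integrable_sliceNorm (a : 𝓢(ℝ × ℝ, R)) : Integrable (sliceNorm a) := by
  have h : Integrable a (volume.prod volume) := a.integrable
  exact h.norm.integral_prod_right

theorem integral_sliceNorm (a : 𝓢(ℝ × ℝ, R)) : ∫ τ, sliceNorm a τ = ∫ p, ‖a p‖ := by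
  have h : Integrable a (volume.prod volume) := a.integrable
  exact (integral_prod_symm _ h.norm).symm

/-- A majorant that is integrable in `s` and independent of `τ`, for dominated convergence and for
uniform bounds on the slices. -/
theorem exists_norm_slice_le (a : 𝓢(ℝ × ℝ, R)) :
    ∃ C : ℝ, 0 ≤ C ∧ ∀ s τ, ‖a (s, τ)‖ ≤ C * (1 + s ^ 2)⁻¹ := by
  refine ⟨2 ^ 2 * (Finset.Iic (2, 0)).sup (fun m => SchwartzMap.seminorm ℝ m.1 m.2) a,
    by positivity, fun s τ => ?_⟩
  have h := SchwartzMap.one_add_le_sup_seminorm_apply (𝕜 := ℝ) (m := (2, 0)) le_rfl le_rfl a (s, τ)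
  rw [norm_iteratedFDeriv_zero] at h
  rw [← div_eq_mul_inv, le_div_iff₀ (by positivity), mul_comm]
  refine le_trans ?_ h
  gcongr
  have h1 : |s| ≤ ‖((s, τ) : ℝ × ℝ)‖ := norm_fst_le (s, τ)
  have h2 : s ^ 2 ≤ ‖((s, τ) : ℝ × ℝ)‖ ^ 2 := by rw [← sq_abs]; gcongr
  change _ ≤ (1 + ‖((s, τ) : ℝ × ℝ)‖) ^ 2
  nlinarith [norm_nonneg ((s, τ) : ℝ × ℝ)]

theorem exists_sliceNorm_le (a : 𝓢(ℝ × ℝ, R)) : ∃ C : ℝ, ∀ τ, sliceNorm a τ ≤ C := by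
  obtain ⟨C, -, h⟩ := exists_norm_slice_le a
  refine ⟨∫ s, C * (1 + s ^ 2)⁻¹, fun τ => ?_⟩
  exact integral_mono (slice a τ).integrable.norm (integrable_inv_one_add_sq.const_mul C)
    fun s => h s τ

/-- The partial (inverse) Fourier transform in the first variable. -/
noncomputable def hatFun (a : 𝓢(ℝ × ℝ, R)) (τ ξ : ℝ) : R := 𝓕⁻ (slice a τ) ξ

theorem hatFun_eq (a : 𝓢(ℝ × ℝ, R)) (τ ξ : ℝ) :
    hatFun a τ ξ = ∫ s, Real.fourierChar (s * ξ) • a (s, τ) := by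
  rw [hatFun, SchwartzMap.fourierInv_coe, Real.fourierInv_eq]
  simp only [RCLike.inner_apply, conj_trivial, slice_apply, mul_comm]

theorem norm_hatFun_le (a : 𝓢(ℝ × ℝ, R)) (τ ξ : ℝ) : ‖hatFun a τ ξ‖ ≤ sliceNorm a τ := by
  rw [hatFun_eq]
  refine (norm_integral_le_integral_norm _).trans_eq ?_
  simp [sliceNorm, Circle.norm_smul]

theorem continuous_hatFun (a : 𝓢(ℝ × ℝ, R)) (ξ : ℝ) : Continuous fun τ => hatFun a τ ξ := by
  obtain ⟨C, -, h⟩ := exists_norm_slice_le a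
  simp only [hatFun_eq]
  refine continuous_of_dominated (bound := fun s => C * (1 + s ^ 2)⁻¹) ?_ ?_
    (integrable_inv_one_add_sq.const_mul C) ?_
  · intro τ
    refine Continuous.aestronglyMeasurable ?_
    exact (Real.continuous_fourierChar.comp (by fun_prop)).smul (slice a τ).continuous
  · intro τ
    exact Eventually.of_forall fun s => by rw [Circle.norm_smul]; exact h s τ
  · refine Eventually.of_forall fun s => continuous_const.smul ?_
    exact a.continuous.comp (by fun_prop)

theorem hatFun_deriv (a : 𝓢(ℝ × ℝ, R)) (τ ξ : ℝ) :
    hatFun (∂_{((1 : ℝ), (0 : ℝ))} a) τ ξ = -(2 * Real.pi * Complex.I * ξ) • hatFun a τ ξ := by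
  have h : slice (∂_{((1 : ℝ), (0 : ℝ))} a) τ = ∂_{(1 : ℝ)} (slice a τ) := by
    ext s
    rw [slice_apply, SchwartzMap.lineDerivOp_apply_eq_fderiv, SchwartzMap.lineDerivOp_apply_eq_fderiv]
    have h1 : HasFDerivAt (fun s : ℝ => ((s, τ) : ℝ × ℝ)) (ContinuousLinearMap.inl ℝ ℝ ℝ) s :=
      hasFDerivAt_prodMk_left s τ
    have h2 := (a.hasFDerivAt (s, τ)).comp s h1
    have h3 : HasFDerivAt (slice a τ) _ s := h2
    rw [h3.fderiv]
    simp
  have hg : (inner ℝ · (1 : ℝ)).HasTemperateGrowth (E := ℝ) := by fun_prop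
  rw [hatFun, h, SchwartzMap.fourierInv_lineDerivOp_eq, hatFun]
  rw [smul_apply, SchwartzMap.smulLeftCLM_apply_apply hg]
  simp only [RCLike.inner_apply, conj_trivial, one_mul, neg_smul, mul_smul, Complex.coe_smul]

theorem norm_hatFun_deriv (a : 𝓢(ℝ × ℝ, R)) (τ ξ : ℝ) :
    ‖hatFun (∂_{((1 : ℝ), (0 : ℝ))} a) τ ξ‖ = 2 * Real.pi * |ξ| * ‖hatFun a τ ξ‖ := by
  rw [hatFun_deriv, norm_smul, norm_neg]
  simp [abs_of_pos Real.pi_pos]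

/-- Two derivatives in `s` give a factor `(2πξ)²`, which dominates `ξ²`. The resulting decay is
integrable in `ξ`, with integral `π`; this is where two integrable derivatives of the potential are
needed. -/
theorem norm_hatFun_le_inv (a : 𝓢(ℝ × ℝ, R)) (τ ξ : ℝ) : ‖hatFun a τ ξ‖ ≤
    (sliceNorm a τ + sliceNorm (∂_{((1 : ℝ), (0 : ℝ))} (∂_{((1 : ℝ), (0 : ℝ))} a)) τ) *
      (1 + ξ ^ 2)⁻¹ := by
  have h1 := norm_hatFun_le a τ ξ
  have h2 := norm_hatFun_le (∂_{((1 : ℝ), (0 : ℝ))} (∂_{((1 : ℝ), (0 : ℝ))} a)) τ ξ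
  rw [norm_hatFun_deriv, norm_hatFun_deriv] at h2
  rw [← div_eq_mul_inv, le_div_iff₀ (by positivity)]
  have h3 : (1 : ℝ) ≤ (2 * Real.pi) ^ 2 := by nlinarith [Real.pi_gt_three]
  have h4 : ξ ^ 2 * ‖hatFun a τ ξ‖ ≤ (2 * Real.pi) ^ 2 * (ξ ^ 2 * ‖hatFun a τ ξ‖) :=
    le_mul_of_one_le_left (by positivity) h3
  rw [← sq_abs ξ] at *
  nlinarith

/-- The bound for the `L¹` norm of the weighted partial Fourier transform. -/
noncomputable def hatBound (ρ : ℝ) (a : 𝓢(ℝ × ℝ, R)) (τ : ℝ) : ℝ :=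
  (sliceNorm a τ + sliceNorm (∂_{((1 : ℝ), (0 : ℝ))} (∂_{((1 : ℝ), (0 : ℝ))} a)) τ) +
    |ρ| * (sliceNorm (∂_{((1 : ℝ), (0 : ℝ))} a) τ +
      sliceNorm (∂_{((1 : ℝ), (0 : ℝ))} (∂_{((1 : ℝ), (0 : ℝ))} (∂_{((1 : ℝ), (0 : ℝ))} a))) τ)

theorem integrable_hatBound (ρ : ℝ) (a : 𝓢(ℝ × ℝ, R)) : Integrable (hatBound ρ a) :=
  ((integrable_sliceNorm _).add (integrable_sliceNorm _)).add
    (((integrable_sliceNorm _).add (integrable_sliceNorm _)).const_mul _)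

theorem integral_hatBound (ρ : ℝ) (a : 𝓢(ℝ × ℝ, R)) : ∫ τ, hatBound ρ a τ =
    ((∫ p, ‖a p‖) + ∫ p, ‖(∂_{((1 : ℝ), (0 : ℝ))} (∂_{((1 : ℝ), (0 : ℝ))} a)) p‖) +
      |ρ| * ((∫ p, ‖(∂_{((1 : ℝ), (0 : ℝ))} a) p‖) +
        ∫ p, ‖(∂_{((1 : ℝ), (0 : ℝ))} (∂_{((1 : ℝ), (0 : ℝ))} (∂_{((1 : ℝ), (0 : ℝ))} a))) p‖) := by
  have h1 : ∀ a b : 𝓢(ℝ × ℝ, R), Integrable fun τ => sliceNorm a τ + sliceNorm b τ := fun a b =>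
    (integrable_sliceNorm a).add (integrable_sliceNorm b)
  unfold hatBound
  rw [integral_add (h1 _ _) ((h1 _ _).const_mul _), integral_const_mul,
    integral_add (integrable_sliceNorm _) (integrable_sliceNorm _),
    integral_add (integrable_sliceNorm _) (integrable_sliceNorm _)]
  simp only [integral_sliceNorm]

theorem exists_hatBound_le (ρ : ℝ) (a : 𝓢(ℝ × ℝ, R)) : ∃ C : ℝ, ∀ τ, hatBound ρ a τ ≤ C := by
  obtain ⟨C0, h0⟩ := exists_sliceNorm_le a
  obtain ⟨C1, h1⟩ := exists_sliceNorm_le (∂_{((1 : ℝ), (0 : ℝ))} a)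
  obtain ⟨C2, h2⟩ := exists_sliceNorm_le (∂_{((1 : ℝ), (0 : ℝ))} (∂_{((1 : ℝ), (0 : ℝ))} a))
  obtain ⟨C3, h3⟩ := exists_sliceNorm_le
    (∂_{((1 : ℝ), (0 : ℝ))} (∂_{((1 : ℝ), (0 : ℝ))} (∂_{((1 : ℝ), (0 : ℝ))} a)))
  exact ⟨(C0 + C2) + |ρ| * (C1 + C3), fun τ => add_le_add (add_le_add (h0 τ) (h2 τ))
    (mul_le_mul_of_nonneg_left (add_le_add (h1 τ) (h3 τ)) (abs_nonneg ρ))⟩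

theorem norm_wt_smul_hatFun_le (ρ : ℝ) (a : 𝓢(ℝ × ℝ, R)) (τ ξ : ℝ) :
    ‖(wt ρ ξ : ℂ) • hatFun a τ ξ‖ ≤ hatBound ρ a τ * (1 + ξ ^ 2)⁻¹ := by
  rw [norm_smul, Complex.norm_real, Real.norm_of_nonneg (wt_pos ρ ξ).le, wt, add_mul, one_mul,
    hatBound, add_mul]
  refine add_le_add (norm_hatFun_le_inv a τ ξ) ?_
  have h := norm_hatFun_le_inv (∂_{((1 : ℝ), (0 : ℝ))} a) τ ξ
  rw [norm_hatFun_deriv] at h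
  rw [mul_assoc, mul_assoc]
  refine mul_le_mul_of_nonneg_left (le_trans ?_ h) (abs_nonneg ρ)
  have h3 : (1 : ℝ) ≤ 2 * Real.pi := by nlinarith [Real.pi_gt_three]
  calc |ξ| * ‖hatFun a τ ξ‖ ≤ (2 * Real.pi) * (|ξ| * ‖hatFun a τ ξ‖) :=
        le_mul_of_one_le_left (by positivity) h3
    _ = _ := by ring

theorem aestronglyMeasurable_wt_smul_hatFun (ρ : ℝ) (a : 𝓢(ℝ × ℝ, R)) (τ : ℝ) :
    AEStronglyMeasurable (fun ξ => (wt ρ ξ : ℂ) • hatFun a τ ξ) := by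
  refine Continuous.aestronglyMeasurable ?_
  exact (Complex.continuous_ofReal.comp (continuous_wt ρ)).smul (𝓕⁻ (slice a τ)).continuous

theorem integrable_wt_smul_hatFun (ρ : ℝ) (a : 𝓢(ℝ × ℝ, R)) (τ : ℝ) :
    Integrable fun ξ => (wt ρ ξ : ℂ) • hatFun a τ ξ :=
  (integrable_inv_one_add_sq.const_mul (hatBound ρ a τ)).mono'
    (aestronglyMeasurable_wt_smul_hatFun ρ a τ)
    (Eventually.of_forall (norm_wt_smul_hatFun_le ρ a τ))

/-- The partial Fourier transform as an element of `LOne R`. -/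
noncomputable def hatL1 (ρ : ℝ) (a : 𝓢(ℝ × ℝ, R)) (τ : ℝ) : LOne R :=
  (integrable_wt_smul_hatFun ρ a τ).toL1 _

theorem norm_hatL1_le (ρ : ℝ) (a : 𝓢(ℝ × ℝ, R)) (τ : ℝ) :
    ‖hatL1 ρ a τ‖ ≤ Real.pi * hatBound ρ a τ := by
  rw [hatL1, L1.norm_of_fun_eq_integral_norm, mul_comm, ← integral_univ_inv_one_add_sq,
    ← integral_const_mul]
  exact integral_mono (integrable_wt_smul_hatFun ρ a τ).norm
    (integrable_inv_one_add_sq.const_mul _) (norm_wt_smul_hatFun_le ρ a τ)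

theorem continuous_hatL1 (ρ : ℝ) (a : 𝓢(ℝ × ℝ, R)) : Continuous (hatL1 ρ a) := by
  obtain ⟨C, hC⟩ := exists_hatBound_le ρ a
  rw [continuous_iff_continuousAt]
  intro τ₀
  rw [ContinuousAt, tendsto_iff_norm_sub_tendsto_zero]
  have heq : ∀ τ, ‖hatL1 ρ a τ - hatL1 ρ a τ₀‖ =
      ∫ ξ, ‖(wt ρ ξ : ℂ) • hatFun a τ ξ - (wt ρ ξ : ℂ) • hatFun a τ₀ ξ‖ := fun τ => by
    rw [hatL1, hatL1, ← Integrable.toL1_sub, L1.norm_of_fun_eq_integral_norm]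
    rfl
  simp only [heq]
  have h0 : (0 : ℝ) = ∫ ξ : ℝ, (0 : ℝ) := by simp
  rw [h0]
  refine tendsto_integral_filter_of_dominated_convergence
    (fun ξ => C * (1 + ξ ^ 2)⁻¹ + C * (1 + ξ ^ 2)⁻¹) ?_ ?_
    ((integrable_inv_one_add_sq.const_mul C).add (integrable_inv_one_add_sq.const_mul C)) ?_
  · exact Eventually.of_forall fun τ => ((aestronglyMeasurable_wt_smul_hatFun ρ a τ).sub
      (aestronglyMeasurable_wt_smul_hatFun ρ a τ₀)).norm
  · refine Eventually.of_forall fun τ => Eventually.of_forall fun ξ => ?_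
    rw [norm_norm]
    have hle : ∀ τ, ‖(wt ρ ξ : ℂ) • hatFun a τ ξ‖ ≤ C * (1 + ξ ^ 2)⁻¹ := fun τ =>
      (norm_wt_smul_hatFun_le ρ a τ ξ).trans (by gcongr; exact hC τ)
    exact (norm_sub_le _ _).trans (add_le_add (hle τ) (hle τ₀))
  · refine Eventually.of_forall fun ξ => ?_
    have h : Continuous fun τ => ‖(wt ρ ξ : ℂ) • hatFun a τ ξ - (wt ρ ξ : ℂ) • hatFun a τ₀ ξ‖ :=
      ((continuous_const.smul (continuous_hatFun a ξ)).sub continuous_const).norm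
    simpa using h.tendsto τ₀

theorem integrable_norm_hatL1 (ρ : ℝ) (a : 𝓢(ℝ × ℝ, R)) : Integrable fun τ => ‖hatL1 ρ a τ‖ :=
  ((integrable_hatBound ρ a).const_mul Real.pi).mono'
    (continuous_hatL1 ρ a).norm.aestronglyMeasurable
    (Eventually.of_forall fun τ => by rw [norm_norm]; exact norm_hatL1_le ρ a τ)

theorem integral_norm_hatL1_le (ρ : ℝ) (a : 𝓢(ℝ × ℝ, R)) :
    ∫ τ, ‖hatL1 ρ a τ‖ ≤ Real.pi * ∫ τ, hatBound ρ a τ := by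
  rw [← integral_const_mul]
  exact integral_mono (integrable_norm_hatL1 ρ a) ((integrable_hatBound ρ a).const_mul Real.pi)
    (norm_hatL1_le ρ a)

/-- Fourier inversion on each horizontal line: evaluating the transformed coefficient recovers the
original one. -/
theorem ev_hatL1 [CompleteSpace R] (ρ s : ℝ) (a : 𝓢(ℝ × ℝ, R)) (τ : ℝ) :
    ev ρ s (hatL1 ρ a τ) = a (s, τ) := by
  have h : unwt ρ (hatL1 ρ a τ) =ᵐ[volume] hatFun a τ := by
    filter_upwards [Integrable.coeFn_toL1 (integrable_wt_smul_hatFun ρ a τ)] with ξ hξ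
    rw [unwt, hatL1, hξ, smul_smul, inv_mul_cancel₀, one_smul]
    exact_mod_cast (wt_pos ρ ξ).ne'
  have h2 : 𝓕 (unwt ρ (hatL1 ρ a τ)) s = 𝓕 (𝓕⁻ (slice a τ)) s := by
    rw [SchwartzMap.fourier_coe, Real.fourier_eq, Real.fourier_eq]
    refine integral_congr_ae ?_
    filter_upwards [h] with ξ hξ
    rw [hξ, hatFun]
  rw [ev_eq_fourier, h2, FourierTransform.fourier_fourierInv_eq, slice_apply]

end PartialFourier

/-! ### Splitting off the jump of the propagator. -/

section RegularPart

/-- The propagator multiplier without its jump at time `0`. -/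
noncomputable def regMult (γ : ℂ) (t ξ : ℝ) : ℂ :=
  if ξ < 0 then -Complex.exp (2 * Real.pi * Complex.I * γ * |ξ| * (max (-t) 0 : ℝ))
  else Complex.exp (2 * Real.pi * Complex.I * γ * |ξ| * (max t 0 : ℝ)) - 1

/-- As `t` increases through `0` the multiplier jumps by exactly `1` for every `ξ ≠ 0`: from `0` to
`1` if `ξ > 0`, from `-1` to `0` if `ξ < 0`. The jump therefore is the Heaviside function,
independent of the frequency, and the rest is continuous in `t`. -/
theorem propMult_eq_regMult_add (γ : ℂ) {t ξ : ℝ} (ht : t ≠ 0) (hξ : ξ ≠ 0) :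
    propMult γ t ξ = regMult γ t ξ + if 0 < t then 1 else 0 := by
  unfold propMult regMult
  rcases lt_or_gt_of_ne ht with h | h <;> rcases lt_or_gt_of_ne hξ with h' | h'
  · rw [if_pos (mul_pos_of_neg_of_neg h h'), if_neg h.le.not_gt, if_pos h', if_neg h.le.not_gt,
      max_eq_left (by linarith), abs_of_neg h']
    push_cast
    ring_nf
  · rw [if_neg (mul_neg_of_neg_of_pos h h').le.not_gt, if_neg h'.le.not_gt, if_neg h.le.not_gt,
      max_eq_right h.le]
    simp
  · rw [if_neg (mul_neg_of_pos_of_neg h h').le.not_gt, if_pos h', if_pos h,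
      max_eq_right (by linarith)]
    simp
  · rw [if_pos (mul_pos h h'), if_pos h, if_neg h'.le.not_gt, if_pos h, max_eq_left h.le,
      abs_of_pos h']
    push_cast
    ring_nf

theorem norm_exp_mul_le_one {c : ℂ} (hc : c.re ≤ 0) {r : ℝ} (hr : 0 ≤ r) :
    ‖Complex.exp (c * r)‖ ≤ 1 := by
  rw [Complex.norm_exp, Real.exp_le_one_iff, Complex.re_mul_ofReal]
  exact mul_nonpos_of_nonpos_of_nonneg hc hr

theorem hasDerivAt_exp_mul (c : ℂ) (r : ℝ) :
    HasDerivAt (fun r : ℝ => Complex.exp (c * r)) (c * Complex.exp (c * r)) r := by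
  have h := ((Complex.ofRealCLM.hasDerivAt (x := r)).const_mul c).cexp
  simpa [mul_comm] using h

theorem norm_exp_mul_sub_le {c : ℂ} (hc : c.re ≤ 0) {r r' : ℝ} (hr : 0 ≤ r) (hr' : 0 ≤ r') :
    ‖Complex.exp (c * r) - Complex.exp (c * r')‖ ≤ ‖c‖ * |r - r'| := by
  refine Convex.norm_image_sub_le_of_norm_hasDerivWithin_le (s := Set.Ici (0 : ℝ))
    (f := fun r : ℝ => Complex.exp (c * r)) (f' := fun r => c * Complex.exp (c * r))
    (fun x _ => (hasDerivAt_exp_mul c x).hasDerivWithinAt) (fun x hx => ?_) (convex_Ici 0)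
    hr' hr
  rw [norm_mul]
  exact mul_le_of_le_one_right (norm_nonneg _) (norm_exp_mul_le_one hc hx)

theorem re_propExponent_nonpos {γ : ℂ} (hγ : 0 ≤ γ.im) (ξ : ℝ) :
    (2 * Real.pi * Complex.I * γ * |ξ|).re ≤ 0 := by
  have h : (2 * Real.pi * Complex.I * γ * |ξ|).re = -(2 * Real.pi * γ.im * |ξ|) := by simp
  rw [h]
  have := Real.pi_pos
  have : 0 ≤ 2 * Real.pi * γ.im * |ξ| := by positivity
  linarith

theorem norm_regMult_le {γ : ℂ} (hγ : 0 ≤ γ.im) (t ξ : ℝ) : ‖regMult γ t ξ‖ ≤ 2 := by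
  unfold regMult
  split_ifs
  · rw [norm_neg]
    exact (norm_exp_mul_le_one (re_propExponent_nonpos hγ ξ) (le_max_right _ _)).trans one_le_two
  · refine (norm_sub_le _ _).trans ?_
    rw [norm_one]
    have := norm_exp_mul_le_one (re_propExponent_nonpos hγ ξ) (le_max_right t 0)
    linarith

/-- The regular part has a kink at `t = 0` but is Lipschitz, being an exponential with nonpositive
real rate composed with `max (±t) 0`. The Lipschitz constant grows like `|ξ|`, which the weight has
to pay for. -/
theorem norm_regMult_sub_le {γ : ℂ} (hγ : 0 ≤ γ.im) (t t' ξ : ℝ) :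
    ‖regMult γ t ξ - regMult γ t' ξ‖ ≤ 2 * Real.pi * ‖γ‖ * |ξ| * |t - t'| := by
  have hn : ‖2 * Real.pi * Complex.I * γ * |ξ|‖ = 2 * Real.pi * ‖γ‖ * |ξ| := by
    simp [abs_of_pos Real.pi_pos]
  unfold regMult
  split_ifs
  · rw [neg_sub_neg, norm_sub_rev]
    refine (norm_exp_mul_sub_le (re_propExponent_nonpos hγ ξ) (le_max_right _ _)
      (le_max_right _ _)).trans ?_
    rw [hn]
    have := Real.pi_pos
    refine mul_le_mul_of_nonneg_left ((abs_max_sub_max_le_abs _ _ _).trans_eq ?_) (by positivity)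
    rw [neg_sub_neg, abs_sub_comm]
  · rw [sub_sub_sub_cancel_right]
    refine (norm_exp_mul_sub_le (re_propExponent_nonpos hγ ξ) (le_max_right _ _)
      (le_max_right _ _)).trans ?_
    rw [hn]
    have := Real.pi_pos
    exact mul_le_mul_of_nonneg_left (abs_max_sub_max_le_abs _ _ _) (by positivity)

theorem measurable_regMult (γ : ℂ) (t : ℝ) : Measurable (regMult γ t) := by
  unfold regMult
  exact Measurable.ite (measurableSet_lt measurable_id measurable_const) (by fun_prop)
    (by fun_prop)

theorem continuous_regMult (γ : ℂ) (ξ : ℝ) : Continuous fun t => regMult γ t ξ := by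
  unfold regMult
  split_ifs <;> fun_prop

theorem hasDerivAt_regMult (γ : ℂ) {t ξ : ℝ} (ht : t ≠ 0) (hξ : ξ ≠ 0) :
    HasDerivAt (fun t => regMult γ t ξ) (2 * Real.pi * Complex.I * γ * ξ * propMult γ t ξ) t := by
  rcases lt_or_gt_of_ne ht with h | h <;> rcases lt_or_gt_of_ne hξ with h' | h'
  · have he : (fun t => regMult γ t ξ) =ᶠ[𝓝 t]
        fun t => -Complex.exp (2 * Real.pi * Complex.I * γ * ξ * t) := by
      filter_upwards [Iio_mem_nhds h] with r hr
      rw [regMult, if_pos h', max_eq_left (by linarith [Set.mem_Iio.1 hr]), abs_of_neg h']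
      push_cast
      ring_nf
    refine ((hasDerivAt_exp_mul (2 * Real.pi * Complex.I * γ * ξ) t).neg.congr_of_eventuallyEq
      he).congr_deriv ?_
    rw [propMult, if_pos (mul_pos_of_neg_of_neg h h'), if_neg h.le.not_gt]
    push_cast
    ring_nf
  · have he : (fun t => regMult γ t ξ) =ᶠ[𝓝 t] fun _ => 0 := by
      filter_upwards [Iio_mem_nhds h] with r hr
      rw [regMult, if_neg h'.le.not_gt, max_eq_right (Set.mem_Iio.1 hr).le]
      simp
    refine ((hasDerivAt_const t (0 : ℂ)).congr_of_eventuallyEq he).congr_deriv ?_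
    rw [propMult, if_neg (mul_neg_of_neg_of_pos h h').le.not_gt, mul_zero]
  · have he : (fun t => regMult γ t ξ) =ᶠ[𝓝 t] fun _ => -1 := by
      filter_upwards [Ioi_mem_nhds h] with r hr
      rw [regMult, if_pos h', max_eq_right (by linarith [Set.mem_Ioi.1 hr])]
      simp
    refine ((hasDerivAt_const t (-1 : ℂ)).congr_of_eventuallyEq he).congr_deriv ?_
    rw [propMult, if_neg (mul_neg_of_pos_of_neg h h').le.not_gt, mul_zero]
  · have he : (fun t => regMult γ t ξ) =ᶠ[𝓝 t]
        fun t => Complex.exp (2 * Real.pi * Complex.I * γ * ξ * t) - 1 := by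
      filter_upwards [Ioi_mem_nhds h] with r hr
      rw [regMult, if_neg h'.le.not_gt, max_eq_left (Set.mem_Ioi.1 hr).le, abs_of_pos h']
    refine (((hasDerivAt_exp_mul (2 * Real.pi * Complex.I * γ * ξ) t).sub_const
      1).congr_of_eventuallyEq he).congr_deriv ?_
    rw [propMult, if_pos (mul_pos h h'), if_pos h]
    push_cast
    ring_nf

end RegularPart

/-! ### Differentiating evaluations in `s` and `τ`. -/

section EvaluationDerivative

variable {R : Type*} [NormedRing R] [NormedAlgebra ℂ R]

/-- The multiplier of the derivative of `ev`. -/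
noncomputable def evDMult (ρ s ξ : ℝ) : ℂ := -(2 * Real.pi * Complex.I) * ξ * evMult ρ s ξ

theorem measurable_evDMult (ρ s : ℝ) : Measurable (evDMult ρ s) := by
  unfold evDMult
  exact Measurable.mul (by fun_prop) (measurable_evMult ρ s)

/-- This is the purpose of the weight: one factor `ξ`, hence one derivative, is controlled at the
price `1 / |ρ|`. That constant enters only regularity statements, never the size of the solution. -/
theorem abs_mul_norm_evMult_le {ρ : ℝ} (hρ : ρ ≠ 0) (s ξ : ℝ) :
    |ξ| * ‖evMult ρ s ξ‖ ≤ 1 / |ρ| := by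
  rw [evMult, norm_mul, Circle.norm_coe, one_mul, norm_inv, Complex.norm_real,
    Real.norm_of_nonneg (wt_pos ρ ξ).le, ← div_eq_mul_inv,
    div_le_div_iff₀ (wt_pos ρ ξ) (abs_pos.2 hρ), wt]
  linarith

theorem norm_evDMult_le {ρ : ℝ} (hρ : ρ ≠ 0) (s ξ : ℝ) :
    ‖evDMult ρ s ξ‖ ≤ 2 * Real.pi * (1 / |ρ|) := by
  have h : ‖evDMult ρ s ξ‖ = 2 * Real.pi * (|ξ| * ‖evMult ρ s ξ‖) := by
    rw [evDMult, norm_mul, norm_mul, norm_neg]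
    simp [abs_of_pos Real.pi_pos, mul_assoc]
  rw [h]
  have := Real.pi_pos
  gcongr
  exact abs_mul_norm_evMult_le hρ s ξ

theorem bddMultiplier_evDMult {ρ : ℝ} (hρ : ρ ≠ 0) (s : ℝ) : BddMultiplier (evDMult ρ s) :=
  ⟨measurable_evDMult ρ s, _, norm_evDMult_le hρ s⟩

variable [CompleteSpace R]

/-- The derivative of `ev` in the point of evaluation. -/
noncomputable def evD (ρ s : ℝ) : LOne R →L[ℂ] R := pairL1 (evDMult ρ s)

theorem hasDerivAt_ev {ρ : ℝ} (hρ : ρ ≠ 0) (s : ℝ) (a : LOne R) :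
    HasDerivAt (fun s => ev ρ s a) (evD ρ s a) s := by
  have hint : Integrable fun ξ : ℝ => ξ • unwt ρ a ξ := by
    refine ((lOne_integrable a).norm.const_mul (1 / |ρ|)).mono' ?_ (Eventually.of_forall fun ξ => ?_)
    · exact aestronglyMeasurable_id.smul (integrable_unwt ρ a).aestronglyMeasurable
    · have h := abs_mul_norm_evMult_le hρ 0 ξ
      rw [evMult, norm_mul, Circle.norm_coe, one_mul, norm_inv, Complex.norm_real,
        Real.norm_of_nonneg (wt_pos ρ ξ).le] at h
      rw [norm_smul, norm_unwt, ← mul_assoc, Real.norm_eq_abs]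
      gcongr
  have h := Real.hasDerivAt_fourier (integrable_unwt ρ a) hint s
  have he : (fun s => ev ρ s a) = FourierTransform.fourier (unwt ρ a) :=
    funext fun s => ev_eq_fourier ρ s a
  rw [he]
  refine h.congr_deriv ?_
  rw [evD, pairL1_apply (bddMultiplier_evDMult hρ s), Real.fourier_eq]
  refine integral_congr_ae (Eventually.of_forall fun ξ => ?_)
  simp only [evDMult, evMult, unwt, RCLike.inner_apply, conj_trivial, Circle.smul_def, mul_comm s,
    smul_smul]
  congr 1
  ring

theorem tendsto_evD {ι : Type*} {l : Filter ι} [l.IsCountablyGenerated] {ρ : ℝ} (hρ : ρ ≠ 0)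
    {s : ι → ℝ} {s₀ : ℝ} (hs : Tendsto s l (𝓝 s₀)) {a : ι → LOne R} {a₀ : LOne R}
    (ha : Tendsto a l (𝓝 a₀)) : Tendsto (fun i => evD ρ (s i) (a i)) l (𝓝 (evD ρ s₀ a₀)) :=
  tendsto_pairL1 (fun i => measurable_evDMult ρ (s i)) (fun i => norm_evDMult_le hρ (s i))
    (measurable_evDMult ρ s₀) (norm_evDMult_le hρ s₀)
    (Eventually.of_forall fun ξ => ((tendsto_evMult ρ s₀ ξ).comp hs).const_mul _) ha

/-- The regular part of the propagator, evaluated at a point. -/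
noncomputable def regPair (ρ s : ℝ) (γ : ℂ) (t : ℝ) : LOne R →L[ℂ] R :=
  pairL1 fun ξ => evMult ρ s ξ * regMult γ t ξ

theorem measurable_regPairMult (ρ s : ℝ) (γ : ℂ) (t : ℝ) :
    Measurable fun ξ => evMult ρ s ξ * regMult γ t ξ :=
  (measurable_evMult ρ s).mul (measurable_regMult γ t)

theorem norm_regPairMult_le (ρ s : ℝ) {γ : ℂ} (hγ : 0 ≤ γ.im) (t ξ : ℝ) :
    ‖evMult ρ s ξ * regMult γ t ξ‖ ≤ 2 := by
  rw [norm_mul]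
  calc _ ≤ 1 * 2 := mul_le_mul (norm_evMult_le ρ s ξ) (norm_regMult_le hγ t ξ) (norm_nonneg _)
        zero_le_one
    _ = 2 := one_mul _

theorem bddMultiplier_regPairMult (ρ s : ℝ) {γ : ℂ} (hγ : 0 ≤ γ.im) (t : ℝ) :
    BddMultiplier fun ξ => evMult ρ s ξ * regMult γ t ξ :=
  ⟨measurable_regPairMult ρ s γ t, 2, norm_regPairMult_le ρ s hγ t⟩

theorem continuous_regPair (ρ s : ℝ) {γ : ℂ} (hγ : 0 ≤ γ.im) {t : ℝ → ℝ} (ht : Continuous t)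
    {a : ℝ → LOne R} (ha : Continuous a) : Continuous fun σ => regPair ρ s γ (t σ) (a σ) := by
  rw [continuous_iff_continuousAt]
  intro σ
  exact tendsto_pairL1 (fun σ => measurable_regPairMult ρ s γ (t σ))
    (fun σ => norm_regPairMult_le ρ s hγ (t σ)) (measurable_regPairMult ρ s γ (t σ))
    (norm_regPairMult_le ρ s hγ (t σ))
    (Eventually.of_forall fun ξ => (((continuous_regMult γ ξ).comp ht).tendsto σ).const_mul _)
    (ha.tendsto σ)

theorem norm_regPairMult_sub_le {ρ : ℝ} (hρ : ρ ≠ 0) (s : ℝ) {γ : ℂ} (hγ : 0 ≤ γ.im) (t t' ξ : ℝ) :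
    ‖evMult ρ s ξ * regMult γ t ξ - evMult ρ s ξ * regMult γ t' ξ‖ ≤
      2 * Real.pi * ‖γ‖ * (1 / |ρ|) * |t - t'| := by
  rw [← mul_sub, norm_mul]
  have := Real.pi_pos
  calc _ ≤ ‖evMult ρ s ξ‖ * (2 * Real.pi * ‖γ‖ * |ξ| * |t - t'|) := by
        gcongr; exact norm_regMult_sub_le hγ t t' ξ
    _ = 2 * Real.pi * ‖γ‖ * (|ξ| * ‖evMult ρ s ξ‖) * |t - t'| := by ring
    _ ≤ _ := by gcongr; exact abs_mul_norm_evMult_le hρ s ξ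

theorem norm_regPair_sub_le {ρ : ℝ} (hρ : ρ ≠ 0) (s : ℝ) {γ : ℂ} (hγ : 0 ≤ γ.im) (t t' : ℝ)
    (a : LOne R) : ‖regPair ρ s γ t a - regPair ρ s γ t' a‖ ≤
      2 * Real.pi * ‖γ‖ * (1 / |ρ|) * ‖a‖ * |t - t'| := by
  rw [regPair, regPair, pairL1_apply (bddMultiplier_regPairMult ρ s hγ t),
    pairL1_apply (bddMultiplier_regPairMult ρ s hγ t'),
    ← integral_sub ((bddMultiplier_regPairMult ρ s hγ t).integrable_smul (lOne_integrable a))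
      ((bddMultiplier_regPairMult ρ s hγ t').integrable_smul (lOne_integrable a)),
    mul_right_comm, L1.norm_eq_integral_norm, ← integral_const_mul]
  refine norm_integral_le_of_norm_le ((lOne_integrable a).norm.const_mul _)
    (Eventually.of_forall fun ξ => ?_)
  rw [← sub_smul, norm_smul]
  gcongr
  exact norm_regPairMult_sub_le hρ s hγ t t' ξ

theorem hasDerivAt_regPair {ρ : ℝ} (hρ : ρ ≠ 0) (s : ℝ) {γ : ℂ} (hγ : 0 ≤ γ.im) {t : ℝ}
    (ht : t ≠ 0) (a : LOne R) : HasDerivAt (fun t => regPair ρ s γ t a)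
      (-(γ • evD ρ s (mulL1 (propMult γ t) a))) t := by
  have hprod : BddMultiplier fun ξ => evDMult ρ s ξ * propMult γ t ξ := by
    refine ⟨(measurable_evDMult ρ s).mul (measurable_propMult γ t), 2 * Real.pi * (1 / |ρ|) * 1,
      fun ξ => ?_⟩
    rw [norm_mul]
    exact mul_le_mul (norm_evDMult_le hρ s ξ) (norm_propMult_le hγ t ξ) (norm_nonneg _)
      ((norm_nonneg _).trans (norm_evDMult_le hρ s ξ))
  have hval : -(γ • evD ρ s (mulL1 (propMult γ t) a)) =
      ∫ ξ, -(γ • ((evDMult ρ s ξ * propMult γ t ξ) • a ξ)) := by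
    rw [evD, pairL1_mulL1 (bddMultiplier_evDMult hρ s) (bddMultiplier_propMult hγ t),
      pairL1_apply hprod, integral_neg, integral_smul]
  have hfun : (fun t => regPair ρ s γ t a) =
      fun t => ∫ ξ, (evMult ρ s ξ * regMult γ t ξ) • a ξ :=
    funext fun t => pairL1_apply (bddMultiplier_regPairMult ρ s hγ t) a
  rw [hval, hfun]
  have hint : ∀ t, Integrable fun ξ => (evMult ρ s ξ * regMult γ t ξ) • a ξ := fun t =>
    (bddMultiplier_regPairMult ρ s hγ t).integrable_smul (lOne_integrable a)
  refine (hasDerivAt_integral_of_dominated_loc_of_lip (s := Set.univ)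
    (bound := fun ξ => 2 * Real.pi * ‖γ‖ * (1 / |ρ|) * ‖a ξ‖) univ_mem
    (Eventually.of_forall fun t => (hint t).aestronglyMeasurable) (hint t) ?_ ?_
    ((lOne_integrable a).norm.const_mul _) ?_).2
  · exact ((hprod.integrable_smul (lOne_integrable a)).smul γ).neg.aestronglyMeasurable
  · refine Eventually.of_forall fun ξ => LipschitzOnWith.of_dist_le_mul fun x _ y _ => ?_
    have := Real.pi_pos
    rw [dist_eq_norm, dist_eq_norm, ← sub_smul, norm_smul, Real.coe_nnabs,
      abs_of_nonneg (by positivity), mul_right_comm, Real.norm_eq_abs]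
    gcongr
    exact norm_regPairMult_sub_le hρ s hγ x y ξ
  · have h0 : ∀ᵐ ξ : ℝ, ξ ≠ 0 := measure_eq_zero_iff_ae_notMem.1 (Real.volume_singleton (a := 0))
    filter_upwards [h0] with ξ hξ
    refine (((hasDerivAt_regMult γ ht hξ).const_mul (evMult ρ s ξ)).smul_const
      (a ξ)).congr_deriv ?_
    rw [smul_smul, ← neg_smul]
    congr 1
    rw [evDMult]
    ring

/-- The frequency-independent jump evaluates to `ev` itself, so it will contribute the source term
when differentiating in `τ`. -/
theorem ev_mulL1_propMult (ρ s : ℝ) {γ : ℂ} (hγ : 0 ≤ γ.im) {t : ℝ} (ht : t ≠ 0) (a : LOne R) :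
    ev ρ s (mulL1 (propMult γ t) a) = regPair ρ s γ t a + if 0 < t then ev ρ s a else 0 := by
  have hb : BddMultiplier fun ξ => evMult ρ s ξ * propMult γ t ξ := by
    refine ⟨(measurable_evMult ρ s).mul (measurable_propMult γ t), 1, fun ξ => ?_⟩
    rw [norm_mul]
    exact mul_le_one₀ (norm_evMult_le ρ s ξ) (norm_nonneg _) (norm_propMult_le hγ t ξ)
  have h0 : ∀ᵐ ξ : ℝ, ξ ≠ 0 := measure_eq_zero_iff_ae_notMem.1 (Real.volume_singleton (a := 0))
  rw [ev, pairL1_mulL1 (bddMultiplier_evMult ρ s) (bddMultiplier_propMult hγ t), pairL1_apply hb,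
    regPair, pairL1_apply (bddMultiplier_regPairMult ρ s hγ t)]
  have hr := (bddMultiplier_regPairMult ρ s hγ t).integrable_smul (lOne_integrable a)
  split_ifs with h
  · rw [pairL1_apply (bddMultiplier_evMult ρ s), ← integral_add hr
      ((bddMultiplier_evMult ρ s).integrable_smul (lOne_integrable a))]
    refine integral_congr_ae ?_
    filter_upwards [h0] with ξ hξ
    rw [propMult_eq_regMult_add γ ht hξ, if_pos h, ← add_smul]
    ring_nf
  · rw [add_zero]
    refine integral_congr_ae ?_
    filter_upwards [h0] with ξ hξ
    rw [propMult_eq_regMult_add γ ht hξ, if_neg h, add_zero]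

end EvaluationDerivative

/-! ### The differential equation and decay at infinity for propagated sources. -/

section Evolution

variable {R : Type*} [NormedRing R] [NormedAlgebra ℂ R]

theorem ae_ne (τ : ℝ) : ∀ᵐ σ : ℝ, σ ≠ τ :=
  measure_eq_zero_iff_ae_notMem.1 (Real.volume_singleton (a := τ))

theorem aestronglyMeasurable_propagate {γ : ℂ} (hγ : 0 ≤ γ.im) {F : ℝ → LOne R}
    (hF : Continuous F) (τ : ℝ) :
    AEStronglyMeasurable fun σ => mulL1 (propMult γ (τ - σ)) (F σ) :=
  (isPropagator_mulL1 (R := R) (Γ := Unit) (g := fun _ => γ) continuous_const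
    fun _ => hγ).aestronglyMeasurable (F := fun q => F q.2) (by fun_prop) () τ

theorem norm_propagate_le {γ : ℂ} (hγ : 0 ≤ γ.im) (t : ℝ) (a : LOne R) :
    ‖mulL1 (propMult γ t) a‖ ≤ ‖a‖ := by
  simpa using norm_mulL1_apply_le (measurable_propMult γ t) (norm_propMult_le hγ t) a

theorem integrable_propagate {γ : ℂ} (hγ : 0 ≤ γ.im) {F : ℝ → LOne R}
    (hF : Continuous F) (hFi : Integrable F) (τ : ℝ) :
    Integrable fun σ => mulL1 (propMult γ (τ - σ)) (F σ) :=
  hFi.norm.mono' (aestronglyMeasurable_propagate hγ hF τ)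
    (Eventually.of_forall fun _ => norm_propagate_le hγ _ _)

/-- The solution of `∂_τ e + γ ∂_s e = F` given by the propagator. -/
noncomputable def propagate (γ : ℂ) (F : ℝ → LOne R) (τ : ℝ) : LOne R :=
  ∫ σ, mulL1 (propMult γ (τ - σ)) (F σ)

/-- For `Im γ > 0` the multiplier decays exponentially in `|t|` at every nonzero frequency, but not
uniformly near `ξ = 0`; the limit is therefore strong, by dominated convergence. -/
theorem tendsto_mulL1_propMult_zero {γ : ℂ} (hγ : 0 < γ.im) (a : LOne R) :
    Tendsto (fun t => mulL1 (propMult γ t) a) (cocompact ℝ) (𝓝 0) := by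
  have : (cocompact ℝ).IsCountablyGenerated := by
    rw [cocompact_eq_atBot_atTop]; infer_instance
  have h0 : mulL1 (fun _ => 0) a = 0 := by
    rw [← norm_le_zero_iff]
    simpa using norm_mulL1_apply_le (m := fun _ => 0) (C := 0) measurable_const (by simp) a
  rw [← h0]
  refine tendsto_mulL1 (C := 1) (fun t => measurable_propMult γ t) (fun t => norm_propMult_le hγ.le t)
    measurable_const (by simp) ?_ tendsto_const_nhds
  filter_upwards [ae_ne 0] with ξ hξ
  refine squeeze_zero_norm (a := fun t => Real.exp (-(2 * Real.pi * γ.im * |ξ| * |t|))) (fun t => ?_) ?_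
  · unfold propMult
    split_ifs with h h'
    · rw [one_mul, norm_exp_propMult, Real.exp_le_exp, ← abs_of_pos h, abs_mul]
      exact le_of_eq (by ring)
    · rw [neg_one_mul, norm_neg, norm_exp_propMult, Real.exp_le_exp, ← abs_of_pos h, abs_mul]
      exact le_of_eq (by ring)
    · rw [norm_zero]
      exact (Real.exp_pos _).le
  · refine Real.tendsto_exp_neg_atTop_nhds_zero.comp ?_
    refine Tendsto.const_mul_atTop ?_ tendsto_norm_cocompact_atTop
    have := Real.pi_pos
    positivity

theorem tendsto_propagate_cocompact {γ : ℂ} (hγ : 0 < γ.im) {F : ℝ → LOne R}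
    (hF : Continuous F) (hFi : Integrable F) :
    Tendsto (propagate γ F) (cocompact ℝ) (𝓝 0) := by
  have : (cocompact ℝ).IsCountablyGenerated := by
    rw [cocompact_eq_atBot_atTop]; infer_instance
  have h0 : (0 : LOne R) = ∫ σ : ℝ, (0 : LOne R) := by simp
  rw [h0]
  refine tendsto_integral_filter_of_dominated_convergence (fun σ => ‖F σ‖)
    (Eventually.of_forall fun τ => aestronglyMeasurable_propagate hγ.le hF τ)
    (Eventually.of_forall fun τ => Eventually.of_forall fun σ => norm_propagate_le hγ.le _ _)
    hFi.norm (Eventually.of_forall fun σ => ?_)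
  refine (tendsto_mulL1_propMult_zero hγ (F σ)).comp ?_
  exact (Homeomorph.subRight σ).isClosedEmbedding.tendsto_cocompact

variable [CompleteSpace R]

theorem hasDerivAt_integral_ite {f : ℝ → R} (hf : Continuous f) (hfi : Integrable f) (τ : ℝ) :
    HasDerivAt (fun τ => ∫ σ, if 0 < τ - σ then f σ else 0) (f τ) τ := by
  have h : (fun τ => ∫ σ, if 0 < τ - σ then f σ else 0) =
      fun τ => (∫ σ in (0 : ℝ)..τ, f σ) + ∫ σ in Set.Iic 0, f σ := by
    funext τ
    rw [← intervalIntegral.integral_Iic_sub_Iic hfi.integrableOn hfi.integrableOn, sub_add_cancel,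
      ← integral_indicator measurableSet_Iic]
    refine integral_congr_ae ?_
    filter_upwards [ae_ne τ] with σ hσ
    by_cases h : σ < τ
    · rw [if_pos (sub_pos.2 h), Set.indicator_of_mem (Set.mem_Iic.2 h.le)]
    · rw [if_neg (fun h' => h (sub_pos.1 h')), Set.indicator_of_notMem]
      exact fun h' => h (lt_of_le_of_ne h' hσ)
  rw [h]
  exact (hf.integral_hasStrictDerivAt 0 τ).hasDerivAt.add_const _

/-- The Heaviside part differentiates to the source by the fundamental theorem of calculus. The
regular part is Lipschitz in `τ` with integrable constant and differentiable for `σ ≠ τ`, with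
derivative `-γ` times the `s`-derivative. -/
theorem hasDerivAt_ev_propagate {ρ : ℝ} (hρ : ρ ≠ 0) (s : ℝ) {γ : ℂ} (hγ : 0 ≤ γ.im)
    {F : ℝ → LOne R} (hF : Continuous F) (hFi : Integrable F) (τ : ℝ) :
    HasDerivAt (fun τ => ev ρ s (propagate γ F τ))
      (ev ρ s (F τ) - γ • evD ρ s (propagate γ F τ)) τ := by
  have hevF : Continuous fun σ => ev ρ s (F σ) := (ev ρ s).continuous.comp hF
  have hevFi : Integrable fun σ => ev ρ s (F σ) := (ev ρ s).integrable_comp hFi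
  have hcont : ∀ τ, Continuous fun σ => regPair ρ s γ (τ - σ) (F σ) := fun τ =>
    continuous_regPair ρ s hγ (by fun_prop) hF
  have hbd : ∀ t (a : LOne R), ‖regPair ρ s γ t a‖ ≤ 2 * ‖a‖ := fun t a =>
    norm_pairL1_apply_le (measurable_regPairMult ρ s γ t) (norm_regPairMult_le ρ s hγ t) a
  have hint : ∀ τ, Integrable fun σ => regPair ρ s γ (τ - σ) (F σ) := fun τ =>
    (hFi.norm.const_mul 2).mono' (hcont τ).aestronglyMeasurable
      (Eventually.of_forall fun σ => hbd _ _)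
  have hite : ∀ τ, Integrable fun σ => if 0 < τ - σ then ev ρ s (F σ) else 0 := fun τ => by
    have h := hevFi.indicator (measurableSet_Iio (a := τ))
    refine h.congr (Eventually.of_forall fun σ => ?_)
    simp only [Set.indicator_apply, Set.mem_Iio, sub_pos]
  have hfun : (fun τ => ev ρ s (propagate γ F τ)) = fun τ =>
      (∫ σ, regPair ρ s γ (τ - σ) (F σ)) + ∫ σ, if 0 < τ - σ then ev ρ s (F σ) else 0 := by
    funext τ
    rw [propagate, ← (ev ρ s).integral_comp_comm (integrable_propagate hγ hF hFi τ),
      ← integral_add (hint τ) (hite τ)]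
    refine integral_congr_ae ?_
    filter_upwards [ae_ne τ] with σ hσ
    exact ev_mulL1_propMult ρ s hγ (sub_ne_zero.2 hσ.symm) (F σ)
  have hval : ev ρ s (F τ) - γ • evD ρ s (propagate γ F τ) =
      (∫ σ, -(γ • evD ρ s (mulL1 (propMult γ (τ - σ)) (F σ)))) + ev ρ s (F τ) := by
    rw [propagate, ← (evD ρ s).integral_comp_comm (integrable_propagate hγ hF hFi τ),
      integral_neg, integral_smul]
    abel
  rw [hfun, hval]
  refine HasDerivAt.add ?_ (hasDerivAt_integral_ite hevF hevFi τ)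
  refine (hasDerivAt_integral_of_dominated_loc_of_lip (s := Set.univ)
    (bound := fun σ => 2 * Real.pi * ‖γ‖ * (1 / |ρ|) * ‖F σ‖) univ_mem
    (Eventually.of_forall fun τ => (hcont τ).aestronglyMeasurable) (hint τ) ?_ ?_
    (hFi.norm.const_mul _) ?_).2
  · exact (((evD ρ s).continuous.comp_aestronglyMeasurable
      (aestronglyMeasurable_propagate hγ hF τ)).const_smul γ).neg
  · refine Eventually.of_forall fun σ => LipschitzOnWith.of_dist_le_mul fun x _ y _ => ?_
    have := Real.pi_pos
    rw [dist_eq_norm, dist_eq_norm, Real.coe_nnabs, abs_of_nonneg (by positivity), Real.norm_eq_abs]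
    refine (norm_regPair_sub_le hρ s hγ _ _ (F σ)).trans_eq ?_
    rw [sub_sub_sub_cancel_right]
  · filter_upwards [ae_ne τ] with σ hσ
    have h := hasDerivAt_regPair hρ s hγ (sub_ne_zero.2 hσ.symm) (F σ)
    exact h.comp_sub_const τ σ

/-- Outside a compact set of `τ` the norm of `e` is small. On that compact set the Riemann–Lebesgue
decay in `s` is locally uniform, because `‖ev‖ ≤ 1` and `e` is continuous, hence uniform by
compactness. -/
theorem tendsto_ev_cocompact_of_continuous (ρ : ℝ) {e : ℝ → LOne R} (he : Continuous e)
    (he0 : Tendsto e (cocompact ℝ) (𝓝 0)) :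
    Tendsto (fun p : ℝ × ℝ => ev ρ p.1 (e p.2)) (cocompact (ℝ × ℝ)) (𝓝 0) := by
  rw [Metric.tendsto_nhds]
  intro ε hε
  have h1 : ∀ᶠ τ in cocompact ℝ, ‖e τ‖ < ε := by
    have := Metric.tendsto_nhds.1 he0 ε hε
    simpa using this
  obtain ⟨K, hK, hKe⟩ := mem_cocompact.1 h1
  have h2 : {p : ℝ × ℝ | ‖ev ρ p.1 (e p.2)‖ < ε} ∈ cocompact ℝ ×ˢ 𝓝ˢ K := by
    refine hK.mem_prod_nhdsSet_of_forall fun τ _ => ?_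
    have h3 : ∀ᶠ s in cocompact ℝ, ‖ev ρ s (e τ)‖ < ε / 2 := by
      have := Metric.tendsto_nhds.1 (tendsto_ev_cocompact ρ (e τ)) (ε / 2) (by positivity)
      simpa using this
    have h4 : ∀ᶠ σ in 𝓝 τ, ‖e σ - e τ‖ < ε / 2 := by
      have := Metric.tendsto_nhds.1 (he.tendsto τ) (ε / 2) (by positivity)
      simpa [dist_eq_norm] using this
    filter_upwards [prod_mem_prod h3 h4] with p hp
    obtain ⟨hp1, hp2⟩ := hp
    have h5 : ev ρ p.1 (e p.2) = ev ρ p.1 (e p.2 - e τ) + ev ρ p.1 (e τ) := by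
      rw [map_sub, sub_add_cancel]
    have h6 := norm_ev_le ρ p.1 (e p.2 - e τ)
    simp only [Set.mem_ofPred_eq] at hp1 hp2 ⊢
    rw [h5]
    refine (norm_add_le _ _).trans_lt ?_
    linarith
  obtain ⟨S, hS, T, hT, hST⟩ := Filter.mem_prod_iff.1 h2
  have hKT : K ⊆ T := subset_of_mem_nhdsSet hT
  obtain ⟨K', hK', hKS⟩ := mem_cocompact.1 hS
  filter_upwards [(hK'.prod hK).compl_mem_cocompact] with p hp
  rw [dist_zero_right]
  by_cases h : p.2 ∈ K
  · have h' : p.1 ∈ S := hKS fun h1 => hp ⟨h1, h⟩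
    exact hST (Set.mk_mem_prod h' (hKT h))
  · exact (norm_ev_le ρ p.1 (e p.2)).trans_lt (hKe h)

end Evolution

/-! ### Continuous partial derivatives imply `C¹`. -/

section PartialDerivatives

variable {F : Type*} [NormedAddCommGroup F] [NormedSpace ℝ F]

/-- A function on the plane with continuous partial derivatives is `C¹`. -/
theorem hasStrictFDerivAt_of_partials {f d₁ d₂ : ℝ × ℝ → F}
    (h₁ : ∀ s t, HasDerivAt (fun s => f (s, t)) (d₁ (s, t)) s)
    (h₂ : ∀ s t, HasDerivAt (fun t => f (s, t)) (d₂ (s, t)) t)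
    (hd₁ : Continuous d₁) (hd₂ : Continuous d₂) (p : ℝ × ℝ) :
    HasStrictFDerivAt f ((ContinuousLinearMap.toSpanSingleton ℝ (d₁ p)).coprod
      (ContinuousLinearMap.toSpanSingleton ℝ (d₂ p))) p := by
  have hc : ∀ {d : ℝ × ℝ → F}, Continuous d →
      Continuous fun p => ContinuousLinearMap.toSpanSingleton ℝ (d p) := fun hd =>
    (ContinuousLinearMap.toSpanSingletonCLE (𝕜 := ℝ) (E := F)).continuous.comp hd
  exact hasStrictFDerivAt_uncurry_coprod (f := fun s t => f (s, t))
    (f₁ := fun s t => ContinuousLinearMap.toSpanSingleton ℝ (d₁ (s, t)))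
    (f₂ := fun s t => ContinuousLinearMap.toSpanSingleton ℝ (d₂ (s, t))) (u := p)
    (Eventually.of_forall fun v => (h₁ v.1 v.2).hasFDerivAt)
    (Eventually.of_forall fun v => (h₂ v.1 v.2).hasFDerivAt)
    (hc hd₁).continuousAt (hc hd₂).continuousAt

theorem contDiff_one_of_partials {f d₁ d₂ : ℝ × ℝ → F}
    (h₁ : ∀ s t, HasDerivAt (fun s => f (s, t)) (d₁ (s, t)) s)
    (h₂ : ∀ s t, HasDerivAt (fun t => f (s, t)) (d₂ (s, t)) t)
    (hd₁ : Continuous d₁) (hd₂ : Continuous d₂) :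
    ContDiff ℝ 1 f ∧ ∀ p, fderiv ℝ f p (1, 0) = d₁ p ∧ fderiv ℝ f p (0, 1) = d₂ p := by
  have hs := hasStrictFDerivAt_of_partials h₁ h₂ hd₁ hd₂
  have hc : ∀ {d : ℝ × ℝ → F}, Continuous d →
      Continuous fun p => ContinuousLinearMap.toSpanSingleton ℝ (d p) := fun hd =>
    (ContinuousLinearMap.toSpanSingletonCLE (𝕜 := ℝ) (E := F)).continuous.comp hd
  have hf : fderiv ℝ f = fun p => (ContinuousLinearMap.toSpanSingleton ℝ (d₁ p)).coprod
      (ContinuousLinearMap.toSpanSingleton ℝ (d₂ p)) := funext fun p => (hs p).hasFDerivAt.fderiv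
  refine ⟨contDiff_one_iff_fderiv.2 ⟨fun p => (hs p).hasFDerivAt.differentiableAt, ?_⟩, fun p => ?_⟩
  · have h : (fun p => (ContinuousLinearMap.toSpanSingleton ℝ (d₁ p)).coprod
        (ContinuousLinearMap.toSpanSingleton ℝ (d₂ p))) = fun p =>
        (ContinuousLinearMap.toSpanSingleton ℝ (d₁ p)).comp (ContinuousLinearMap.fst ℝ ℝ ℝ) +
        (ContinuousLinearMap.toSpanSingleton ℝ (d₂ p)).comp (ContinuousLinearMap.snd ℝ ℝ ℝ) := by
      funext p; ext <;> simp
    rw [hf, h]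
    exact ((hc hd₁).clm_comp continuous_const).add ((hc hd₂).clm_comp continuous_const)
  · rw [hf]
    simp

end PartialDerivatives

/-! ### Solutions near `1` of the normalized equation. -/

section Chart

open scoped LineDeriv

variable {R : Type*} [NormedRing R] [NormedAlgebra ℂ R]

/-- The part of the `W^{2,1}` norm that controls the partial Fourier transform. -/
noncomputable def normS (a : 𝓢(ℝ × ℝ, R)) : ℝ :=
  (∫ p, ‖a p‖) + ∫ p, ‖(∂_{((1 : ℝ), (0 : ℝ))} (∂_{((1 : ℝ), (0 : ℝ))} a)) p‖

theorem integral_hatBound_eq (ρ : ℝ) (a : 𝓢(ℝ × ℝ, R)) :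
    ∫ τ, hatBound ρ a τ = normS a + |ρ| * normS (∂_{((1 : ℝ), (0 : ℝ))} a) :=
  integral_hatBound ρ a

theorem normS_nonneg (a : 𝓢(ℝ × ℝ, R)) : 0 ≤ normS a :=
  add_nonneg (integral_nonneg fun _ => norm_nonneg _) (integral_nonneg fun _ => norm_nonneg _)

/-- The weight adds only `ρ` times norms involving a third derivative, which are finite but
uncontrolled. As the hypothesis is a strict inequality, a `ρ` depending on the coefficients fits
into the gap. The factors `2` and `3` are the bounds on `γ` and `κ` in the charts. -/
theorem exists_integral_norm_hatL1_lt (a₀ a₁ a₂ : 𝓢(ℝ × ℝ, R)) {η : ℝ}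
    (hsmall : Real.pi * (normS a₀ + 2 * normS a₁ + 3 * normS a₂) < η) :
    ∃ ρ : ℝ, ρ ≠ 0 ∧ ∫ τ, (‖hatL1 ρ a₀ τ‖ + 2 * ‖hatL1 ρ a₁ τ‖ + 3 * ‖hatL1 ρ a₂ τ‖) ≤ η := by
  set D := normS (∂_{((1 : ℝ), (0 : ℝ))} a₀) + 2 * normS (∂_{((1 : ℝ), (0 : ℝ))} a₁) +
    3 * normS (∂_{((1 : ℝ), (0 : ℝ))} a₂) with hD
  set S := normS a₀ + 2 * normS a₁ + 3 * normS a₂ with hS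
  have hD0 : 0 ≤ D := by
    have h0 := normS_nonneg (∂_{((1 : ℝ), (0 : ℝ))} a₀)
    have h1 := normS_nonneg (∂_{((1 : ℝ), (0 : ℝ))} a₁)
    have h2 := normS_nonneg (∂_{((1 : ℝ), (0 : ℝ))} a₂)
    positivity
  have hpi := Real.pi_pos
  -- Chosen so that `π ρ (D + 1)` is exactly the slack `η - π S`; the `+ 1` avoids division by zero.
  set ρ := (η - Real.pi * S) / (Real.pi * (D + 1)) with hρ
  have hρ0 : 0 < ρ := div_pos (by linarith) (by positivity)
  refine ⟨ρ, hρ0.ne', ?_⟩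
  have h0 := integral_norm_hatL1_le ρ a₀
  have h1 := integral_norm_hatL1_le ρ a₁
  have h2 := integral_norm_hatL1_le ρ a₂
  rw [integral_hatBound_eq, abs_of_pos hρ0] at h0 h1 h2
  have i0 := integrable_norm_hatL1 ρ a₀
  have i1 := (integrable_norm_hatL1 ρ a₁).const_mul 2
  have i2 := (integrable_norm_hatL1 ρ a₂).const_mul 3
  have i01 : Integrable fun τ => ‖hatL1 ρ a₀ τ‖ + 2 * ‖hatL1 ρ a₁ τ‖ := i0.add i1
  rw [integral_add i01 i2, integral_add i0 i1, integral_const_mul, integral_const_mul]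
  have hkey : Real.pi * (ρ * (D + 1)) = η - Real.pi * S := by
    rw [hρ]; field_simp
  have h3 : Real.pi * (ρ * D) ≤ Real.pi * (ρ * (D + 1)) := by gcongr; linarith
  have h4 : Real.pi * (normS a₀ + ρ * normS (∂_{((1 : ℝ), (0 : ℝ))} a₀)) +
      2 * (Real.pi * (normS a₁ + ρ * normS (∂_{((1 : ℝ), (0 : ℝ))} a₁))) +
      3 * (Real.pi * (normS a₂ + ρ * normS (∂_{((1 : ℝ), (0 : ℝ))} a₂))) =
      Real.pi * S + Real.pi * (ρ * D) := by rw [hS, hD]; ring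
  linarith

theorem continuous_convL1 (ρ : ℝ) {X : Type*} [TopologicalSpace X] {b a : X → LOne R}
    (hb : Continuous b) (ha : Continuous a) : Continuous fun x => convL1 ρ (b x) (a x) :=
  ((convL1 ρ).continuous.comp hb).clm_apply ha

theorem differentiableOn_convL1 (ρ : ℝ) {U : Set ℂ} {b a : ℂ → LOne R}
    (hb : DifferentiableOn ℂ b U) (ha : DifferentiableOn ℂ a U) :
    DifferentiableOn ℂ (fun z => convL1 ρ (b z) (a z)) U :=
  ((convL1 ρ).differentiable.comp_differentiableOn hb).clm_apply ha

theorem differentiableOn_mulL1_propMult {U : Set ℂ} {g : ℂ → ℂ} {a : ℂ → LOne R}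
    (hU : IsOpen U) (hg : DifferentiableOn ℂ g U) (hg0 : ∀ z ∈ U, 0 < (g z).im)
    (ha : DifferentiableOn ℂ a U) (t : ℝ) :
    DifferentiableOn ℂ (fun z => mulL1 (propMult (g z) t) (a z)) U := by
  intro z hz
  have h0 : DifferentiableAt ℂ (fun w => (mulL1 (propMult w t) : LOne R →L[ℂ] LOne R)) (g z) :=
    HasDerivAt.differentiableAt (𝕜 := ℂ) (F := LOne R →L[ℂ] LOne R)
      (hasDerivAt_mulL1_propMult (R := R) (hg0 z hz) t)
  have h1 : DifferentiableAt ℂ (fun z => (mulL1 (propMult (g z) t) : LOne R →L[ℂ] LOne R)) z :=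
    DifferentiableAt.comp (𝕜 := ℂ) (G := LOne R →L[ℂ] LOne R) z h0
      (hg.differentiableAt (hU.mem_nhds hz))
  exact (h1.clm_apply (ha.differentiableAt (hU.mem_nhds hz))).differentiableWithinAt

/-- The partial Fourier transform of `a₀ + γ a₁ + κ a₂`. -/
noncomputable def hatComb (ρ : ℝ) (a₀ a₁ a₂ : 𝓢(ℝ × ℝ, R)) (γ κ : ℂ) (τ : ℝ) : LOne R :=
  hatL1 ρ a₀ τ + γ • hatL1 ρ a₁ τ + κ • hatL1 ρ a₂ τ

theorem continuous_hatComb (ρ : ℝ) (a₀ a₁ a₂ : 𝓢(ℝ × ℝ, R)) {X : Type*} [TopologicalSpace X]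
    {γ κ : X → ℂ} {τ : X → ℝ} (hγ : Continuous γ) (hκ : Continuous κ) (hτ : Continuous τ) :
    Continuous fun q => hatComb ρ a₀ a₁ a₂ (γ q) (κ q) (τ q) :=
  (((continuous_hatL1 ρ a₀).comp hτ).add (hγ.smul ((continuous_hatL1 ρ a₁).comp hτ))).add
    (hκ.smul ((continuous_hatL1 ρ a₂).comp hτ))

theorem norm_hatComb_le (ρ : ℝ) (a₀ a₁ a₂ : 𝓢(ℝ × ℝ, R)) {γ κ : ℂ} (hγ : ‖γ‖ ≤ 2) (hκ : ‖κ‖ ≤ 3)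
    (τ : ℝ) : ‖hatComb ρ a₀ a₁ a₂ γ κ τ‖ ≤
      ‖hatL1 ρ a₀ τ‖ + 2 * ‖hatL1 ρ a₁ τ‖ + 3 * ‖hatL1 ρ a₂ τ‖ := by
  refine (norm_add_le _ _).trans (add_le_add ((norm_add_le _ _).trans (add_le_add le_rfl ?_)) ?_)
  · rw [norm_smul]; gcongr
  · rw [norm_smul]; gcongr

theorem isSmallSource_hatComb {Γ : Type*} [TopologicalSpace Γ] {g k : Γ → ℂ}
    (hg : Continuous g) (hk : Continuous k) (hg2 : ∀ x, ‖g x‖ ≤ 2)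
    (hk3 : ∀ x, ‖k x‖ ≤ 3) (ρ : ℝ) (a₀ a₁ a₂ : 𝓢(ℝ × ℝ, R))
    (hβ : ∫ τ, (‖hatL1 ρ a₀ τ‖ + 2 * ‖hatL1 ρ a₁ τ‖ + 3 * ‖hatL1 ρ a₂ τ‖) ≤ 1 / 2) :
    IsSmallSource (fun x τ => hatComb ρ a₀ a₁ a₂ (g x) (k x) τ)
      (fun x τ => convL1 ρ (hatComb ρ a₀ a₁ a₂ (g x) (k x) τ))
      (fun τ => ‖hatL1 ρ a₀ τ‖ + 2 * ‖hatL1 ρ a₁ τ‖ + 3 * ‖hatL1 ρ a₂ τ‖) := by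
  have hb : Continuous fun q : Γ × ℝ => hatComb ρ a₀ a₁ a₂ (g q.1) (k q.1) q.2 :=
    continuous_hatComb ρ a₀ a₁ a₂ (by fun_prop) (by fun_prop) continuous_snd
  have hM : Continuous fun q : Γ × ℝ × LOne R => hatComb ρ a₀ a₁ a₂ (g q.1) (k q.1) q.2.1 :=
    continuous_hatComb ρ a₀ a₁ a₂ (by fun_prop) (by fun_prop) (by fun_prop)
  have hM2 : Continuous fun q : Γ × ℝ × LOne R => q.2.2 := continuous_snd.comp continuous_snd
  have hn := fun x => norm_hatComb_le ρ a₀ a₁ a₂ (hg2 x) (hk3 x)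
  refine ⟨hb, continuous_convL1 ρ hM hM2, ?_, hn, fun x τ a => ?_, hβ⟩
  · exact ((integrable_norm_hatL1 ρ a₀).add
      ((integrable_norm_hatL1 ρ a₁).const_mul 2)).add ((integrable_norm_hatL1 ρ a₂).const_mul 3)
  · exact (norm_convL1_le ρ _ a).trans (mul_le_mul_of_nonneg_right (hn x τ) (norm_nonneg a))

theorem differentiableOn_hatComb (ρ : ℝ) (a₀ a₁ a₂ : 𝓢(ℝ × ℝ, R)) {U : Set ℂ} {g k : ℂ → ℂ}
    (hg : DifferentiableOn ℂ g U) (hk : DifferentiableOn ℂ k U) (t : ℝ) :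
    DifferentiableOn ℂ (fun z => hatComb ρ a₀ a₁ a₂ (g z) (k z) t) U :=
  ((differentiableOn_const _).add (hg.smul_const _)).add (hk.smul_const _)

variable [CompleteSpace R]

theorem ev_hatComb (ρ : ℝ) (a₀ a₁ a₂ : 𝓢(ℝ × ℝ, R)) (γ κ : ℂ) (s τ : ℝ) :
    ev ρ s (hatComb ρ a₀ a₁ a₂ γ κ τ) = a₀ (s, τ) + γ • a₁ (s, τ) + κ • a₂ (s, τ) := by
  simp only [hatComb, map_add, map_smul, ev_hatL1]

theorem contDiff_ev_propagate {ρ : ℝ} (hρ : ρ ≠ 0) {γ : ℂ} (hγ : 0 ≤ γ.im)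
    {F e : ℝ → LOne R} (hF : Continuous F) (hFi : Integrable F) (he : Continuous e)
    (hprop : ∀ τ, e τ = propagate γ F τ) :
    ContDiff ℝ 1 (fun p : ℝ × ℝ => 1 + ev ρ p.1 (e p.2)) ∧ ∀ p,
      fderiv ℝ (fun p : ℝ × ℝ => 1 + ev ρ p.1 (e p.2)) p (1, 0) = evD ρ p.1 (e p.2) ∧
      fderiv ℝ (fun p : ℝ × ℝ => 1 + ev ρ p.1 (e p.2)) p (0, 1) =
        ev ρ p.1 (F p.2) - γ • evD ρ p.1 (e p.2) := by
  have hc1 : Continuous fun p : ℝ × ℝ => evD ρ p.1 (e p.2) :=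
    continuous_iff_continuousAt.2 fun p => tendsto_evD hρ (continuous_fst.tendsto p)
      ((he.comp continuous_snd).tendsto p)
  have hc2 : Continuous fun p : ℝ × ℝ => ev ρ p.1 (F p.2) :=
    continuous_iff_continuousAt.2 fun p => tendsto_ev ρ (continuous_fst.tendsto p)
      ((hF.comp continuous_snd).tendsto p)
  refine contDiff_one_of_partials (fun s t => (hasDerivAt_ev (R := R) hρ s (e t)).const_add 1) (fun s t => ?_)
    hc1 (hc2.sub (hc1.const_smul _))
  have h := hasDerivAt_ev_propagate hρ s hγ hF hFi t
  simp only [← hprop] at h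
  exact h.const_add 1

theorem IsSmallSource.continuous_slice {Γ A : Type*} [TopologicalSpace Γ] [NormedAddCommGroup A]
    [NormedSpace ℂ A] {b : Γ → ℝ → A} {M : Γ → ℝ → A →L[ℂ] A} {β : ℝ → ℝ}
    (hs : IsSmallSource b M β) {e : Γ × ℝ → A} (he : Continuous e) (x : Γ) :
    Continuous fun σ => b x σ + M x σ (e (x, σ)) :=
  (hs.continuous_source he).comp (f := fun σ : ℝ => (x, σ)) (by fun_prop)

theorem IsSmallSource.integrable_slice {Γ A : Type*} [TopologicalSpace Γ] [NormedAddCommGroup A]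
    [NormedSpace ℂ A] {b : Γ → ℝ → A} {M : Γ → ℝ → A →L[ℂ] A} {β : ℝ → ℝ}
    (hs : IsSmallSource b M β) {e : Γ × ℝ → A} (he : Continuous e) {K : ℝ}
    (hK : ∀ q, ‖e q‖ ≤ K) (x : Γ) : Integrable fun σ => b x σ + M x σ (e (x, σ)) :=
  (hs.integrable.mul_const (1 + K)).mono' (hs.continuous_slice he x).aestronglyMeasurable
    (Eventually.of_forall fun σ => hs.norm_source_le hK (x, σ))

/-- Solutions of `∂_t E + g ∂_s E = (a₀ + g a₁ + k a₂) E` near `1`, with all their dependence on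
the parameters. -/
theorem exists_chart {Γ : Type*} [TopologicalSpace Γ] [FirstCountableTopology Γ] {g k : Γ → ℂ}
    (hg : Continuous g) (hk : Continuous k) (hg0 : ∀ x, 0 ≤ (g x).im) (hg2 : ∀ x, ‖g x‖ ≤ 2)
    (hk3 : ∀ x, ‖k x‖ ≤ 3) (a₀ a₁ a₂ : 𝓢(ℝ × ℝ, R)) {η : ℝ} (hη : η ≤ 1 / 2)
    (hsmall : Real.pi * (normS a₀ + 2 * normS a₁ + 3 * normS a₂) < η) :
    ∃ E : Γ → ℝ × ℝ → R,
      Continuous (fun q : Γ × ℝ × ℝ => E q.1 q.2) ∧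
      (∀ x p, ‖E x p - 1‖ ≤ 2 * η) ∧
      (∀ x, ContDiff ℝ 1 (E x)) ∧
      (∀ x p, fderiv ℝ (E x) p (0, 1) + g x • fderiv ℝ (E x) p (1, 0) =
        (a₀ p + g x • a₁ p + k x • a₂ p) * E x p) ∧
      (∀ x, 0 < (g x).im → Tendsto (E x) (cocompact (ℝ × ℝ)) (𝓝 1)) ∧
      (∀ x, Tendsto (fun s => E x (s, 0)) (cocompact ℝ) (𝓝 1)) ∧
      ∀ (U : Set ℂ) (c : ℂ → Γ), IsOpen U → DifferentiableOn ℂ (fun z => g (c z)) U →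
        DifferentiableOn ℂ (fun z => k (c z)) U → (∀ z ∈ U, 0 < (g (c z)).im) →
        ∀ p, DifferentiableOn ℂ (fun z => E (c z) p) U := by
  obtain ⟨ρ, hρ, hβ⟩ := exists_integral_norm_hatL1_lt a₀ a₁ a₂ hsmall
  have hV := isPropagator_mulL1 (R := R) hg hg0
  have hs := isSmallSource_hatComb hg hk hg2 hk3 ρ a₀ a₁ a₂ (hβ.trans hη)
  obtain ⟨e, hfix, hnorm, hhol⟩ := exists_evolution hV hs
  set F : Γ → ℝ → LOne R := fun x σ => hatComb ρ a₀ a₁ a₂ (g x) (k x) σ +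
    convL1 ρ (hatComb ρ a₀ a₁ a₂ (g x) (k x) σ) (e (x, σ)) with hF
  have hFc : ∀ x, Continuous (F x) := fun x => hs.continuous_slice e.continuous x
  have hFi : ∀ x, Integrable (F x) := fun x =>
    hs.integrable_slice e.continuous e.norm_coe_le_norm x
  have hec : ∀ x, Continuous fun τ => e (x, τ) := fun x =>
    e.continuous.comp (f := fun τ : ℝ => (x, τ)) (by fun_prop)
  have hE := fun x => contDiff_ev_propagate hρ (hg0 x) (hFc x) (hFi x) (hec x) (hfix x)
  refine ⟨fun x p => 1 + ev ρ p.1 (e (x, p.2)), ?_, ?_, fun x => (hE x).1, ?_, ?_, ?_, ?_⟩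
  -- The frame is `1 + ev (e)`: the integral equation is set up for the deviation from `1`, which
  -- accounts for the inhomogeneous term in the source.
  · refine continuous_const.add (continuous_iff_continuousAt.2 fun q => tendsto_ev ρ
      (Continuous.tendsto (by fun_prop) q) ?_)
    have h : Continuous fun q : Γ × ℝ × ℝ => e (q.1, q.2.2) :=
      e.continuous.comp (f := fun q : Γ × ℝ × ℝ => (q.1, q.2.2)) (by fun_prop)
    exact h.tendsto q
  · intro x p
    rw [add_sub_cancel_left]
    refine (norm_ev_le _ _ _).trans ((hnorm x p.2).trans ?_)
    linarith
  · intro x p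
    obtain ⟨h1, h2⟩ := (hE x).2 p
    rw [h1, h2, sub_add_cancel, hF]
    simp only [map_add, ev_convL1, ev_hatComb]
    rw [mul_add, mul_one]
  · intro x hx
    have h := tendsto_propagate_cocompact hx (hFc x) (hFi x)
    have h2 := tendsto_ev_cocompact_of_continuous ρ (hec x)
      (h.congr fun τ => (hfix x τ).symm)
    simpa using h2.const_add (1 : R)
  · intro x
    simpa using (tendsto_ev_cocompact ρ (e (x, 0))).const_add (1 : R)
  · intro U c hU hgc hkc him p
    have hbd := differentiableOn_hatComb ρ a₀ a₁ a₂ hgc hkc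
    have h := hhol U c hU
      (fun t _ f hf => differentiableOn_mulL1_propMult hU hgc him hf t) hbd
      (fun t f hf => differentiableOn_convL1 ρ (hbd t) hf) p.2
    exact ((ev ρ p.1).differentiable.comp_differentiableOn h).const_add 1

end Chart

/-! ### Charts over open sets of spectral parameters. -/

section ChartOn

variable {R : Type*} [NormedRing R] [NormedAlgebra ℂ R] [CompleteSpace R]

/-- `exists_chart` over the part of an open set `D ⊆ ℂ` outside the open unit disc, with
coefficients that are holomorphic in the parameter. -/
theorem exists_chart_on {D : Set ℂ} (hD : IsOpen D) {g k : ℂ → ℂ} (hg : DifferentiableOn ℂ g D)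
    (hk : DifferentiableOn ℂ k D) (hg0 : ∀ m ∈ D, 1 ≤ ‖m‖ → 0 ≤ (g m).im)
    (hg1 : ∀ m ∈ D, 1 < ‖m‖ → 0 < (g m).im) (hg2 : ∀ m ∈ D, ‖g m‖ ≤ 2) (hk3 : ∀ m ∈ D, ‖k m‖ ≤ 3)
    (a₀ a₁ a₂ : 𝓢(ℝ × ℝ, R)) {η : ℝ} (hη : η ≤ 1 / 2)
    (hsmall : Real.pi * (normS a₀ + 2 * normS a₁ + 3 * normS a₂) < η) :
    ∃ E : ℂ → ℝ × ℝ → R,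
      ContinuousOn (fun q : ℂ × ℝ × ℝ => E q.1 q.2) ((D ∩ {m | 1 ≤ ‖m‖}) ×ˢ Set.univ) ∧
      (∀ m ∈ D, 1 ≤ ‖m‖ → (∀ p, ‖E m p - 1‖ ≤ 2 * η) ∧ ContDiff ℝ 1 (E m) ∧
        (∀ p, fderiv ℝ (E m) p (0, 1) + g m • fderiv ℝ (E m) p (1, 0) =
          (a₀ p + g m • a₁ p + k m • a₂ p) * E m p) ∧
        Tendsto (fun s => E m (s, 0)) (cocompact ℝ) (𝓝 1)) ∧
      (∀ m ∈ D, 1 < ‖m‖ → Tendsto (E m) (cocompact (ℝ × ℝ)) (𝓝 1)) ∧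
      ∀ p, DifferentiableOn ℂ (fun m => E m p) (D ∩ {m | 1 < ‖m‖}) := by
  classical
  let Γ := {m : ℂ // m ∈ D ∩ {m | 1 ≤ ‖m‖}}
  have hgc : Continuous fun x : Γ => g x :=
    (hg.continuousOn.mono Set.inter_subset_left).domRestrict
  have hkc : Continuous fun x : Γ => k x :=
    (hk.continuousOn.mono Set.inter_subset_left).domRestrict
  obtain ⟨E, hEc, hE1, hE2, hE3, hE4, hE5, hE6⟩ := exists_chart hgc hkc
    (fun x => hg0 x x.2.1 x.2.2) (fun x => hg2 x x.2.1) (fun x => hk3 x x.2.1) a₀ a₁ a₂ hη hsmall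
  obtain ⟨E', hval⟩ : ∃ E' : ℂ → ℝ × ℝ → R, ∀ (m : ℂ) (h : m ∈ D ∩ {m | 1 ≤ ‖m‖}),
      E' m = E ⟨m, h⟩ :=
    ⟨fun m => if h : m ∈ D ∩ {m | 1 ≤ ‖m‖} then E ⟨m, h⟩ else 1, fun m h => dif_pos h⟩
  refine ⟨E', ?_, ?_, ?_, ?_⟩
  · rw [continuousOn_iff_continuous_domRestrict]
    have hc : Continuous fun q : ((D ∩ {m : ℂ | 1 ≤ ‖m‖}) ×ˢ (Set.univ : Set (ℝ × ℝ)) : Set _) =>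
        ((⟨q.1.1, q.2.1⟩ : Γ), q.1.2) := by fun_prop
    convert hEc.comp hc using 1
    funext q
    simp only [Set.domRestrict_apply, Function.comp]
    rw [hval _ q.2.1]
  · intro m hm h1
    rw [hval m ⟨hm, h1⟩]
    exact ⟨hE1 _, hE2 _, hE3 _, hE5 _⟩
  · intro m hm h1
    rw [hval m ⟨hm, h1.le⟩]
    exact hE4 _ (hg1 m hm h1)
  · intro p
    rcases (D ∩ {m : ℂ | 1 < ‖m‖}).eq_empty_or_nonempty with h0 | ⟨m₀, hm₀⟩
    · rw [h0]; exact differentiableOn_empty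
    · have hsub : ∀ m ∈ D ∩ {m : ℂ | 1 < ‖m‖}, m ∈ D ∩ {m : ℂ | 1 ≤ ‖m‖} :=
        fun m hm => ⟨hm.1, show 1 ≤ ‖m‖ from le_of_lt hm.2⟩
      -- A curve of parameters has to be defined on all of `ℂ`; its values off the open set are
      -- irrelevant, so an arbitrary point `m₀` is used.
      let c : ℂ → Γ := fun m => if h : m ∈ D ∩ {m | 1 ≤ ‖m‖} then ⟨m, h⟩ else ⟨m₀, hsub _ hm₀⟩
      have hcv : ∀ m (h : m ∈ D ∩ {m : ℂ | 1 < ‖m‖}), c m = ⟨m, hsub m h⟩ :=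
        fun m h => dif_pos (hsub m h)
      have hopen : IsOpen (D ∩ {m : ℂ | 1 < ‖m‖}) :=
        hD.inter (isOpen_lt continuous_const continuous_norm)
      refine (hE6 _ c hopen ?_ ?_ ?_ p).congr fun m hm => ?_
      · exact (hg.mono Set.inter_subset_left).congr fun m hm => by rw [hcv m hm]
      · exact (hk.mono Set.inter_subset_left).congr fun m hm => by rw [hcv m hm]
      · intro m hm; rw [hcv m hm]; exact hg1 m hm.1 hm.2
      · rw [hval m (hsub m hm), hcv m hm]

end ChartOn

/-! ### Comparison with the `W^{2,1}` norm, and the rotation of the plane. -/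

section Bounds

open scoped LineDeriv

variable {n : ℕ}

theorem integral_norm_eq_toReal_normL1 (f : 𝓢(ℝ × ℝ, Mat n)) : (∫ p, ‖f p‖) = (normL1 f).toReal := by
  rw [normL1, integral_norm_eq_lintegral_enorm f.continuous.aestronglyMeasurable]

theorem normL1_ne_top (f : 𝓢(ℝ × ℝ, Mat n)) : normL1 f ≠ ⊤ :=
  (f.integrable (μ := volume)).2.ne

theorem pdx_coe (f : 𝓢(ℝ × ℝ, Mat n)) : pdx f = ∂_{((1 : ℝ), (0 : ℝ))} f :=
  funext fun p => (SchwartzMap.lineDerivOp_apply_eq_fderiv _ f p).symm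

theorem pdy_coe (f : 𝓢(ℝ × ℝ, Mat n)) : pdy f = ∂_{((0 : ℝ), (1 : ℝ))} f :=
  funext fun p => (SchwartzMap.lineDerivOp_apply_eq_fderiv _ f p).symm

theorem normW21_ne_top (f : 𝓢(ℝ × ℝ, Mat n)) : normW21 f ≠ ⊤ := by
  simp only [normW21, pdx_coe, pdy_coe]
  simp [normL1_ne_top]

theorem normS_le_normW21 (f : 𝓢(ℝ × ℝ, Mat n)) : normS f ≤ (normW21 f).toReal := by
  rw [normS, integral_norm_eq_toReal_normL1, integral_norm_eq_toReal_normL1, ← pdx_coe, ← pdx_coe,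
    ← ENNReal.toReal_add (normL1_ne_top f) (by rw [pdx_coe, pdx_coe]; exact normL1_ne_top _)]
  refine ENNReal.toReal_mono (normW21_ne_top f) ?_
  rw [normW21]
  calc normL1 f + normL1 (pdx (pdx f)) ≤
      normL1 f + normL1 (pdx (pdx f)) + (normL1 (pdx f) + normL1 (pdy f) +
        normL1 (pdx (pdy f)) + normL1 (pdy (pdy f))) := le_self_add
    _ = _ := by ring

/-- The rotation `(s, t) ↦ (t, -s)`. -/
noncomputable def rot : (ℝ × ℝ) ≃L[ℝ] ℝ × ℝ :=
  (ContinuousLinearEquiv.prodComm ℝ ℝ ℝ).trans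
    ((ContinuousLinearEquiv.refl ℝ ℝ).prodCongr (ContinuousLinearEquiv.neg ℝ))

@[simp] theorem rot_apply (p : ℝ × ℝ) : rot p = (p.2, -p.1) := rfl

@[simp] theorem rot_symm_apply (p : ℝ × ℝ) : rot.symm p = (-p.2, p.1) := by
  rw [ContinuousLinearEquiv.symm_apply_eq]; simp

theorem measurePreserving_rot : MeasurePreserving rot := by
  have h1 : MeasurePreserving (Prod.map id Neg.neg : ℝ × ℝ → ℝ × ℝ) volume volume :=
    (MeasurePreserving.id volume).prod (Measure.measurePreserving_neg (volume : Measure ℝ))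
  exact h1.comp (Measure.measurePreserving_swap (μ := (volume : Measure ℝ)) (ν := volume))

theorem fderiv_comp_rot {F : Type*} [NormedAddCommGroup F] [NormedSpace ℝ F] (f : ℝ × ℝ → F)
    (p v : ℝ × ℝ) : fderiv ℝ (fun p => f (rot p)) p v = fderiv ℝ f (rot p) (rot v) := by
  have := rot.comp_right_fderiv (f := f) (x := p)
  rw [show (fun p => f (rot p)) = f ∘ rot from rfl, this]
  rfl

theorem fderiv_comp_rot_symm {F : Type*} [NormedAddCommGroup F] [NormedSpace ℝ F] (f : ℝ × ℝ → F)
    (p v : ℝ × ℝ) :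
    fderiv ℝ (fun p => f (rot.symm p)) p v = fderiv ℝ f (rot.symm p) (rot.symm v) := by
  have := rot.symm.comp_right_fderiv (f := f) (x := p)
  rw [show (fun p => f (rot.symm p)) = f ∘ rot.symm from rfl, this]
  rfl

/-- Composition of a Schwartz function with `rot`. -/
noncomputable def rotS (f : 𝓢(ℝ × ℝ, Mat n)) : 𝓢(ℝ × ℝ, Mat n) :=
  SchwartzMap.compCLMOfContinuousLinearEquiv ℝ rot f

@[simp] theorem rotS_apply (f : 𝓢(ℝ × ℝ, Mat n)) (p : ℝ × ℝ) : rotS f p = f (p.2, -p.1) := rfl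

theorem pdx_comp_rot (f : ℝ × ℝ → Mat n) : pdx (fun p => f (rot p)) = fun p => -pdy f (rot p) := by
  funext p
  rw [pdx, fderiv_comp_rot, pdy, ← map_neg]
  simp

/-- The rotation preserves area and exchanges the roles of `x` and `y` up to sign, so both charts
are controlled by the same norm. -/
theorem normS_rotS_le (f : 𝓢(ℝ × ℝ, Mat n)) : normS (rotS f) ≤ (normW21 f).toReal := by
  have h1 : normL1 (rotS f) = normL1 f :=
    measurePreserving_rot.lintegral_comp (f := fun p => ‖f p‖ₑ) f.continuous.enorm.measurable
  have h2 : normL1 (pdx (pdx (rotS f))) = normL1 (pdy (pdy f)) := by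
    have h3 : pdx (pdx (rotS f)) = fun p => pdy (pdy f) (rot p) := by
      rw [show (rotS f : ℝ × ℝ → Mat n) = fun p => f (rot p) from rfl, pdx_comp_rot,
        pdx_comp_rot (fun p => -pdy f p)]
      funext p
      rw [pdy, fderiv_fun_neg]
      simp [pdy]
    rw [h3, pdy_coe, pdy_coe]
    exact measurePreserving_rot.lintegral_comp
      (f := fun p => ‖(∂_{((0 : ℝ), (1 : ℝ))} (∂_{((0 : ℝ), (1 : ℝ))} f)) p‖ₑ)
      (SchwartzMap.continuous _).enorm.measurable
  rw [normS, integral_norm_eq_toReal_normL1, integral_norm_eq_toReal_normL1, ← pdx_coe, ← pdx_coe,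
    ← ENNReal.toReal_add (normL1_ne_top _) (by rw [pdx_coe, pdx_coe]; exact normL1_ne_top _), h1, h2]
  refine ENNReal.toReal_mono (normW21_ne_top f) ?_
  rw [normW21]
  calc normL1 f + normL1 (pdy (pdy f)) ≤
      normL1 f + normL1 (pdy (pdy f)) + (normL1 (pdx f) + normL1 (pdy f) +
        normL1 (pdx (pdx f)) + normL1 (pdx (pdy f))) := le_self_add
    _ = _ := by ring

theorem SpatialPair.sum_normW21_lt {P : SpatialPair n} {δ : ℝ} (h : P.normW21 < ENNReal.ofReal δ) :
    (Monopole.normW21 P.Ax).toReal + (Monopole.normW21 P.Ay).toReal +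
      (Monopole.normW21 P.φ).toReal < δ := by
  rw [← ENNReal.toReal_add (normW21_ne_top _) (normW21_ne_top _),
    ← ENNReal.toReal_add (by simp [normW21_ne_top]) (normW21_ne_top _)]
  exact (ENNReal.lt_ofReal_iff_toReal_lt (by simp [normW21_ne_top])).1 h

end Bounds

/-! ### Spectral coefficients and the two charts. -/

section Solutions

variable {n : ℕ}

/-- `E` solves `α ∇_x E + β ∇_y E = κ φ E` at `p`. -/
def IsSol (P : SpatialPair n) (α β κ : ℂ) (E : ℝ × ℝ → Mat n) (p : ℝ × ℝ) : Prop :=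
  α • pdx E p + β • pdy E p = (α • P.Ax p + β • P.Ay p + κ • P.φ p) * E p

/-- The coefficient of `∇_x` in `bundleOp`. -/
noncomputable def coefX (μ : OnePoint ℂ) : ℂ := μ.elim (1 / 2) fun m => (m ^ 2 - 1) / 2

/-- The coefficient of `∇_y` in `bundleOp`. -/
noncomputable def coefY (μ : OnePoint ℂ) : ℂ :=
  μ.elim (-(Complex.I / 2)) fun m => -(Complex.I * (m ^ 2 + 1) / 2)

/-- The coefficient of `φ` in `bundleOp`, up to sign. -/
noncomputable def coefPhi (μ : OnePoint ℂ) : ℂ := μ.elim 0 fun m => Complex.I * m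

@[simp] theorem coefX_coe (m : ℂ) : coefX m = (m ^ 2 - 1) / 2 := rfl
@[simp] theorem coefY_coe (m : ℂ) : coefY m = -(Complex.I * (m ^ 2 + 1) / 2) := rfl
@[simp] theorem coefPhi_coe (m : ℂ) : coefPhi m = Complex.I * m := rfl
@[simp] theorem coefX_infty : coefX OnePoint.infty = 1 / 2 := rfl
@[simp] theorem coefY_infty : coefY OnePoint.infty = -(Complex.I / 2) := rfl
@[simp] theorem coefPhi_infty : coefPhi OnePoint.infty = 0 := rfl

/-- `E` is annihilated by the Cauchy-Riemann operator at the spectral parameter `μ`. -/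
def IsSolAt (P : SpatialPair n) (μ : OnePoint ℂ) (E : ℝ × ℝ → Mat n) (p : ℝ × ℝ) : Prop :=
  IsSol P (coefX μ) (coefY μ) (coefPhi μ) E p

theorem bundleOp_eq (P : SpatialPair n) (μ : OnePoint ℂ) (E : ℝ × ℝ → Mat n) (p : ℝ × ℝ) :
    bundleOp P μ E p = (coefX μ • pdx E p + coefY μ • pdy E p) -
      (coefX μ • P.Ax p + coefY μ • P.Ay p + coefPhi μ • P.φ p) * E p := by
  induction μ using OnePoint.rec with
  | infty =>
    simp only [bundleOp, OnePoint.elim_infty, nablaZ, nablaX, nablaY, coefX_infty, coefY_infty,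
      coefPhi_infty, add_mul, smul_mul_assoc]
    module
  | coe m =>
    simp only [bundleOp, OnePoint.elim_some, nablaZ, nablaZbar, nablaX, nablaY, coefX_coe,
      coefY_coe, coefPhi_coe, add_mul, smul_mul_assoc]
    module

theorem bundleOp_eq_zero_iff {P : SpatialPair n} {μ : OnePoint ℂ} {E : ℝ × ℝ → Mat n}
    {p : ℝ × ℝ} : bundleOp P μ E p = 0 ↔ IsSolAt P μ E p := by
  rw [bundleOp_eq, sub_eq_zero]; rfl

theorem spatialOp_eq_zero_iff {P : SpatialPair n} {m : ℂ} (hm : m ≠ 0) {E : ℝ × ℝ → Mat n}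
    {p : ℝ × ℝ} : spatialOp P m E p = 0 ↔ IsSolAt P m E p := by
  rw [← bundleOp_eq_zero_iff, bundleOp_coe P hm, smul_eq_zero, or_iff_right hm]

/-- This quantity measures ellipticity: it vanishes exactly on the unit circle, and its sign, which
is that of the imaginary part of `coefX / coefY`, tells the two sides apart. -/
theorem im_coef_mul_conj (m : ℂ) :
    (coefX m * starRingEnd ℂ (coefY m)).im = (‖m‖ ^ 4 - 1) / 4 := by
  have h : ‖m‖ ^ 4 = (m.re ^ 2 + m.im ^ 2) ^ 2 := by
    rw [← Complex.normSq_add_mul_I, Complex.re_add_im, Complex.normSq_eq_norm_sq]; ring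
  rw [h]
  simp [Complex.mul_im, Complex.mul_re, pow_two, Complex.div_re, Complex.div_im, Complex.normSq]
  ring

theorem im_coef_mul_conj_infty :
    (coefX OnePoint.infty * starRingEnd ℂ (coefY OnePoint.infty)).im = 1 / 4 := by
  simp [Complex.mul_im, Complex.div_re, Complex.div_im, Complex.normSq]
  norm_num

theorem im_coef_ne_zero {μ : OnePoint ℂ}
    (hμ : μ ∉ ((↑) : ℂ → OnePoint ℂ) '' Metric.sphere (0 : ℂ) 1) :
    (coefX μ * starRingEnd ℂ (coefY μ)).im ≠ 0 := by
  induction μ using OnePoint.rec with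
  | infty => rw [im_coef_mul_conj_infty]; norm_num
  | coe m =>
    rw [im_coef_mul_conj]
    have h1 : ‖m‖ ≠ 1 := fun h => hμ ⟨m, by simpa using h, rfl⟩
    have h2 : ‖m‖ ^ 4 ≠ 1 := fun h => h1 ((pow_eq_one_iff_of_nonneg (norm_nonneg m) (by norm_num)).1 h)
    intro h
    apply h2
    linarith

theorem im_div_eq (a b : ℂ) : (a / b).im = (a * starRingEnd ℂ b).im / ‖b‖ ^ 2 := by
  rw [div_eq_mul_inv, Complex.inv_def, ← mul_assoc, Complex.im_mul_ofReal,
    Complex.normSq_eq_norm_sq, div_eq_mul_inv]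

theorem coef_sq (μ : OnePoint ℂ) : coefX μ ^ 2 + coefY μ ^ 2 = coefPhi μ ^ 2 := by
  induction μ using OnePoint.rec with
  | infty => simp only [coefX_infty, coefY_infty, coefPhi_infty]; linear_combination Complex.I_sq / 4
  | coe m =>
    simp only [coefX_coe, coefY_coe, coefPhi_coe]
    linear_combination ((m ^ 2 + 1) ^ 2 / 4 - m ^ 2) * Complex.I_sq

/-- The relation `a² + b² = c²` holds for the spectral coefficients, so `|a / b| ≤ 2` alone gives
`|c / b|² ≤ 5 < 9`. -/
theorem norm_coef_div_le {a b c : ℂ} (hb : b ≠ 0) (h : a ^ 2 + b ^ 2 = c ^ 2) (hab : ‖a‖ ≤ 2 * ‖b‖) :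
    ‖a / b‖ ≤ 2 ∧ ‖c / b‖ ≤ 3 := by
  have hb0 : 0 < ‖b‖ := norm_pos_iff.2 hb
  refine ⟨by rwa [norm_div, div_le_iff₀ hb0], ?_⟩
  rw [norm_div, div_le_iff₀ hb0]
  have h1 : ‖c‖ ^ 2 ≤ ‖a‖ ^ 2 + ‖b‖ ^ 2 := by
    rw [← norm_pow, ← h]
    exact (norm_add_le _ _).trans_eq (by rw [norm_pow, norm_pow])
  nlinarith [norm_nonneg a, norm_nonneg c]

/-- Frames that solve the spatial equation for the parameters `m ∈ D` with `1 ≤ |m|`. -/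
structure UpperChart (P : SpatialPair n) (q : ℝ) (D : Set ℂ) (E : ℂ → ℝ × ℝ → Mat n) : Prop where
  isOpen : IsOpen D
  continuousOn :
    ContinuousOn (fun q : ℂ × ℝ × ℝ => E q.1 q.2) ((D ∩ {m | 1 ≤ ‖m‖}) ×ˢ Set.univ)
  near_one : ∀ m ∈ D, 1 ≤ ‖m‖ → ∀ p, ‖E m p - 1‖ ≤ q
  contDiff : ∀ m ∈ D, 1 ≤ ‖m‖ → ContDiff ℝ 1 (E m)
  isSolAt : ∀ m ∈ D, 1 ≤ ‖m‖ → ∀ p, IsSolAt P m (E m) p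
  tendsto_line : ∀ θ : ℝ, Complex.exp (θ * Complex.I) ∈ D →
    ∃ v : ℝ × ℝ, v.1 * Real.cos θ + v.2 * Real.sin θ ≠ 0 ∧
      Tendsto (fun s : ℝ => E (Complex.exp (θ * Complex.I)) (s • v)) (cocompact ℝ) (𝓝 1)
  tendsto_one : ∀ m ∈ D, 1 < ‖m‖ → Tendsto (E m) (cocompact (ℝ × ℝ)) (𝓝 1)
  differentiableOn : ∀ p, DifferentiableOn ℂ (fun m => E m p) (D ∩ {m | 1 < ‖m‖})

theorem coefX_exp (θ : ℝ) : coefX (Complex.exp (θ * Complex.I) : ℂ) =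
    Complex.I * Complex.exp (θ * Complex.I) * Real.sin θ := by
  simp only [coefX_coe, Complex.ofReal_sin, Complex.sin]
  have h : Complex.exp (θ * Complex.I) * Complex.exp (-θ * Complex.I) = 1 := by
    rw [← Complex.exp_add]; simp
  linear_combination (Complex.exp (θ * Complex.I) * (Complex.exp (-θ * Complex.I) -
    Complex.exp (θ * Complex.I)) / 2) * (-Complex.I_sq) + h / 2

theorem coefY_exp (θ : ℝ) : coefY (Complex.exp (θ * Complex.I) : ℂ) =
    -(Complex.I * Complex.exp (θ * Complex.I) * Real.cos θ) := by
  simp only [coefY_coe, Complex.ofReal_cos, Complex.cos]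
  have h : Complex.exp (θ * Complex.I) * Complex.exp (-θ * Complex.I) = 1 := by
    rw [← Complex.exp_add]; simp
  linear_combination Complex.I / 2 * h

theorem differentiable_coefX : Differentiable ℂ fun m : ℂ => coefX m := by
  simp only [coefX_coe]; fun_prop

theorem differentiable_coefY : Differentiable ℂ fun m : ℂ => coefY m := by
  simp only [coefY_coe]; fun_prop

theorem differentiable_coefPhi : Differentiable ℂ fun m : ℂ => coefPhi m := by
  simp only [coefPhi_coe]; fun_prop

/-- Division by the coefficient of `∂_y` makes `y` the evolution variable. On the circle this
coefficient is proportional to `cos θ`, so where it is nonzero the `x`-axis is transversal to the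
direction `(-sin θ, cos θ)`. -/
theorem exists_upperChart_x {P : SpatialPair n} {δ η : ℝ} (hη : η ≤ 1 / 2)
    (hδ : Real.pi * (3 * δ) ≤ η) (hP : P.normW21 < ENNReal.ofReal δ) :
    ∃ E, UpperChart P (2 * η) {m : ℂ | ‖coefX m‖ < 2 * ‖coefY m‖} E := by
  have hsum := SpatialPair.sum_normW21_lt hP
  have h1 := normS_le_normW21 P.Ax
  have h2 := normS_le_normW21 P.Ay
  have h3 := normS_le_normW21 P.φ
  have hpi := Real.pi_pos
  have n1 : 0 ≤ (normW21 P.Ax).toReal := ENNReal.toReal_nonneg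
  have n2 : 0 ≤ (normW21 P.Ay).toReal := ENNReal.toReal_nonneg
  have hsmall : Real.pi * (normS P.Ay + 2 * normS P.Ax + 3 * normS P.φ) < η :=
    lt_of_lt_of_le (mul_lt_mul_of_pos_left (by linarith) hpi) hδ
  have hne : ∀ m ∈ {m : ℂ | ‖coefX m‖ < 2 * ‖coefY m‖}, coefY m ≠ 0 := fun m hm h => by
    have : ‖coefX m‖ < 2 * ‖coefY m‖ := hm
    rw [h, norm_zero, mul_zero] at this
    exact (norm_nonneg _).not_gt this
  have hb := fun m (hm : m ∈ {m : ℂ | ‖coefX m‖ < 2 * ‖coefY m‖}) =>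
    norm_coef_div_le (hne m hm) (coef_sq m) (le_of_lt hm)
  have hopen : IsOpen {m : ℂ | ‖coefX m‖ < 2 * ‖coefY m‖} :=
    isOpen_lt differentiable_coefX.continuous.norm
      (differentiable_coefY.continuous.norm.const_mul 2)
  obtain ⟨E, hc, hE, ht, hd⟩ := exists_chart_on hopen
    (g := fun m => coefX m / coefY m) (k := fun m => coefPhi m / coefY m)
    (differentiable_coefX.differentiableOn.div differentiable_coefY.differentiableOn hne)
    (differentiable_coefPhi.differentiableOn.div differentiable_coefY.differentiableOn hne)
    (fun m hm h => by
      rw [im_div_eq, im_coef_mul_conj]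
      have : 1 ≤ ‖m‖ ^ 4 := one_le_pow₀ h
      exact div_nonneg (by linarith) (by positivity))
    (fun m hm h => by
      rw [im_div_eq, im_coef_mul_conj]
      have : 1 < ‖m‖ ^ 4 := one_lt_pow₀ h (by norm_num)
      exact div_pos (by linarith) (pow_pos (norm_pos_iff.2 (hne m hm)) 2))
    (fun m hm => (hb m hm).1) (fun m hm => (hb m hm).2) P.Ay P.Ax P.φ hη hsmall
  refine ⟨E, hopen, hc, fun m hm h => (hE m hm h).1, fun m hm h => (hE m hm h).2.1,
    fun m hm h p => ?_, fun θ hθ => ⟨(1, 0), ?_, ?_⟩, ht, hd⟩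
  · have h1 := congrArg (fun X => coefY m • X) ((hE m hm h).2.2.1 p)
    have h2 : ∀ z : ℂ, coefY m * (z / coefY m) = z := fun z => mul_div_cancel₀ z (hne m hm)
    simp only [smul_add, smul_smul, h2, ← smul_mul_assoc] at h1
    change coefX m • fderiv ℝ (E m) p (1, 0) + coefY m • fderiv ℝ (E m) p (0, 1) = _
    rw [add_comm, h1, add_comm (coefY m • _)]
  · have := hne _ hθ
    rw [coefY_exp, neg_ne_zero] at this
    simpa using Complex.ofReal_ne_zero.1 (right_ne_zero_of_mul this)
  · have := (hE _ hθ (by simp [Complex.norm_exp])).2.2.2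
    simpa using this

/-- Here `x` is the evolution variable. A rotation, not a reflection, is used to exchange the
variables: the sign in `-(coefY / coefX)` keeps the imaginary part nonnegative for `|m| ≥ 1`. The
transversal line is now the `y`-axis. -/
theorem exists_upperChart_y {P : SpatialPair n} {δ η : ℝ} (hη : η ≤ 1 / 2)
    (hδ : Real.pi * (3 * δ) ≤ η) (hP : P.normW21 < ENNReal.ofReal δ) :
    ∃ E, UpperChart P (2 * η) {m : ℂ | ‖coefY m‖ < 2 * ‖coefX m‖} E := by
  have hsum := SpatialPair.sum_normW21_lt hP
  have h1 := normS_rotS_le P.Ax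
  have h2 := normS_rotS_le P.Ay
  have h3 := normS_rotS_le P.φ
  have h4 : normS (-rotS P.Ay) = normS (rotS P.Ay) := by
    simp only [normS, LineDeriv.lineDerivOp_neg, neg_apply, norm_neg]
  have hpi := Real.pi_pos
  have n1 : 0 ≤ (normW21 P.Ax).toReal := ENNReal.toReal_nonneg
  have n2 : 0 ≤ (normW21 P.Ay).toReal := ENNReal.toReal_nonneg
  have hsmall : Real.pi * (normS (rotS P.Ax) + 2 * normS (-rotS P.Ay) + 3 * normS (rotS P.φ)) < η :=
    lt_of_lt_of_le (mul_lt_mul_of_pos_left (by linarith) hpi) hδ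
  have hne : ∀ m ∈ {m : ℂ | ‖coefY m‖ < 2 * ‖coefX m‖}, coefX m ≠ 0 := fun m hm h => by
    have : ‖coefY m‖ < 2 * ‖coefX m‖ := hm
    rw [h, norm_zero, mul_zero] at this
    exact (norm_nonneg _).not_gt this
  have hb := fun m (hm : m ∈ {m : ℂ | ‖coefY m‖ < 2 * ‖coefX m‖}) =>
    norm_coef_div_le (hne m hm) ((add_comm _ _).trans (coef_sq m)) (le_of_lt hm)
  have hopen : IsOpen {m : ℂ | ‖coefY m‖ < 2 * ‖coefX m‖} :=
    isOpen_lt differentiable_coefY.continuous.norm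
      (differentiable_coefX.continuous.norm.const_mul 2)
  have him : ∀ m : ℂ, (-(coefY m / coefX m)).im = (‖m‖ ^ 4 - 1) / 4 / ‖coefX m‖ ^ 2 := fun m => by
    rw [Complex.neg_im, im_div_eq, ← neg_div, ← im_coef_mul_conj, ← Complex.conj_im]
    simp [mul_comm]
  obtain ⟨E, hc, hE, ht, hd⟩ := exists_chart_on hopen
    (g := fun m => -(coefY m / coefX m)) (k := fun m => coefPhi m / coefX m)
    (differentiable_coefY.differentiableOn.div differentiable_coefX.differentiableOn hne).neg
    (differentiable_coefPhi.differentiableOn.div differentiable_coefX.differentiableOn hne)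
    (fun m hm h => by
      rw [him]
      have : 1 ≤ ‖m‖ ^ 4 := one_le_pow₀ h
      exact div_nonneg (by linarith) (by positivity))
    (fun m hm h => by
      rw [him]
      have : 1 < ‖m‖ ^ 4 := one_lt_pow₀ h (by norm_num)
      exact div_pos (by linarith) (pow_pos (norm_pos_iff.2 (hne m hm)) 2))
    (fun m hm => (norm_neg _).trans_le (hb m hm).1) (fun m hm => (hb m hm).2)
    (rotS P.Ax) (-rotS P.Ay) (rotS P.φ) hη hsmall
  refine ⟨fun m p => E m (rot.symm p), hopen, ?_, fun m hm h p => (hE m hm h).1 _,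
    fun m hm h => (hE m hm h).2.1.comp rot.symm.contDiff,
    fun m hm h p => ?_, fun θ hθ => ⟨(0, 1), ?_, ?_⟩,
    fun m hm h => (ht m hm h).comp rot.symm.toHomeomorph.isClosedEmbedding.tendsto_cocompact,
    fun p => hd _⟩
  · exact hc.comp (f := fun q : ℂ × ℝ × ℝ => (q.1, rot.symm q.2))
      (by fun_prop) fun q hq => ⟨hq.1, trivial⟩
  · have h1 := congrArg (fun X => coefX m • X) ((hE m hm h).2.2.1 (rot.symm p))
    have h2 : ∀ z : ℂ, coefX m * (z / coefX m) = z := fun z => mul_div_cancel₀ z (hne m hm)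
    simp only [smul_add, smul_smul, h2, ← smul_mul_assoc, neg_apply, rotS_apply,
      rot_symm_apply, neg_neg, neg_smul, smul_neg] at h1
    change coefX m • fderiv ℝ (fun p => E m (rot.symm p)) p (1, 0) +
      coefY m • fderiv ℝ (fun p => E m (rot.symm p)) p (0, 1) = _
    rw [fderiv_comp_rot_symm, fderiv_comp_rot_symm]
    have h3 : rot.symm ((0 : ℝ), (1 : ℝ)) = -(1, 0) := by simp
    have h4 : rot.symm ((1 : ℝ), (0 : ℝ)) = (0, 1) := by simp
    rw [h3, h4, map_neg, smul_neg, rot_symm_apply, h1]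
    simp only [rot_symm_apply]
  · have := hne _ hθ
    rw [coefX_exp] at this
    simpa using Complex.ofReal_ne_zero.1 (right_ne_zero_of_mul this)
  · have := (hE _ hθ (by simp [Complex.norm_exp])).2.2.2.comp
      (Homeomorph.neg ℝ).isClosedEmbedding.tendsto_cocompact
    simpa [Function.comp_def] using this

/-- A small spatial pair has frames near `1` around every spectral parameter outside the open
unit disc. -/
theorem exists_upperChart {P : SpatialPair n} {δ η : ℝ} (hη : η ≤ 1 / 2)
    (hδ : Real.pi * (3 * δ) ≤ η) (hP : P.normW21 < ENNReal.ofReal δ) (m : ℂ) :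
    ∃ D E, m ∈ D ∧ UpperChart P (2 * η) D E := by
  by_cases h : ‖coefX m‖ < 2 * ‖coefY m‖
  · obtain ⟨E, hE⟩ := exists_upperChart_x hη hδ hP
    exact ⟨_, E, h, hE⟩
  · obtain ⟨E, hE⟩ := exists_upperChart_y hη hδ hP
    refine ⟨_, E, ?_, hE⟩
    -- The two coefficients never vanish together, since `m² - 1` and `m² + 1` differ by `2`; hence
    -- at least one of the chart conditions holds.
    have hX : coefX m ≠ 0 := fun h0 => by
      have hY : coefY m = 0 := by
        rw [h0, norm_zero, not_lt] at h
        exact norm_eq_zero.1 (le_antisymm (by linarith) (norm_nonneg _))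
      have h1 : m ^ 2 - 1 = 0 := by simpa using h0
      have h2 : m ^ 2 + 1 = 0 := by simpa using hY
      have : (2 : ℂ) = 0 := by linear_combination h2 - h1
      norm_num at this
    have := norm_pos_iff.2 hX
    change ‖coefY m‖ < 2 * ‖coefX m‖
    linarith [not_lt.1 h]

/-- A small spatial pair has a frame at `μ = ∞`. -/
theorem exists_frame_infty {P : SpatialPair n} {δ η : ℝ} (hη : η ≤ 1 / 2)
    (hδ : Real.pi * (3 * δ) ≤ η) (hP : P.normW21 < ENNReal.ofReal δ) :
    ∃ E : ℝ × ℝ → Mat n, ContDiff ℝ 1 E ∧ (∀ p, IsSolAt P OnePoint.infty E p) ∧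
      (∀ p, ‖E p - 1‖ ≤ 2 * η) ∧ Tendsto E (cocompact (ℝ × ℝ)) (𝓝 1) := by
  have hsum := SpatialPair.sum_normW21_lt hP
  have h1 := normS_le_normW21 P.Ax
  have h2 := normS_le_normW21 P.Ay
  have h3 := normS_le_normW21 P.φ
  have hpi := Real.pi_pos
  have n1 : 0 ≤ (normW21 P.Ax).toReal := ENNReal.toReal_nonneg
  have n2 : 0 ≤ (normW21 P.Ay).toReal := ENNReal.toReal_nonneg
  have hsmall : Real.pi * (normS P.Ay + 2 * normS P.Ax + 3 * normS P.φ) < η :=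
    lt_of_lt_of_le (mul_lt_mul_of_pos_left (by linarith) hpi) hδ
  -- At `μ = ∞` the ratio of the coefficients of `∂_x` and `∂_y` is `i`, and the Higgs field drops
  -- out.
  obtain ⟨E, -, hn, hc, hs, ht, -⟩ := exists_chart (Γ := Unit) (g := fun _ => Complex.I)
    (k := fun _ => 0) continuous_const continuous_const (by simp) (by simp) (by simp)
    P.Ay P.Ax P.φ hη hsmall
  refine ⟨E (), hc _, fun p => ?_, hn _, ht _ (by simp)⟩
  have h1 := congrArg (fun X => (-(Complex.I / 2)) • X) (hs () p)
  have h2 : -(Complex.I / 2) * Complex.I = 1 / 2 := by linear_combination -Complex.I_sq / 2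
  simp only [smul_add, smul_smul, h2, ← smul_mul_assoc, mul_zero] at h1
  change (1 / 2 : ℂ) • fderiv ℝ (E ()) p (1, 0) + (-(Complex.I / 2)) • fderiv ℝ (E ()) p (0, 1) = _
  rw [add_comm, h1, add_comm ((-(Complex.I / 2)) • _)]
  rfl

end Solutions

/-! ### Liouville's theorem in the coordinate annihilated by the operator. -/

section Liouville

variable {V : Type*} [NormedAddCommGroup V] [NormedSpace ℂ V]

/-- The linear coordinate annihilated by `α ∂_x + β ∂_y`. -/
noncomputable def linCoord (α β : ℂ) : ℝ × ℝ →ₗ[ℝ] ℂ where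
  toFun p := β * p.1 - α * p.2
  map_add' p q := by simp; ring
  map_smul' r p := by simp; ring

theorem linCoord_apply (α β : ℂ) (p : ℝ × ℝ) : linCoord α β p = β * p.1 - α * p.2 := rfl

theorem linCoord_injective {α β : ℂ} (h : (α * starRingEnd ℂ β).im ≠ 0) :
    Function.Injective (linCoord α β) := by
  rw [injective_iff_map_eq_zero]
  rintro ⟨x, y⟩ hp
  rw [linCoord_apply] at hp
  have h1 : (Complex.normSq β : ℂ) * x = α * starRingEnd ℂ β * y := by
    rw [Complex.normSq_eq_conj_mul_self]
    linear_combination (starRingEnd ℂ β) * hp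
  have h2 := congrArg Complex.im h1
  rw [Complex.im_mul_ofReal, Complex.im_mul_ofReal, Complex.ofReal_im, zero_mul] at h2
  have hy : y = 0 := (mul_eq_zero.1 h2.symm).resolve_left h
  have hβ : β ≠ 0 := fun h0 => h (by simp [h0])
  have hx : x = 0 := by
    rw [hy] at hp
    simpa [hβ] using hp
  rw [hx, hy]; rfl

/-- `linCoord` as an isomorphism. -/
noncomputable def linCoordEquiv {α β : ℂ} (h : (α * starRingEnd ℂ β).im ≠ 0) :
    (ℝ × ℝ) ≃L[ℝ] ℂ :=
  (LinearMap.linearEquivOfInjective (linCoord α β) (linCoord_injective h)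
    (by simp [Complex.finrank_real_complex])).toContinuousLinearEquiv

theorem linCoordEquiv_apply {α β : ℂ} (h : (α * starRingEnd ℂ β).im ≠ 0) (p : ℝ × ℝ) :
    linCoordEquiv h p = β * p.1 - α * p.2 := rfl

theorem coordW_eq (μ : OnePoint ℂ) (p : ℝ × ℝ) :
    coordW μ p = 2 * Complex.I * (coefY μ * p.1 - coefX μ * p.2) := by
  induction μ using OnePoint.rec with
  | infty =>
    simp only [coordW, OnePoint.elim_infty, coefX_infty, coefY_infty]
    linear_combination p.1 * Complex.I_sq
  | coe m =>
    simp only [coordW, OnePoint.elim_some, coefX_coe, coefY_coe]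
    linear_combination (m ^ 2 + 1) * p.1 * Complex.I_sq

theorem coordW_ne_zero {μ : OnePoint ℂ}
    (hμ : (coefX μ * starRingEnd ℂ (coefY μ)).im ≠ 0) {p : ℝ × ℝ} (hp : p ≠ 0) :
    coordW μ p ≠ 0 := by
  rw [coordW_eq, ← linCoordEquiv_apply hμ]
  refine mul_ne_zero (by simp) ?_
  simpa using hp

theorem tendsto_norm_coordW {μ : OnePoint ℂ}
    (hμ : (coefX μ * starRingEnd ℂ (coefY μ)).im ≠ 0) :
    Tendsto (fun p => ‖coordW μ p‖) (cocompact (ℝ × ℝ)) atTop := by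
  have h := (tendsto_norm_cocompact_atTop (E := ℂ)).comp
    (linCoordEquiv hμ).toHomeomorph.isClosedEmbedding.tendsto_cocompact
  refine (h.const_mul_atTop (r := 2) two_pos).congr fun p => ?_
  simp [coordW_eq, linCoordEquiv_apply]

theorem tendsto_coordW_zpow {μ : OnePoint ℂ}
    (hμ : (coefX μ * starRingEnd ℂ (coefY μ)).im ≠ 0) {k : ℤ} (hk : k < 0) :
    Tendsto (fun p => coordW μ p ^ k) (cocompact (ℝ × ℝ)) (𝓝 0) := by
  rw [tendsto_zero_iff_norm_tendsto_zero]
  simp only [norm_zpow]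
  exact (tendsto_zpow_atTop_zero hk).comp (tendsto_norm_coordW hμ)

/-- The equation says that the gradient of `G` is `(β, -α)` times one vector `c`. As `(β, -α)` is
the gradient of the linear coordinate, the derivative in that coordinate is multiplication by `c`,
hence complex linear. -/
theorem differentiable_comp_linCoordEquiv_symm {α β : ℂ} (h : (α * starRingEnd ℂ β).im ≠ 0)
    {G : ℝ × ℝ → V} (hG : Differentiable ℝ G)
    (hd : ∀ p, α • fderiv ℝ G p (1, 0) + β • fderiv ℝ G p (0, 1) = 0) :
    Differentiable ℂ (G ∘ (linCoordEquiv h).symm) := by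
  intro z
  set p := (linCoordEquiv h).symm z with hp
  have hc : ∃ c : V, fderiv ℝ G p (1, 0) = β • c ∧ fderiv ℝ G p (0, 1) = -α • c := by
    have hβ : β ≠ 0 := fun h0 => h (by simp [h0])
    refine ⟨β⁻¹ • fderiv ℝ G p (1, 0), by rw [smul_inv_smul₀ hβ], ?_⟩
    have h1 := congrArg (fun v => β⁻¹ • v) (hd p)
    simp only [smul_add, inv_smul_smul₀ hβ, smul_zero] at h1
    rw [neg_smul, smul_comm]
    exact eq_neg_of_add_eq_zero_right h1
  obtain ⟨c, h1, h2⟩ := hc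
  have hD : HasFDerivAt (G ∘ (linCoordEquiv h).symm)
      ((fderiv ℝ G p).comp ((linCoordEquiv h).symm : ℂ →L[ℝ] ℝ × ℝ)) z :=
    (hG p).hasFDerivAt.comp z (linCoordEquiv h).symm.hasFDerivAt
  refine (hasFDerivAt_of_restrictScalars ℝ (f' := ContinuousLinearMap.toSpanSingleton ℂ c) hD
    ?_).differentiableAt
  refine ContinuousLinearMap.ext fun w => ?_
  obtain ⟨⟨x, y⟩, rfl⟩ := (linCoordEquiv h).surjective w
  have h3 : ((x, y) : ℝ × ℝ) = x • (1, 0) + y • (0, 1) := by simp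
  have h4 : fderiv ℝ G p (x, y) = (β * x - α * y) • c := by
    rw [h3, map_add, map_smul, map_smul, h1, h2, ← Complex.coe_smul, ← Complex.coe_smul]
    module
  simp only [ContinuousLinearMap.coe_restrictScalars', ContinuousLinearMap.toSpanSingleton_apply,
    ContinuousLinearMap.comp_apply, ContinuousLinearEquiv.coe_coe,
    ContinuousLinearEquiv.symm_apply_apply, h4]
  rw [linCoordEquiv_apply]

/-- Liouville's theorem for the operator `α ∂_x + β ∂_y`. -/
theorem eq_of_dbar_eq_zero {α β : ℂ} (h : (α * starRingEnd ℂ β).im ≠ 0)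
    {G : ℝ × ℝ → V} (hG : Differentiable ℝ G)
    (hd : ∀ p, α • fderiv ℝ G p (1, 0) + β • fderiv ℝ G p (0, 1) = 0) {c : V}
    (hc : Tendsto G (cocompact (ℝ × ℝ)) (𝓝 c)) (p : ℝ × ℝ) : G p = c := by
  have h1 := differentiable_comp_linCoordEquiv_symm h hG hd
  have h2 := h1.apply_eq_of_tendsto_cocompact (linCoordEquiv h p) (hc.comp
    (linCoordEquiv h).symm.toHomeomorph.isClosedEmbedding.tendsto_cocompact)
  simpa using h2

end Liouville

/-! ### Uniqueness, reflection and the Chern vector of frames. -/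

section Derivation

variable {n : ℕ}

/-- The first order operator `α ∂_x + β ∂_y`. -/
noncomputable def dOp (α β : ℂ) (E : ℝ × ℝ → Mat n) (p : ℝ × ℝ) : Mat n :=
  α • pdx E p + β • pdy E p

theorem fderiv_matrix_mul {E F : ℝ × ℝ → Mat n} {p : ℝ × ℝ} (hE : DifferentiableAt ℝ E p)
    (hF : DifferentiableAt ℝ F p) (v : ℝ × ℝ) :
    fderiv ℝ (fun p => E p * F p) p v = fderiv ℝ E p v * F p + E p * fderiv ℝ F p v := by
  have h : fderiv ℝ (fun p => E p * F p) p = _ := (hE.hasFDerivAt.mul' hF.hasFDerivAt).fderiv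
  rw [h]
  simp [add_comm]

theorem dOp_mul {α β : ℂ} {E F : ℝ × ℝ → Mat n} {p : ℝ × ℝ} (hE : DifferentiableAt ℝ E p)
    (hF : DifferentiableAt ℝ F p) :
    dOp α β (fun p => E p * F p) p = dOp α β E p * F p + E p * dOp α β F p := by
  simp only [dOp, pdx, pdy, fderiv_matrix_mul hE hF, smul_add, add_mul, mul_add, smul_mul_assoc,
    mul_smul_comm]
  abel

theorem dOp_const (α β : ℂ) (C : Mat n) (p : ℝ × ℝ) : dOp α β (fun _ => C) p = 0 := by
  simp [dOp, pdx, pdy]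

theorem contDiff_matrix_inv {E : ℝ × ℝ → Mat n} {k : ℕ∞ω} (hE : ContDiff ℝ k E)
    (hu : ∀ p, IsUnit (E p)) : ContDiff ℝ k fun p => (E p)⁻¹ := by
  rw [contDiff_iff_contDiffAt]
  intro p
  have h : (fun p => (E p)⁻¹) = Ring.inverse ∘ E :=
    funext fun p => Matrix.nonsing_inv_eq_ringInverse _
  rw [h]
  obtain ⟨v, hv⟩ := hu p
  refine ContDiffAt.comp p ?_ hE.contDiffAt
  rw [← hv]
  exact contDiffAt_ringInverse ℝ v

theorem dOp_inv {α β : ℂ} {E : ℝ × ℝ → Mat n} (hE : ContDiff ℝ 1 E)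
    (hu : ∀ p, IsUnit (E p)) (p : ℝ × ℝ) :
    dOp α β (fun p => (E p)⁻¹) p = -((E p)⁻¹ * dOp α β E p * (E p)⁻¹) := by
  have hu' := fun p => (Matrix.isUnit_iff_isUnit_det _).1 (hu p)
  have h1 : (fun p => (E p)⁻¹ * E p) = fun _ => (1 : Mat n) :=
    funext fun p => Matrix.nonsing_inv_mul _ (hu' p)
  have h2 := dOp_mul (α := α) (β := β)
    ((contDiff_matrix_inv hE hu).differentiable one_ne_zero p)
    (hE.differentiable one_ne_zero p)
  rw [h1, dOp_const] at h2
  have h3 := congrArg (fun X => X * (E p)⁻¹) h2.symm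
  simp only [add_mul, zero_mul, mul_assoc, Matrix.mul_nonsing_inv _ (hu' p), mul_one] at h3
  rw [mul_assoc]
  exact eq_neg_of_add_eq_zero_left h3

theorem fderiv_matrix_star (E : ℝ × ℝ → Mat n) (p v : ℝ × ℝ) :
    fderiv ℝ (fun p => star (E p)) p v = star (fderiv ℝ E p v) := by
  have h := (starL' ℝ (A := Mat n)).comp_fderiv (f := E) (x := p)
  rw [show (fun p => star (E p)) = starL' ℝ (A := Mat n) ∘ E from rfl, h]
  rfl

theorem dOp_star (α β : ℂ) (E : ℝ × ℝ → Mat n) (p : ℝ × ℝ) :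
    dOp (starRingEnd ℂ α) (starRingEnd ℂ β) (fun p => star (E p)) p = star (dOp α β E p) := by
  simp only [dOp, pdx, pdy, fderiv_matrix_star, star_add, star_smul]
  rfl

theorem contDiff_matrix_star {E : ℝ × ℝ → Mat n} {k : ℕ∞ω} (hE : ContDiff ℝ k E) :
    ContDiff ℝ k fun p => star (E p) :=
  (starL' ℝ (A := Mat n)).contDiff.comp hE

/-- The zeroth order part of the spatial operator. -/
noncomputable def pot (P : SpatialPair n) (α β κ : ℂ) (p : ℝ × ℝ) : Mat n :=
  α • P.Ax p + β • P.Ay p + κ • P.φ p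

theorem isSol_iff {P : SpatialPair n} {α β κ : ℂ} {E : ℝ × ℝ → Mat n} {p : ℝ × ℝ} :
    IsSol P α β κ E p ↔ dOp α β E p = pot P α β κ p * E p := Iff.rfl

theorem star_pot (P : SpatialPair n) (α β κ : ℂ) (p : ℝ × ℝ) :
    star (pot P α β κ p) =
      -pot P (starRingEnd ℂ α) (starRingEnd ℂ β) (starRingEnd ℂ κ) p := by
  simp only [pot, star_add, star_smul, P.Ax_skew, P.Ay_skew, P.φ_skew, smul_neg, neg_add]
  rfl

theorem IsSol.const_mul {P : SpatialPair n} {α β κ : ℂ} {E : ℝ × ℝ → Mat n} {p : ℝ × ℝ}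
    (h : IsSol P α β κ E p) (c : ℂ) : IsSol P (c * α) (c * β) (c * κ) E p := by
  have h1 := congrArg (fun X => c • X) h
  simp only [smul_add, smul_smul, ← smul_mul_assoc] at h1
  exact h1

/-- The solution `(E*)⁻¹` of the adjoint equation. -/
theorem IsSol.star_inv {P : SpatialPair n} {α β κ : ℂ} {E : ℝ × ℝ → Mat n} (hE : ContDiff ℝ 1 E)
    (hu : ∀ p, IsUnit (E p)) {p : ℝ × ℝ} (h : IsSol P α β κ E p) :
    IsSol P (starRingEnd ℂ α) (starRingEnd ℂ β) (starRingEnd ℂ κ)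
      (fun p => (star (E p))⁻¹) p := by
  have hu' : ∀ p, IsUnit (star (E p)) := fun p => (hu p).star
  rw [isSol_iff] at h ⊢
  rw [dOp_inv (contDiff_matrix_star hE) hu', dOp_star, h, star_mul, star_pot, mul_assoc, mul_assoc,
    ← mul_assoc (star (E p))⁻¹ (star (E p)),
    Matrix.nonsing_inv_mul _ ((Matrix.isUnit_iff_isUnit_det _).1 (hu' p)), one_mul, neg_mul, neg_neg]

/-- Two solutions differ by a holomorphic factor. -/
theorem IsSol.dOp_inv_mul {P : SpatialPair n} {α β κ : ℂ} {E₀ E : ℝ × ℝ → Mat n}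
    (hE₀ : ContDiff ℝ 1 E₀) (hu : ∀ p, IsUnit (E₀ p)) {p : ℝ × ℝ} (hE : DifferentiableAt ℝ E p)
    (h₀ : IsSol P α β κ E₀ p) (h : IsSol P α β κ E p) :
    dOp α β (fun p => (E₀ p)⁻¹ * E p) p = 0 := by
  rw [isSol_iff] at h₀ h
  rw [dOp_mul ((contDiff_matrix_inv hE₀ hu).differentiable one_ne_zero p) hE, dOp_inv hE₀ hu, h₀, h,
    mul_assoc (E₀ p)⁻¹, mul_assoc (pot P α β κ p),
    Matrix.mul_nonsing_inv _ ((Matrix.isUnit_iff_isUnit_det _).1 (hu p)), mul_one, neg_mul, mul_assoc,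
    neg_add_cancel]

theorem IsSol.mul {P : SpatialPair n} {α β κ : ℂ} {E G : ℝ × ℝ → Mat n} {p : ℝ × ℝ}
    (hE : DifferentiableAt ℝ E p) (hG : DifferentiableAt ℝ G p) (h : IsSol P α β κ E p)
    (h0 : dOp α β G p = 0) : IsSol P α β κ (fun p => E p * G p) p := by
  rw [isSol_iff] at h ⊢
  rw [dOp_mul hE hG, h, h0, mul_zero, add_zero, mul_assoc]

/-- `E` is an invertible solution at the spectral parameter `μ` that tends to `1` at infinity. -/
structure IsFrameAt (P : SpatialPair n) (μ : OnePoint ℂ) (E : ℝ × ℝ → Mat n) : Prop where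
  contDiff : ContDiff ℝ 1 E
  isUnit : ∀ p, IsUnit (E p)
  isSolAt : ∀ p, IsSolAt P μ E p
  tendsto_one : Tendsto E (cocompact (ℝ × ℝ)) (𝓝 1)

theorem continuousAt_matrix_inv {A : Mat n} (hA : IsUnit A) :
    ContinuousAt (fun A : Mat n => A⁻¹) A := by
  have h : (fun A : Mat n => A⁻¹) = Ring.inverse :=
    funext fun p => Matrix.nonsing_inv_eq_ringInverse _
  rw [h]
  obtain ⟨v, rfl⟩ := hA
  exact NormedRing.inverse_continuousAt v

theorem tendsto_matrix_inv {ι : Type*} {l : Filter ι} {f : ι → Mat n} {A : Mat n}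
    (hf : Tendsto f l (𝓝 A)) (hA : IsUnit A) : Tendsto (fun i => (f i)⁻¹) l (𝓝 A⁻¹) :=
  (continuousAt_matrix_inv hA).tendsto.comp hf

/-- Solutions that tend to `1` are unique. -/
theorem IsFrameAt.eq {P : SpatialPair n} {μ : OnePoint ℂ}
    (hμ : (coefX μ * starRingEnd ℂ (coefY μ)).im ≠ 0) {E₀ E : ℝ × ℝ → Mat n}
    (h₀ : IsFrameAt P μ E₀) (hE : ContDiff ℝ 1 E) (hs : ∀ p, IsSolAt P μ E p)
    (ht : Tendsto E (cocompact (ℝ × ℝ)) (𝓝 1)) : E = E₀ := by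
  have h1 := eq_of_dbar_eq_zero hμ (G := fun p => (E₀ p)⁻¹ * E p)
    (((contDiff_matrix_inv h₀.contDiff h₀.isUnit).mul hE).differentiable one_ne_zero)
    (fun p => IsSol.dOp_inv_mul h₀.contDiff h₀.isUnit (hE.differentiable one_ne_zero p)
      (h₀.isSolAt p) (hs p)) (c := 1)
    (by simpa using (tendsto_matrix_inv h₀.tendsto_one isUnit_one).mul ht)
  funext p
  have h2 := congrArg (fun X => E₀ p * X) (h1 p)
  simpa [Matrix.mul_nonsing_inv_cancel_left _ _ ((Matrix.isUnit_iff_isUnit_det _).1 (h₀.isUnit p))]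
    using h2

/-- The spectral parameter `1/μ̄`. -/
noncomputable def conjInv (μ : OnePoint ℂ) : OnePoint ℂ :=
  μ.elim ((0 : ℂ) : OnePoint ℂ) fun m =>
    if m = 0 then OnePoint.infty else ((starRingEnd ℂ m)⁻¹ : ℂ)

/-- Up to a common factor, `-1` at `0` and `∞` and `-m̄⁻²` elsewhere, the coefficients at `1/μ̄` are
the conjugates of those at `μ`. Thus the adjoint equation at `μ` is the equation at the reflected
parameter. -/
theorem exists_coef_conjInv (μ : OnePoint ℂ) : ∃ c : ℂ,
    coefX (conjInv μ) = c * starRingEnd ℂ (coefX μ) ∧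
    coefY (conjInv μ) = c * starRingEnd ℂ (coefY μ) ∧
    coefPhi (conjInv μ) = c * starRingEnd ℂ (coefPhi μ) := by
  have h2 : starRingEnd ℂ 2 = 2 := map_ofNat _ 2
  induction μ using OnePoint.rec with
  | infty => refine ⟨-1, ?_, ?_, ?_⟩ <;> simp [conjInv, h2] <;> ring
  | coe m =>
    by_cases hm : m = 0
    · refine ⟨-1, ?_, ?_, ?_⟩ <;> simp [conjInv, hm, h2] <;> ring
    · have hm' : starRingEnd ℂ m ≠ 0 := by simpa using hm
      refine ⟨-((starRingEnd ℂ m) ^ 2)⁻¹, ?_, ?_, ?_⟩ <;>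
      · simp [conjInv, hm, h2]
        field_simp
        try ring

theorem IsFrameAt.star_inv {P : SpatialPair n} {μ : OnePoint ℂ} {E : ℝ × ℝ → Mat n}
    (h : IsFrameAt P μ E) : IsFrameAt P (conjInv μ) fun p => (star (E p))⁻¹ := by
  have hu : ∀ p, IsUnit (star (E p)) := fun p => (h.isUnit p).star
  refine ⟨contDiff_matrix_inv (contDiff_matrix_star h.contDiff) hu, fun p => ?_, fun p => ?_, ?_⟩
  · exact (Matrix.isUnit_nonsing_inv_iff).2 (hu p)
  · obtain ⟨c, h1, h2, h3⟩ := exists_coef_conjInv μ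
    rw [IsSolAt, h1, h2, h3]
    exact (IsSol.star_inv h.contDiff h.isUnit (h.isSolAt p)).const_mul c
  · have := h.tendsto_one.star
    rw [star_one] at this
    simpa using tendsto_matrix_inv this isUnit_one

theorem dOp_mul_const {α β : ℂ} {G : ℝ × ℝ → Mat n} {p : ℝ × ℝ} (hG : DifferentiableAt ℝ G p)
    (h : dOp α β G p = 0) (C D : Mat n) : dOp α β (fun p => C * G p * D) p = 0 := by
  have hG' : DifferentiableAt ℝ (fun p => C * G p) p := (differentiableAt_const C).mul hG
  rw [dOp_mul hG' (differentiableAt_const D),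
    dOp_mul (differentiableAt_const C) hG, dOp_const, dOp_const, h]
  simp

/-- The Chern vector vanishes where there is a frame. -/
theorem IsFrameAt.isChernVector_iff {P : SpatialPair n} {μ : OnePoint ℂ}
    (hμ : (coefX μ * starRingEnd ℂ (coefY μ)).im ≠ 0) {E₀ : ℝ × ℝ → Mat n}
    (h₀ : IsFrameAt P μ E₀) (c : Fin n → ℤ) : IsChernVector P μ c ↔ c = 0 := by
  constructor
  · rintro ⟨-, E, F, R, F', hR, hE, hEu, hEs, -, -, -, hFt, hF', hEF⟩
    have hdet : ∀ {A : Mat n}, IsUnit A → IsUnit A.det := (Matrix.isUnit_iff_isUnit_det _).1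
    -- The quotient of the two frames is entire in `w`, invertible, and equals an invertible matrix
    -- with invertible limit times `diag (w^{-c(i)})` near infinity.
    set G : ℝ × ℝ → Mat n := fun p => (E₀ p)⁻¹ * E p with hG
    have hGc : ContDiff ℝ 1 G := (contDiff_matrix_inv h₀.contDiff h₀.isUnit).mul hE
    have hGu : ∀ p, IsUnit (G p) := fun p =>
      ((Matrix.isUnit_nonsing_inv_iff).2 (h₀.isUnit p)).mul (hEu p)
    have hGd : ∀ p, dOp (coefX μ) (coefY μ) G p = 0 := fun p =>
      IsSol.dOp_inv_mul h₀.contDiff h₀.isUnit (hE.differentiable one_ne_zero p)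
        (h₀.isSolAt p) (bundleOp_eq_zero_iff.1 (hEs p))
    have hH : Tendsto (fun p => (E₀ p)⁻¹ * F p) (cocompact (ℝ × ℝ)) (𝓝 F') := by
      simpa using (tendsto_matrix_inv h₀.tendsto_one isUnit_one).mul hFt
    have hfar : ∀ᶠ p : ℝ × ℝ in cocompact (ℝ × ℝ), R < ‖p‖ :=
      tendsto_norm_cocompact_atTop.eventually_gt_atTop R
    funext i
    -- The projection `D` on the `i`-th coordinate isolates one degree: `D G⁻¹` is of order
    -- `w^{c(i)}` and `G D` of order `w^{-c(i)}`. Whichever decays is zero by Liouville, which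
    -- contradicts the invertibility of `G`.
    set D : Mat n := Matrix.diagonal (Pi.single i 1) with hD
    have hD0 : D ≠ 0 := fun h => by
      have := congrFun (congrFun h i) i
      simp [hD] at this
    rcases lt_trichotomy (c i) 0 with hi | hi | hi
    · exfalso
      have hGi : ContDiff ℝ 1 fun p => (G p)⁻¹ := contDiff_matrix_inv hGc hGu
      have hGid : ∀ p, dOp (coefX μ) (coefY μ) (fun p => (G p)⁻¹) p = 0 := fun p => by
        rw [dOp_inv hGc hGu, hGd]; simp
      have hlim : Tendsto (fun p => D * (G p)⁻¹ * 1) (cocompact (ℝ × ℝ)) (𝓝 0) := by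
        have h1 : Tendsto (fun p => coordW μ p ^ (c i) • (D * ((E₀ p)⁻¹ * F p)⁻¹))
            (cocompact (ℝ × ℝ)) (𝓝 ((0 : ℂ) • (D * F'⁻¹))) :=
          (tendsto_coordW_zpow hμ hi).smul ((tendsto_matrix_inv hH hF').const_mul D)
        rw [zero_smul] at h1
        refine h1.congr' ?_
        filter_upwards [hfar] with p hp
        have hw : coordW μ p ≠ 0 := coordW_ne_zero hμ (norm_pos_iff.1 (hR.trans_lt hp))
        have hinv : (Matrix.diagonal fun i => coordW μ p ^ (-(c i)))⁻¹ =
            (Matrix.diagonal fun i => coordW μ p ^ (c i) : Mat n) := by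
          refine Matrix.inv_eq_left_inv ?_
          rw [Matrix.diagonal_mul_diagonal, ← Matrix.diagonal_one]
          congr 1
          funext j
          rw [← zpow_add₀ hw, add_neg_cancel, zpow_zero]
        rw [mul_one, hG]
        simp only
        rw [hEF p hp, ← mul_assoc, Matrix.mul_inv_rev _ (Matrix.diagonal _), hinv, ← mul_assoc, hD,
          Matrix.diagonal_mul_diagonal, ← smul_mul_assoc]
        congr 1
        rw [← Matrix.diagonal_smul]
        congr 1
        funext j
        by_cases hj : j = i
        · subst hj; simp
        · simp [hj]
      have hz := eq_of_dbar_eq_zero hμ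
        (((contDiff_const.mul hGi).mul contDiff_const).differentiable one_ne_zero)
        (fun p => dOp_mul_const (hGi.differentiable one_ne_zero p) (hGid p) D 1) hlim 0
      rw [mul_one] at hz
      have h3 := congrArg (fun X => X * G 0) hz
      simp only [zero_mul] at h3
      rw [Matrix.nonsing_inv_mul_cancel_right _ _ (hdet (hGu 0))] at h3
      exact hD0 h3
    · exact hi
    · exfalso
      have hlim : Tendsto (fun p => 1 * G p * D) (cocompact (ℝ × ℝ)) (𝓝 0) := by
        have h1 : Tendsto (fun p => coordW μ p ^ (-(c i)) • (((E₀ p)⁻¹ * F p) * D))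
            (cocompact (ℝ × ℝ)) (𝓝 ((0 : ℂ) • (F' * D))) :=
          (tendsto_coordW_zpow hμ (neg_lt_zero.2 hi)).smul (hH.mul_const D)
        rw [zero_smul] at h1
        refine h1.congr' ?_
        filter_upwards [hfar] with p hp
        rw [one_mul, hG]
        simp only
        rw [hEF p hp, ← mul_assoc, mul_assoc _ (Matrix.diagonal _), hD,
          Matrix.diagonal_mul_diagonal, ← mul_smul_comm]
        congr 1
        rw [← Matrix.diagonal_smul]
        congr 1
        funext j
        by_cases hj : j = i
        · subst hj; simp
        · simp [hj]
      have hz := eq_of_dbar_eq_zero hμ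
        (((contDiff_const.mul hGc).mul contDiff_const).differentiable one_ne_zero)
        (fun p => dOp_mul_const (hGc.differentiable one_ne_zero p) (hGd p) 1 D) hlim 0
      rw [one_mul] at hz
      have h3 := congrArg (fun X => (G 0)⁻¹ * X) hz
      simp only [mul_zero] at h3
      rw [Matrix.nonsing_inv_mul_cancel_left _ _ (hdet (hGu 0))] at h3
      exact hD0 h3
  · rintro rfl
    refine ⟨monotone_const, E₀, E₀, 0, 1, le_rfl, h₀.contDiff, h₀.isUnit,
      fun p => bundleOp_eq_zero_iff.2 (h₀.isSolAt p), h₀.contDiff.contDiffOn,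
      fun p _ => h₀.isUnit p, fun p _ => bundleOp_eq_zero_iff.2 (h₀.isSolAt p), h₀.tendsto_one,
      isUnit_one, fun p _ => ?_⟩
    simp

end Derivation

/-! ### Limits at infinity from integrable gradients. -/

section LimitAtInfinity

variable {V : Type*} [NormedAddCommGroup V] [NormedSpace ℝ V]

/-- Comparison with `K arctan`, whose total variation is `K π`. -/
theorem norm_sub_le_of_deriv_le {g g' : ℝ → V} {K : ℝ} (hg : ∀ t, HasDerivAt g (g' t) t)
    (hK : ∀ t, ‖g' t‖ ≤ K / (1 + t ^ 2)) (a b : ℝ) : ‖g b - g a‖ ≤ K * Real.pi := by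
  have hK0 : 0 ≤ K := by simpa using (norm_nonneg _).trans (hK 0)
  wlog hab : a ≤ b generalizing a b
  · rw [norm_sub_rev]; exact this b a (le_of_not_ge hab)
  have h := image_norm_le_of_norm_deriv_right_le_deriv_boundary (a := a) (b := b)
    (f := fun t => g t - g a) (f' := g') (B := fun t => K * (Real.arctan t - Real.arctan a))
    (B' := fun t => K / (1 + t ^ 2))
    (fun t _ => ((hg t).sub_const _).continuousAt.continuousWithinAt)
    (fun t _ => ((hg t).sub_const _).hasDerivWithinAt) (by simp)
    (fun t => by
      have := ((Real.hasDerivAt_arctan t).sub_const (Real.arctan a)).const_mul K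
      rwa [mul_one_div] at this)
    (fun t _ => hK t) (Set.right_mem_Icc.2 hab)
  refine h.trans (mul_le_mul_of_nonneg_left ?_ hK0)
  linarith [Real.arctan_lt_pi_div_two b, Real.neg_pi_div_two_lt_arctan a]

/-- A function on the plane whose gradient decays fast enough has a limit at infinity. -/
theorem exists_tendsto_cocompact [CompleteSpace V] {f : ℝ × ℝ → V} (hf : Differentiable ℝ f) {K : ℝ}
    (h₁ : ∀ p, ‖fderiv ℝ f p (1, 0)‖ ≤ K / ((1 + p.1 ^ 2) * (1 + p.2 ^ 2)))
    (h₂ : ∀ p, ‖fderiv ℝ f p (0, 1)‖ ≤ K / ((1 + p.1 ^ 2) * (1 + p.2 ^ 2))) :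
    ∃ c, Tendsto f (cocompact (ℝ × ℝ)) (𝓝 c) := by
  have hK0 : 0 ≤ K := by simpa using (norm_nonneg _).trans (h₁ 0)
  have hx : ∀ a b y, ‖f (b, y) - f (a, y)‖ ≤ K / (1 + y ^ 2) * Real.pi := fun a b y =>
    norm_sub_le_of_deriv_le (g := fun x => f (x, y)) (g' := fun x => fderiv ℝ f (x, y) (1, 0))
      (fun t => (hf (t, y)).hasFDerivAt.comp_hasDerivAt t
        ((hasDerivAt_id t).prodMk (hasDerivAt_const t y)))
      (fun t => (h₁ (t, y)).trans_eq (by rw [div_div, mul_comm])) a b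
  have hy : ∀ a b x, ‖f (x, b) - f (x, a)‖ ≤ K / (1 + x ^ 2) * Real.pi := fun a b x =>
    norm_sub_le_of_deriv_le (g := fun y => f (x, y)) (g' := fun y => fderiv ℝ f (x, y) (0, 1))
      (fun t => (hf (x, t)).hasFDerivAt.comp_hasDerivAt t
        ((hasDerivAt_const t x).prodMk (hasDerivAt_id t)))
      (fun t => (h₂ (x, t)).trans_eq (by rw [div_div])) a b
  have hmono : ∀ {N s : ℝ}, 0 ≤ N → N ≤ |s| → K / (1 + s ^ 2) * Real.pi ≤
      K / (1 + N ^ 2) * Real.pi := fun {N s} hN hs => by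
    have h3 : N ^ 2 ≤ s ^ 2 := by rw [← sq_abs s]; gcongr
    have := Real.pi_pos.le
    gcongr
  -- A point outside the square of half-side `N` is joined to the corner `(N, N)` by two
  -- axis-parallel segments along whose lines the fixed coordinate is at least `N` in modulus.
  have key : ∀ N : ℝ, 0 ≤ N → ∀ p : ℝ × ℝ, N ≤ ‖p‖ →
      ‖f p - f (N, N)‖ ≤ 2 * (K / (1 + N ^ 2) * Real.pi) := by
    rintro N hN ⟨x, y⟩ hp
    rw [Prod.norm_def, le_max_iff, Real.norm_eq_abs, Real.norm_eq_abs] at hp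
    rcases hp with hp | hp
    · have h3 := (hy N y x).trans (hmono hN hp)
      have h4 := hx N x N
      calc _ = ‖(f (x, y) - f (x, N)) + (f (x, N) - f (N, N))‖ := by rw [sub_add_sub_cancel]
        _ ≤ _ := (norm_add_le _ _).trans (by linarith)
    · have h3 := (hx N x y).trans (hmono hN hp)
      have h4 := hy N y N
      calc _ = ‖(f (x, y) - f (N, y)) + (f (N, y) - f (N, N))‖ := by rw [sub_add_sub_cancel]
        _ ≤ _ := (norm_add_le _ _).trans (by linarith)
  refine cauchy_map_iff_exists_tendsto.1 (Metric.cauchy_iff.2 ⟨inferInstance, fun ε hε => ?_⟩)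
  have hlim : Tendsto (fun N : ℝ => 4 * (K / (1 + N ^ 2) * Real.pi)) atTop (𝓝 0) := by
    have h5 : Tendsto (fun N : ℝ => 1 + N ^ 2) atTop atTop :=
      tendsto_atTop_add_const_left _ _ (tendsto_pow_atTop two_ne_zero)
    simpa using ((h5.const_div_atTop K).mul_const Real.pi).const_mul 4
  obtain ⟨N, hN, hN0⟩ := ((hlim.eventually_lt_const hε).and (eventually_ge_atTop 0)).exists
  refine ⟨f '' {p | N ≤ ‖p‖}, image_mem_map
    (tendsto_norm_cocompact_atTop.eventually_ge_atTop N), ?_⟩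
  rintro _ ⟨p, hp, rfl⟩ _ ⟨q, hq, rfl⟩
  rw [dist_eq_norm]
  calc ‖f p - f q‖ = ‖(f p - f (N, N)) - (f q - f (N, N))‖ := by rw [sub_sub_sub_cancel_right]
    _ ≤ _ := norm_sub_le _ _
    _ ≤ 4 * (K / (1 + N ^ 2) * Real.pi) := by linarith [key N hN0 p hp, key N hN0 q hq]
    _ < ε := hN

theorem exists_norm_schwartz_le (a : 𝓢(ℝ × ℝ, V)) :
    ∃ K, ∀ p, ‖a p‖ ≤ K / ((1 + p.1 ^ 2) * (1 + p.2 ^ 2)) := by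
  refine ⟨2 ^ 4 * ((Finset.Iic (4, 0)).sup fun m => SchwartzMap.seminorm ℝ m.1 m.2) a,
    fun p => ?_⟩
  have h := SchwartzMap.one_add_le_sup_seminorm_apply (𝕜 := ℝ) (m := (4, 0)) (k := 4) (n := 0)
    le_rfl le_rfl a p
  rw [norm_iteratedFDeriv_zero] at h
  rw [le_div_iff₀ (by positivity), mul_comm]
  refine le_trans (mul_le_mul_of_nonneg_right ?_ (norm_nonneg _)) h
  have h1 : 1 + p.1 ^ 2 ≤ (1 + ‖p‖) ^ 2 := by
    have := norm_fst_le p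
    rw [Real.norm_eq_abs] at this
    nlinarith [sq_abs p.1, abs_nonneg p.1, norm_nonneg p]
  have h2 : 1 + p.2 ^ 2 ≤ (1 + ‖p‖) ^ 2 := by
    have := norm_snd_le p
    rw [Real.norm_eq_abs] at this
    nlinarith [sq_abs p.2, abs_nonneg p.2, norm_nonneg p]
  calc _ ≤ (1 + ‖p‖) ^ 2 * (1 + ‖p‖) ^ 2 := by gcongr
    _ = _ := by ring

end LimitAtInfinity

/-! ### Gauge transformations: limit at infinity and action on frames. -/

section Gauge

variable {n : ℕ} {u : ℝ × ℝ → Mat n} {P Q : SpatialPair n}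

theorem IsGaugeTransform.star_mul_self (h : IsGaugeTransform u P Q) (p : ℝ × ℝ) :
    star (u p) * u p = 1 := Unitary.star_mul_self_of_mem (h.unitary p)

theorem IsGaugeTransform.mul_star_self (h : IsGaugeTransform u P Q) (p : ℝ × ℝ) :
    u p * star (u p) = 1 := Unitary.mul_star_self_of_mem (h.unitary p)

/-- Solving the transformation law for the derivative gives `D = B U - U A`, and unitary factors
preserve the operator norm. So the gradient of `u` decays as fast as the two connections. -/
theorem norm_le_of_gauge_eq {U A B D : Mat n} (hU : U ∈ Matrix.unitaryGroup (Fin n) ℂ)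
    (h : B = U * A * star U + D * star U) : ‖D‖ ≤ ‖B‖ + ‖A‖ := by
  have hU' : star U ∈ unitary (Mat n) := Unitary.star_mem hU
  have h1 : D = B * U - U * A := by
    rw [h, add_mul, mul_assoc (U * A), mul_assoc D, Unitary.star_mul_self_of_mem hU]; simp
  rw [h1]
  refine (norm_sub_le _ _).trans_eq ?_
  rw [CStarRing.norm_mul_mem_unitary _ hU, CStarRing.norm_mem_unitary_mul _ hU]

/-- A gauge transformation between spatial pairs has a limit at infinity. -/
theorem IsGaugeTransform.exists_limit (h : IsGaugeTransform u P Q) :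
    ∃ c ∈ Matrix.unitaryGroup (Fin n) ℂ, Tendsto u (cocompact (ℝ × ℝ)) (𝓝 c) := by
  obtain ⟨K₁, h₁⟩ := exists_norm_schwartz_le Q.Ax
  obtain ⟨K₂, h₂⟩ := exists_norm_schwartz_le P.Ax
  obtain ⟨K₃, h₃⟩ := exists_norm_schwartz_le Q.Ay
  obtain ⟨K₄, h₄⟩ := exists_norm_schwartz_le P.Ay
  obtain ⟨c, hc⟩ := exists_tendsto_cocompact (f := u) (K := max (K₁ + K₂) (K₃ + K₄))
    (h.smooth.differentiable (by simp))
    (fun p => (norm_le_of_gauge_eq (h.unitary p) (h.Ax_eq p)).trans ((add_le_add (h₁ p) (h₂ p)).trans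
      (by rw [← add_div]; gcongr; exact le_max_left _ _)))
    (fun p => (norm_le_of_gauge_eq (h.unitary p) (h.Ay_eq p)).trans ((add_le_add (h₃ p) (h₄ p)).trans
      (by rw [← add_div]; gcongr; exact le_max_right _ _)))
  refine ⟨c, Matrix.mem_unitaryGroup_iff.2 ?_, hc⟩
  have h5 := hc.mul hc.star
  simp only [h.mul_star_self] at h5
  exact tendsto_nhds_unique h5 tendsto_const_nhds |>.symm ▸ rfl

theorem IsGaugeTransform.dOp_star (h : IsGaugeTransform u P Q) (α β : ℂ) (p : ℝ × ℝ) :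
    dOp α β (fun p => star (u p)) p = -(star (u p) * dOp α β u p * star (u p)) := by
  have hu : ContDiff ℝ 1 u := h.smooth.of_le (by norm_cast)
  have hinv : ∀ p, star (u p) = (u p)⁻¹ := fun p =>
    (Matrix.inv_eq_left_inv (h.star_mul_self p)).symm
  have hunit : ∀ p, IsUnit (u p) := fun p => IsUnit.of_mul_eq_one _ (h.mul_star_self p)
  simp only [hinv]
  exact dOp_inv hu hunit p

theorem IsGaugeTransform.pot_eq (h : IsGaugeTransform u P Q) (α β κ : ℂ) (p : ℝ × ℝ) :
    pot Q α β κ p = u p * pot P α β κ p * star (u p) + dOp α β u p * star (u p) := by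
  simp only [pot, dOp, h.Ax_eq, h.Ay_eq, h.φ_eq, mul_add, add_mul, smul_add, smul_mul_assoc,
    mul_smul_comm]
  abel

/-- Frames transform under gauge transformations. -/
theorem IsGaugeTransform.isFrameAt (h : IsGaugeTransform u P Q) {c : Mat n}
    (hc : c ∈ Matrix.unitaryGroup (Fin n) ℂ) (hu : Tendsto u (cocompact (ℝ × ℝ)) (𝓝 c))
    {μ : OnePoint ℂ} {E : ℝ × ℝ → Mat n} (hE : IsFrameAt Q μ E) :
    IsFrameAt P μ fun p => star (u p) * E p * c := by
  have hu1 : ContDiff ℝ 1 u := h.smooth.of_le (by norm_cast)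
  have hs1 := contDiff_matrix_star hu1
  have hcu : IsUnit c := IsUnit.of_mul_eq_one _ (Unitary.mul_star_self_of_mem hc)
  refine ⟨(hs1.mul hE.contDiff).mul contDiff_const, fun p => ?_, fun p => ?_, ?_⟩
  · exact ((IsUnit.of_mul_eq_one _ (h.star_mul_self p)).mul (hE.isUnit p)).mul hcu
  · have hd : DifferentiableAt ℝ (fun p => star (u p) * E p) p :=
      (hs1.mul hE.contDiff).differentiable one_ne_zero p
    refine IsSol.mul hd (differentiableAt_const c) ?_ (dOp_const _ _ c p)
    have hs := isSol_iff.1 (hE.isSolAt p)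
    rw [isSol_iff, dOp_mul (hs1.differentiable one_ne_zero p)
      (hE.contDiff.differentiable one_ne_zero p), h.dOp_star, hs, h.pot_eq]
    simp only [mul_add, add_mul, ← mul_assoc, h.star_mul_self, one_mul, neg_mul]
    abel
  · have := (hu.star.mul hE.tendsto_one).mul_const c
    rwa [mul_one, Unitary.star_mul_self_of_mem hc] at this

end Gauge

/-! ### Boundary values, scattering matrix and the main theorem. -/

section Scattering

variable {n : ℕ}

/-- Frames outside the closed unit disc, with boundary values `T θ` whose squares are near `1`
and behave like a scattering matrix. -/
structure HasUpperFrames (P : SpatialPair n) (q : ℝ) (E : ℂ → ℝ × ℝ → Mat n)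
    (T : ℝ → ℝ × ℝ → Mat n) : Prop where
  isFrameAt : ∀ m : ℂ, 1 < ‖m‖ → IsFrameAt P m (E m)
  differentiableOn : ∀ p, DifferentiableOn ℂ (fun m => E m p) {m | 1 < ‖m‖}
  tendsto : ∀ (θ : ℝ) (p : ℝ × ℝ), Tendsto (fun z : ℂ × ℝ × ℝ => E z.1 z.2)
    (𝓝[{m | 1 < ‖m‖}] Complex.exp (θ * Complex.I) ×ˢ 𝓝 p) (𝓝 (T θ p))
  continuous : ∀ θ, Continuous (T θ)
  isUnit : ∀ θ p, IsUnit (T θ p)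
  near_one : ∀ θ p, ‖star (T θ p) * T θ p - 1‖ ≤ q
  hasLineDerivAt : ∀ θ p, HasLineDerivAt ℝ (fun p => star (T θ p) * T θ p) 0 p
    (-Real.sin θ, Real.cos θ)
  tendsto_one : ∀ θ, Tendsto (fun p => star (T θ p) * T θ p)
    (comap (fun p : ℝ × ℝ => p.1 * Real.cos θ + p.2 * Real.sin θ) (cocompact ℝ)) (𝓝 1)

theorem isUnit_of_norm_sub_one_lt {A : Mat n} (h : ‖A - 1‖ < 1) : IsUnit A := by
  have := isUnit_one_sub_of_norm_lt_one (x := 1 - A) (by rwa [norm_sub_rev])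
  rwa [sub_sub_cancel] at this

theorem norm_star_mul_self_sub_one_le {A : Mat n} {q : ℝ} (h : ‖A - 1‖ ≤ q) :
    ‖star A * A - 1‖ ≤ q * q + (q + q) := by
  have h1 : star A * A - 1 = star (A - 1) * (A - 1) + (star (A - 1) + (A - 1)) := by
    simp only [star_sub, star_one]; noncomm_ring
  rw [h1]
  have hq : 0 ≤ q := (norm_nonneg _).trans h
  have hs : ‖star (A - 1)‖ ≤ q := by rwa [norm_star]
  refine (norm_add_le _ _).trans (add_le_add ((norm_mul_le _ _).trans ?_)
    ((norm_add_le _ _).trans (add_le_add hs h)))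
  gcongr

theorem hasLineDerivAt_star_mul_self {P : SpatialPair n} {θ : ℝ} {T : ℝ × ℝ → Mat n}
    (hT : ContDiff ℝ 1 T) (hs : ∀ p, IsSolAt P (Complex.exp (θ * Complex.I) : ℂ) T p) (p : ℝ × ℝ) :
    HasLineDerivAt ℝ (fun p => star (T p) * T p) 0 p (-Real.sin θ, Real.cos θ) := by
  have he := Complex.exp_ne_zero (θ * Complex.I)
  have hd := hT.differentiable one_ne_zero p
  have hsd := (contDiff_matrix_star hT).differentiable one_ne_zero p
  -- After multiplication by `i e^{-iθ}` all three coefficients are real. The potential is then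
  -- skew-Hermitian, and its contributions to the derivative of `T* T` cancel.
  have h1 : IsSol P (-Real.sin θ : ℝ) (Real.cos θ : ℝ) (-1 : ℝ) T p := by
    have h := (hs p).const_mul (Complex.I / Complex.exp (θ * Complex.I))
    convert h using 1
    · rw [coefX_exp]
      field_simp
      push_cast
      linear_combination -(Complex.sin θ) * Complex.I_sq
    · rw [coefY_exp]
      field_simp
      push_cast
      linear_combination (Complex.cos θ) * Complex.I_sq
    · rw [coefPhi_coe]
      field_simp
      push_cast
      linear_combination -Complex.I_sq
  have h2 : dOp (-Real.sin θ : ℝ) (Real.cos θ : ℝ) (fun p => star (T p) * T p) p = 0 := by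
    rw [isSol_iff] at h1
    have h3 := dOp_star (-Real.sin θ : ℝ) (Real.cos θ : ℝ) T p
    have h4 := star_pot P (-Real.sin θ : ℝ) (Real.cos θ : ℝ) (-1 : ℝ) p
    simp only [Complex.conj_ofReal] at h3 h4
    rw [dOp_mul hsd hd, h3, h1, star_mul, h4]
    noncomm_ring
  have h3 : DifferentiableAt ℝ (fun p => star (T p) * T p) p := hsd.mul hd
  have h4 : fderiv ℝ (fun p => star (T p) * T p) p (-Real.sin θ, Real.cos θ) = 0 := by
    have h5 : ((-Real.sin θ, Real.cos θ) : ℝ × ℝ) =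
        (-Real.sin θ) • (1, 0) + Real.cos θ • (0, 1) := by simp
    rw [h5, map_add, map_smul, map_smul, ← Complex.coe_smul, ← Complex.coe_smul]
    exact h2
  rw [← h4]
  exact h3.hasFDerivAt.hasLineDerivAt _

/-- A function that is constant in the direction `(-sin θ, cos θ)` and has a limit along some
other line has this limit as `|x cos θ + y sin θ| → ∞`. -/
theorem tendsto_of_hasLineDerivAt {θ : ℝ} {S : ℝ × ℝ → Mat n}
    (hS : ∀ p, HasLineDerivAt ℝ S 0 p (-Real.sin θ, Real.cos θ)) {v : ℝ × ℝ}
    (hv : v.1 * Real.cos θ + v.2 * Real.sin θ ≠ 0) {c : Mat n}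
    (hc : Tendsto (fun s : ℝ => S (s • v)) (cocompact ℝ) (𝓝 c)) :
    Tendsto S (comap (fun p : ℝ × ℝ => p.1 * Real.cos θ + p.2 * Real.sin θ) (cocompact ℝ))
      (𝓝 c) := by
  set d := v.1 * Real.cos θ + v.2 * Real.sin θ with hd
  have hline : ∀ p (r : ℝ), S (p + r • (-Real.sin θ, Real.cos θ)) = S p := fun p r => by
    have hder : ∀ t : ℝ, HasDerivAt (fun t : ℝ => S (p + t • (-Real.sin θ, Real.cos θ))) 0 t :=
      fun t => by
        have h := hS (p + t • (-Real.sin θ, Real.cos θ))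
        have h2 : HasDerivAt (fun r : ℝ => S (p + t • (-Real.sin θ, Real.cos θ) +
          r • (-Real.sin θ, Real.cos θ))) 0 (t - t) := by rw [sub_self]; exact h
        have h3 := HasDerivAt.comp_sub_const t t h2
        refine h3.congr_of_eventuallyEq (Eventually.of_forall fun r => ?_)
        simp only
        rw [add_assoc, ← add_smul, add_sub_cancel]
    have := is_const_of_deriv_eq_zero (fun t => (hder t).differentiableAt)
      (fun t => (hder t).deriv) r 0
    simpa using this
  have hmul : Tendsto (fun s : ℝ => d⁻¹ * s) (cocompact ℝ) (cocompact ℝ) :=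
    (Homeomorph.mulLeft₀ d⁻¹ (inv_ne_zero hv)).isClosedEmbedding.tendsto_cocompact
  refine ((hc.comp hmul).comp tendsto_comap).congr fun p => ?_
  set s := d⁻¹ * (p.1 * Real.cos θ + p.2 * Real.sin θ) with hs
  have hsd : s * d = p.1 * Real.cos θ + p.2 * Real.sin θ := by
    rw [hs, mul_comm, mul_inv_cancel_left₀ hv]
  -- Any point is moved along the direction `(-sin θ, cos θ)` to the point of the line `ℝ v` with
  -- the same value of `x cos θ + y sin θ`.
  have h1 : p = s • v + (-(p.1 - s * v.1) * Real.sin θ + (p.2 - s * v.2) * Real.cos θ) •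
      (-Real.sin θ, Real.cos θ) := by
    have h2 : (p.1 - s * v.1) * Real.cos θ + (p.2 - s * v.2) * Real.sin θ = 0 := by
      rw [hd] at hsd; linarith
    have h3 := Real.sin_sq_add_cos_sq θ
    refine Prod.ext ?_ ?_
    · simp only [Prod.fst_add, Prod.smul_fst, smul_eq_mul]
      linear_combination Real.cos θ * h2 - (p.1 - s * v.1) * h3
    · simp only [Prod.snd_add, Prod.smul_snd, smul_eq_mul]
      linear_combination Real.sin θ * h2 - (p.2 - s * v.2) * h3
  change S (s • v) = S p
  conv_rhs => rw [h1]
  exact (hline _ _).symm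

theorem im_coef_ne_zero_of_one_lt {m : ℂ} (hm : 1 < ‖m‖) :
    (coefX m * starRingEnd ℂ (coefY m)).im ≠ 0 := by
  rw [im_coef_mul_conj]
  have : 1 < ‖m‖ ^ 4 := one_lt_pow₀ hm (by norm_num)
  linarith

theorem UpperChart.isFrameAt {P : SpatialPair n} {q : ℝ} (hq : q < 1) {D : Set ℂ}
    {E : ℂ → ℝ × ℝ → Mat n} (h : UpperChart P q D E) {m : ℂ} (hD : m ∈ D) (hm : 1 < ‖m‖) :
    IsFrameAt P m (E m) :=
  ⟨h.contDiff m hD hm.le, fun p => isUnit_of_norm_sub_one_lt ((h.near_one m hD hm.le p).trans_lt hq),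
    h.isSolAt m hD hm.le, h.tendsto_one m hD hm⟩

theorem norm_exp_angle (θ : ℝ) : ‖Complex.exp (θ * Complex.I)‖ = 1 :=
  Complex.norm_exp_ofReal_mul_I θ

/-- A small spatial pair has frames outside the unit disc with continuous boundary values. -/
theorem exists_hasUpperFrames {P : SpatialPair n} {q : ℝ} (hq : q < 1)
    (h : ∀ m : ℂ, ∃ D E, m ∈ D ∧ UpperChart P q D E) :
    ∃ E T, HasUpperFrames P (q * q + (q + q)) E T := by
  choose D C hD hC using h
  -- On overlaps outside the closed disc the charts agree by uniqueness, so the diagonal choice `C m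
  -- m` inherits holomorphy and boundary continuity from any single chart.
  have heq : ∀ (m₀ m : ℂ), m ∈ D m₀ → 1 < ‖m‖ → C m m = C m₀ m := fun m₀ m hm h1 => by
    have hf := (hC m).isFrameAt hq (hD m) h1
    exact ((hC m₀).isFrameAt hq hm h1).eq (im_coef_ne_zero_of_one_lt h1) hf.contDiff hf.isSolAt
      hf.tendsto_one
  have hout : IsOpen {m : ℂ | 1 < ‖m‖} := isOpen_lt continuous_const continuous_norm
  have hder : ∀ (θ : ℝ) (p : ℝ × ℝ), HasLineDerivAt ℝ (fun p =>
      star (C (Complex.exp (θ * Complex.I)) (Complex.exp (θ * Complex.I)) p) *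
        C (Complex.exp (θ * Complex.I)) (Complex.exp (θ * Complex.I)) p) 0 p
      (-Real.sin θ, Real.cos θ) := fun θ p =>
    hasLineDerivAt_star_mul_self ((hC _).contDiff _ (hD _) (norm_exp_angle θ).ge)
      ((hC _).isSolAt _ (hD _) (norm_exp_angle θ).ge) p
  refine ⟨fun m => C m m, fun θ => C (Complex.exp (θ * Complex.I)) (Complex.exp (θ * Complex.I)),
    fun m hm => (hC m).isFrameAt hq (hD m) hm, fun p m hm => ?_, fun θ p => ?_, fun θ => ?_,
    fun θ p => ?_, fun θ p => ?_, hder, fun θ => ?_⟩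
  · have hnhds : D m ∩ {m | 1 < ‖m‖} ∈ 𝓝 m := ((hC m).isOpen.inter hout).mem_nhds ⟨hD m, hm⟩
    refine (((hC m).differentiableOn p).differentiableAt hnhds).differentiableWithinAt.congr_of_eventuallyEq
      ?_ rfl
    filter_upwards [mem_nhdsWithin_of_mem_nhds hnhds] with z hz
    rw [heq m z hz.1 hz.2]
  · set e := Complex.exp (θ * Complex.I) with he
    have h1 := (hC e).continuousOn (e, p) ⟨⟨hD e, (norm_exp_angle θ).ge⟩, trivial⟩
    rw [ContinuousWithinAt, nhdsWithin_prod_eq, nhdsWithin_univ] at h1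
    have hnhds : D e ∈ 𝓝 e := (hC e).isOpen.mem_nhds (hD e)
    have hle : 𝓝[{m : ℂ | 1 < ‖m‖}] e ≤ 𝓝[D e ∩ {m | 1 ≤ ‖m‖}] e := by
      rw [nhdsWithin_inter_of_mem (mem_nhdsWithin_of_mem_nhds hnhds)]
      exact nhdsWithin_mono e fun m hm => le_of_lt (show 1 < ‖m‖ from hm)
    refine (h1.mono_left (prod_mono_left _ hle)).congr' ?_
    have hev : ∀ᶠ m in 𝓝[{m : ℂ | 1 < ‖m‖}] e, m ∈ D e ∩ {m | 1 < ‖m‖} :=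
      inter_mem (mem_nhdsWithin_of_mem_nhds hnhds) self_mem_nhdsWithin
    filter_upwards [hev.prod_inl (𝓝 p)] with z hz
    rw [heq e z.1 hz.1 hz.2]
  · exact ((hC _).contDiff _ (hD _) (norm_exp_angle θ).ge).continuous
  · exact isUnit_of_norm_sub_one_lt (((hC _).near_one _ (hD _) (norm_exp_angle θ).ge p).trans_lt hq)
  · exact norm_star_mul_self_sub_one_le ((hC _).near_one _ (hD _) (norm_exp_angle θ).ge p)
  · obtain ⟨v, hv, hlim⟩ := (hC _).tendsto_line θ (hD _)
    refine tendsto_of_hasLineDerivAt (hder θ) hv ?_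
    simpa using hlim.star.mul hlim

/-- The right factor `c` restores the normalization at infinity. The scattering matrix only changes
by conjugation with the constant unitary `c`, as `u` cancels in `T* T`; hence all its properties and
its distance from `1` are preserved. -/
theorem HasUpperFrames.gauge {P Q : SpatialPair n} {u : ℝ × ℝ → Mat n} {q : ℝ}
    {E : ℂ → ℝ × ℝ → Mat n} {T : ℝ → ℝ × ℝ → Mat n} (h : HasUpperFrames Q q E T)
    (hg : IsGaugeTransform u P Q) {c : Mat n} (hc : c ∈ Matrix.unitaryGroup (Fin n) ℂ)
    (hu : Tendsto u (cocompact (ℝ × ℝ)) (𝓝 c)) :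
    HasUpperFrames P q (fun m p => star (u p) * E m p * c) fun θ p => star (u p) * T θ p * c := by
  have hcu : IsUnit c := IsUnit.of_mul_eq_one _ (Unitary.mul_star_self_of_mem hc)
  have huc : Continuous fun p => star (u p) := hg.smooth.continuous.star
  have hS : ∀ θ p, star (star (u p) * T θ p * c) * (star (u p) * T θ p * c) =
      star c * (star (T θ p) * T θ p) * c := fun θ p => by
    simp only [star_mul, star_star, mul_assoc]
    rw [← mul_assoc (u p), hg.mul_star_self, one_mul]
  refine ⟨fun m hm => hg.isFrameAt hc hu (h.isFrameAt m hm),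
    fun p => ((h.differentiableOn p).const_mul _).mul_const _, fun θ p => ?_,
    fun θ => (huc.mul (h.continuous θ)).mul continuous_const, fun θ p =>
    ((IsUnit.of_mul_eq_one _ (hg.star_mul_self p)).mul (h.isUnit θ p)).mul hcu, fun θ p => ?_,
    fun θ p => ?_, fun θ => ?_⟩
  · have h1 : Tendsto (fun z : ℂ × ℝ × ℝ => star (u z.2))
        (𝓝[{m | 1 < ‖m‖}] Complex.exp (θ * Complex.I) ×ˢ 𝓝 p) (𝓝 (star (u p))) :=
      (huc.tendsto p).comp tendsto_snd
    exact (h1.mul (h.tendsto θ p)).mul_const c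
  · have h1 : star c * (star (T θ p) * T θ p) * c - 1 =
        star c * (star (T θ p) * T θ p - 1) * c := by
      rw [mul_sub, sub_mul, mul_one, Unitary.star_mul_self_of_mem hc]
    rw [hS, h1, CStarRing.norm_mul_mem_unitary _ hc,
      CStarRing.norm_mem_unitary_mul _ (Unitary.star_mem hc)]
    exact h.near_one θ p
  · simp only [hS]
    have h1 : HasDerivAt _ _ _ := h.hasLineDerivAt θ p
    have h2 := (h1.const_mul (star c)).mul_const c
    simpa [HasLineDerivAt] using h2
  · simp only [hS]
    have h1 := ((h.tendsto_one θ).const_mul (star c)).mul_const c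
    rwa [mul_one, Unitary.star_mul_self_of_mem hc] at h1

theorem star_matrix_inv (A : Mat n) : star A⁻¹ = (star A)⁻¹ := Matrix.conjTranspose_nonsing_inv A

theorem IsFrameAt.isSpatialFrame {P : SpatialPair n} {m : ℂ} (hm : m ≠ 0) {E : ℝ × ℝ → Mat n}
    (h : IsFrameAt P m E) : IsSpatialFrame P m E :=
  ⟨h.contDiff, fun p => (spatialOp_eq_zero_iff hm).2 (h.isSolAt p), h.tendsto_one⟩

theorem tendstoLocallyUniformly_of_tendsto_prod {ι : Type*} {l : Filter ι}
    {F : ι → ℝ × ℝ → Mat n} {f : ℝ × ℝ → Mat n} (hf : Continuous f)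
    (h : ∀ p, Tendsto (fun z : ι × ℝ × ℝ => F z.1 z.2) (l ×ˢ 𝓝 p) (𝓝 (f p))) :
    TendstoLocallyUniformly F f l := by
  refine tendstoLocallyUniformly_iff_forall_tendsto.2 fun p => ?_
  have h1 : Tendsto (fun z : ι × ℝ × ℝ => f z.2) (l ×ˢ 𝓝 p) (𝓝 (f p)) :=
    (hf.tendsto p).comp tendsto_snd
  exact ((h1.prodMk_nhds (h p)).mono_right (nhds_le_uniformity _))

/-- The frames outside and their reflections inside the unit disc make up continuous scattering
data. -/
theorem HasUpperFrames.hasContinuousScatteringData {P : SpatialPair n} {q : ℝ}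
    {E : ℂ → ℝ × ℝ → Mat n} {T : ℝ → ℝ × ℝ → Mat n} (h : HasUpperFrames P q E T) :
    HasContinuousScatteringData P fun θ p => star (T θ p) * T θ p := by
  classical
  have hinner : ∀ m ∈ innerAnnulus 1, m ≠ 0 ∧ ‖m‖ < 1 ∧ 1 < ‖(starRingEnd ℂ m)⁻¹‖ := fun m hm => by
    have h0 : m ≠ 0 := fun h0 => by
      have := hm.1
      rw [h0] at this
      norm_num at this
    have h1 := hm.1
    exact ⟨h0, (one_lt_inv₀ (norm_pos_iff.2 h0)).1 h1, by simpa using h1⟩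
  have houter : ∀ m ∈ outerAnnulus 1, m ≠ 0 ∧ 1 < ‖m‖ := fun m hm =>
    ⟨norm_pos_iff.1 (one_pos.trans hm.1), hm.1⟩
  -- The frames outside the disc are extended inside by reflection; values on the circle itself play
  -- no role.
  obtain ⟨E', hup, hlow⟩ : ∃ E' : ℂ → ℝ × ℝ → Mat n, (∀ m, 1 < ‖m‖ → E' m = E m) ∧
      ∀ m, ‖m‖ < 1 → E' m = fun p => (star (E (starRingEnd ℂ m)⁻¹ p))⁻¹ :=
    ⟨fun m => if 1 < ‖m‖ then E m else fun p => (star (E (starRingEnd ℂ m)⁻¹ p))⁻¹,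
      fun m hm => if_pos hm, fun m hm => if_neg hm.le.not_gt⟩
  have hframe : ∀ m ∈ outerAnnulus 1 ∪ innerAnnulus 1, IsFrameAt P m (E' m) := by
    rintro m (hm | hm)
    · rw [hup m hm.1]; exact h.isFrameAt m hm.1
    · obtain ⟨h0, h1, h2⟩ := hinner m hm
      rw [hlow m h1]
      have h3 := (h.isFrameAt _ h2).star_inv
      have h4 : conjInv (((starRingEnd ℂ m)⁻¹ : ℂ) : OnePoint ℂ) = m := by
        simp [conjInv, h0]
      rwa [h4] at h3
  refine ⟨1, one_pos, E', T, fun θ p => (star (T θ p))⁻¹, fun m hm => ?_, fun m hm p => ?_,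
    fun p => ?_, fun p => ?_, fun θ => ?_, fun θ => ?_, fun θ p => ?_⟩
  · refine (hframe m hm).isSpatialFrame ?_
    rcases hm with hm | hm
    · exact (houter m hm).1
    · exact (hinner m hm).1
  · refine ⟨(hframe m hm).isUnit p, ?_⟩
    rcases hm with hm | hm
    · have h1 : ‖(starRingEnd ℂ m)⁻¹‖ < 1 := by
        rw [norm_inv, RCLike.norm_conj]
        exact inv_lt_one_of_one_lt₀ hm.1
      rw [hlow _ h1, hup m hm.1]
      simp
    · obtain ⟨h0, h1, h2⟩ := hinner m hm
      rw [hup _ h2, hlow m h1, star_matrix_inv, star_star,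
        Matrix.nonsing_inv_nonsing_inv _ ((Matrix.isUnit_iff_isUnit_det _).1
          ((h.isFrameAt _ h2).isUnit p))]
  · exact ((h.differentiableOn p).mono fun m hm => hm.1).congr fun m hm => by rw [hup m hm.1]
  · intro m hm
    obtain ⟨h0, h1, h2⟩ := hinner m hm
    have hout : IsOpen {m : ℂ | 1 < ‖m‖} := isOpen_lt continuous_const continuous_norm
    have hw : starRingEnd ℂ m ≠ 0 := by simpa using h0
    have hE : DifferentiableAt ℂ (fun z => E z p) (starRingEnd ℂ m)⁻¹ :=
      (h.differentiableOn p).differentiableAt (hout.mem_nhds h2)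
    -- The map `z ↦ (E_{1/z})⁻¹` is holomorphic near `m̄`. Conjugating the argument and taking the
    -- adjoint of the value keeps it holomorphic and yields the reflected frame near `m`.
    have hk : DifferentiableAt ℂ (fun z => (E z⁻¹ p)⁻¹) (starRingEnd ℂ m) := by
      have hr : (fun z => (E z⁻¹ p)⁻¹) = fun z => Ring.inverse (E z⁻¹ p) :=
        funext fun z => Matrix.nonsing_inv_eq_ringInverse _
      rw [hr]
      have h3 : DifferentiableAt ℂ (fun z => E z⁻¹ p) (starRingEnd ℂ m) :=
        DifferentiableAt.comp (starRingEnd ℂ m) hE (differentiableAt_inv hw)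
      refine DifferentiableAt.comp (g := Ring.inverse) (starRingEnd ℂ m) ?_ h3
      obtain ⟨w, hw⟩ := (h.isFrameAt _ h2).isUnit p
      rw [← hw]
      exact differentiableAt_inverse w.isUnit
    have hs := hk.star_conj
    rw [Complex.conj_conj] at hs
    refine (hs.differentiableWithinAt (s := innerAnnulus 1)).congr (fun z hz => ?_) ?_
    · rw [hlow z (hinner z hz).2.1]
      simp [star_matrix_inv]
    · rw [hlow m h1]
      simp [star_matrix_inv]
  · refine tendstoLocallyUniformly_of_tendsto_prod (h.continuous θ) fun p => ?_
    have h1 := (h.tendsto θ p).mono_left (prod_mono_left (𝓝 p)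
      (nhdsWithin_mono (Complex.exp (θ * Complex.I))
        (fun m hm => hm.1 : outerAnnulus 1 ⊆ {m | 1 < ‖m‖})))
    refine h1.congr' ?_
    have hev : ∀ᶠ m in 𝓝[outerAnnulus 1] Complex.exp (θ * Complex.I), m ∈ outerAnnulus 1 :=
      self_mem_nhdsWithin
    filter_upwards [hev.prod_inl (𝓝 p)] with z hz
    rw [hup z.1 hz.1]
  · have hu := fun p => (h.isUnit θ p).star
    have hcont : Continuous fun p => (star (T θ p))⁻¹ := continuous_iff_continuousAt.2 fun p =>
      tendsto_matrix_inv ((h.continuous θ).star.tendsto p) (hu p)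
    refine tendstoLocallyUniformly_of_tendsto_prod hcont fun p => ?_
    have hmap : Tendsto (fun m : ℂ => (starRingEnd ℂ m)⁻¹)
        (𝓝[innerAnnulus 1] Complex.exp (θ * Complex.I))
        (𝓝[{m | 1 < ‖m‖}] Complex.exp (θ * Complex.I)) := by
      refine tendsto_nhdsWithin_iff.2 ⟨?_, ?_⟩
      · have hne : starRingEnd ℂ (Complex.exp (θ * Complex.I)) ≠ 0 := by simp
        have h1 : Tendsto (fun m : ℂ => (starRingEnd ℂ m)⁻¹) (𝓝 (Complex.exp (θ * Complex.I)))
            (𝓝 (starRingEnd ℂ (Complex.exp (θ * Complex.I)))⁻¹) :=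
          (Complex.continuous_conj.tendsto _).inv₀ hne
        have h2 : (starRingEnd ℂ (Complex.exp (θ * Complex.I)))⁻¹ = Complex.exp (θ * Complex.I) := by
          rw [← Complex.exp_conj, ← Complex.exp_neg]; simp
        rw [h2] at h1
        exact h1.mono_left nhdsWithin_le_nhds
      · filter_upwards [self_mem_nhdsWithin] with m hm
        exact (hinner m hm).2.2
    have h1 : Tendsto (fun z : ℂ × ℝ × ℝ => E (starRingEnd ℂ z.1)⁻¹ z.2)
        (𝓝[innerAnnulus 1] Complex.exp (θ * Complex.I) ×ˢ 𝓝 p) (𝓝 (T θ p)) :=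
      (h.tendsto θ p).comp (hmap.prodMap tendsto_id)
    refine (tendsto_matrix_inv h1.star (hu p)).congr' ?_
    have hev : ∀ᶠ m in 𝓝[innerAnnulus 1] Complex.exp (θ * Complex.I), m ∈ innerAnnulus 1 :=
      self_mem_nhdsWithin
    filter_upwards [hev.prod_inl (𝓝 p)] with z hz
    rw [hlow z.1 (hinner z.1 hz).2.1]
  · have hu := (h.isUnit θ p).star
    refine ⟨(Matrix.isUnit_nonsing_inv_iff).2 hu, ?_, rfl⟩
    rw [Matrix.nonsing_inv_nonsing_inv _ ((Matrix.isUnit_iff_isUnit_det _).1 hu)]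

/-- A small spatial pair has a frame at every spectral parameter off the unit circle. -/
theorem exists_isFrameAt {P : SpatialPair n} {q : ℝ} {E : ℂ → ℝ × ℝ → Mat n}
    {T : ℝ → ℝ × ℝ → Mat n} (h : HasUpperFrames P q E T)
    (hinf : ∃ F, IsFrameAt P OnePoint.infty F) {μ : OnePoint ℂ}
    (hμ : μ ∉ ((↑) : ℂ → OnePoint ℂ) '' Metric.sphere (0 : ℂ) 1) : ∃ F, IsFrameAt P μ F := by
  induction μ using OnePoint.rec with
  | infty => exact hinf
  | coe m =>
    rcases lt_trichotomy ‖m‖ 1 with hm | hm | hm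
    · by_cases h0 : m = 0
      · obtain ⟨F, hF⟩ := hinf
        rw [h0]
        exact ⟨_, hF.star_inv⟩
      · have h2 : 1 < ‖(starRingEnd ℂ m)⁻¹‖ := by
          rw [norm_inv, RCLike.norm_conj]
          exact (one_lt_inv₀ (norm_pos_iff.2 h0)).2 hm
        have h3 := (h.isFrameAt _ h2).star_inv
        have h4 : conjInv (((starRingEnd ℂ m)⁻¹ : ℂ) : OnePoint ℂ) = m := by
          simp [conjInv, h0]
        rw [h4] at h3
        exact ⟨_, h3⟩
    · exact absurd ⟨m, by simpa using hm, rfl⟩ hμ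
    · exact ⟨_, h.isFrameAt m hm⟩

/-- The theorem at a single time. -/
theorem exists_delta (n : ℕ) {ε : ℝ} (hε : 0 < ε) : ∃ δ : ℝ, 0 < δ ∧ ∀ (P Q : SpatialPair n)
    (u : ℝ × ℝ → Mat n), IsGaugeTransform u P Q → Q.normW21 < ENNReal.ofReal δ →
    (∀ μ : OnePoint ℂ, μ ∉ ((↑) : ℂ → OnePoint ℂ) '' Metric.sphere (0 : ℂ) 1 →
      ∃ F, IsFrameAt P μ F) ∧ ∃ E T, HasUpperFrames P ε E T := by
  -- The frames are within `q = 2η ≤ 1/2` of `1`, hence invertible, and the scattering matrix is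
  -- within `q² + 2q = 4η² + 4η ≤ 5η ≤ ε` of `1`.
  set η := min (1 / 4) (ε / 8) with hη
  have hη0 : 0 < η := lt_min (by norm_num) (by positivity)
  have hη1 : η ≤ 1 / 4 := min_le_left _ _
  have hη2 : η ≤ ε / 8 := min_le_right _ _
  have hpi := Real.pi_pos
  refine ⟨η / (3 * Real.pi), by positivity, fun P Q u hg hQ => ?_⟩
  have hδ : Real.pi * (3 * (η / (3 * Real.pi))) ≤ η := by
    apply le_of_eq; field_simp
  obtain ⟨E, T, hET⟩ := exists_hasUpperFrames (q := 2 * η) (by linarith)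
    (exists_upperChart (by linarith) hδ hQ)
  obtain ⟨c, hc, hu⟩ := hg.exists_limit
  obtain ⟨F, hF1, hF2, hF3, hF4⟩ := exists_frame_infty (by linarith) hδ hQ
  have hF : IsFrameAt Q OnePoint.infty F :=
    ⟨hF1, fun p => isUnit_of_norm_sub_one_lt ((hF3 p).trans_lt (by linarith)), hF2, hF4⟩
  refine ⟨fun μ hμ => ?_, fun m p => star (u p) * E m p * c, fun θ p => star (u p) * T θ p * c, ?_⟩
  · obtain ⟨F', hF'⟩ := exists_isFrameAt hET ⟨F, hF⟩ hμ
    exact ⟨_, hg.isFrameAt hc hu hF'⟩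
  · have h := hET.gauge hg hc hu
    exact { h with near_one := fun θ p => (h.near_one θ p).trans (by nlinarith) }

end Scattering

end Monopole

theorem mainTheorem4 (n : ℕ) (ε : ℝ) (hε : 0 < ε) :
    ∃ δ : ℝ, 0 < δ ∧
      ∀ (J : Set ℝ) (P : ℝ → Monopole.SpatialPair n),
        (∀ t ∈ J, ∃ (u : ℝ × ℝ → Monopole.Mat n) (Q : Monopole.SpatialPair n),
          Monopole.IsGaugeTransform u (P t) Q ∧ Q.normW21 < ENNReal.ofReal δ) →
        (∀ t ∈ J, ∀ μ : OnePoint ℂ, μ ∉ ((↑) : ℂ → OnePoint ℂ) '' Metric.sphere (0 : ℂ) 1 →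
          ∀ c : Fin n → ℤ, Monopole.IsChernVector (P t) μ c ↔ c = 0) ∧
        ∃ S : ℝ → ℝ → ℝ × ℝ → Monopole.Mat n,
          (∀ t ∈ J, Monopole.HasContinuousScatteringData (P t) (S t)) ∧
          (∀ t ∈ J, ∀ (θ : ℝ) (p : ℝ × ℝ), ‖S t θ p - 1‖ ≤ ε) ∧
          (∀ t ∈ J, ∀ (θ : ℝ) (p : ℝ × ℝ), star (S t θ p) = S t θ p ∧ (S t θ p).PosSemidef) ∧
          (∀ t ∈ J, ∀ (θ : ℝ) (p : ℝ × ℝ),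
            HasLineDerivAt ℝ (S t θ) 0 p (-Real.sin θ, Real.cos θ)) ∧
          ∀ t ∈ J, ∀ θ : ℝ, Tendsto (S t θ)
            (comap (fun p : ℝ × ℝ => p.1 * Real.cos θ + p.2 * Real.sin θ) (cocompact ℝ))
            (𝓝 1) := by
  classical
  obtain ⟨δ, hδ, hmain⟩ := Monopole.exists_delta n hε
  refine ⟨δ, hδ, fun J P hJ => ⟨fun t ht μ hμ c => ?_, ?_⟩⟩
  · obtain ⟨u, Q, hg, hQ⟩ := hJ t ht
    obtain ⟨F, hF⟩ := (hmain (P t) Q u hg hQ).1 μ hμ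
    exact hF.isChernVector_iff (Monopole.im_coef_ne_zero hμ) c
  -- The scattering matrix must be a function of all real `t`; outside `J` it is filled in with a
  -- constant.
  · have hex : ∀ t, ∃ T : ℝ → ℝ × ℝ → Monopole.Mat n,
        t ∈ J → ∃ E, Monopole.HasUpperFrames (P t) ε E T := fun t => by
      by_cases ht : t ∈ J
      · obtain ⟨u, Q, hg, hQ⟩ := hJ t ht
        obtain ⟨E, T, h⟩ := (hmain (P t) Q u hg hQ).2
        exact ⟨T, fun _ => ⟨E, h⟩⟩
      · exact ⟨fun _ _ => 1, fun h => absurd h ht⟩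
    choose T hT using hex
    refine ⟨fun t θ p => star (T t θ p) * T t θ p, fun t ht => ?_, fun t ht => ?_,
      fun t _ θ p => ⟨by simp, Matrix.posSemidef_conjTranspose_mul_self _⟩, fun t ht => ?_,
      fun t ht => ?_⟩
    all_goals obtain ⟨E, h⟩ := hT t ht
    · exact h.hasContinuousScatteringData
    · exact h.near_one
    · exact h.hasLineDerivAt
    · exact h.tendsto_one
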